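/- Let $p$ be a prime. Let $|\cdot|_p$ be the $p$-adic absolute value on $\mathbb{Q}_p$, $B(x,r)=\{y\in\mathbb{Q}_p : |x-y|_p\le r\}$, $\mathbb{Z}_p=B(0,1)$, and let $dx$ be the Haar measure on $\mathbb{Q}_p$ with $\int_{\mathbb{Z}_p}dx=1$. Write $\{x\}_p\in[0,1)$ for the $p$-adic fractional part of $x\in\mathbb{Q}_p$ and $e(t)=e^{2\pi i t}$, and put $\widehat{\mu}(s)=\int e(\{xs\}_p)\,d\mu(x)$ for a finite Borel measure $\mu$ on $\mathbb{Q}_p$ and $\widehat{f}(s)=\int e(\{xs\}_p)f(x)\,dx$ for $f\in L^1(\mathbb{Q}_p)$, where $s\in\mathbb{Q}_p$. For $A\subseteq\mathbb{Q}_p$ let $\mathcal{P}(A)$ be the set of Borel probability measures on $\mathbb{Q}_p$ whose support is compact and contained in $A$, and let the Fourier dimension of $A$ be $$\dim_F(A)=\sup\Big\{0\le\beta\le 1 : \sup_{0\ne\xi\in\mathbb{Q}_p}|\widehat{\mu}(\xi)|^2|\xi|_p^{\beta}<\infty\ \text{ for some }\mu\in\mathcal{P}(A)\Big\}.$$ A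 set $A$ is a Salem set if $\dim_F(A)$ equals the Hausdorff dimension $\dim_H(A)$. For $\tau\in\mathbb{R}$ let $$W(\tau)=\big\{x\in\mathbb{Z}_p : |xq-r|_p\le\max(|q|,|r|)^{-\tau}\text{ for infinitely many }(q,r)\in\mathbb{Z}^2\big\}.$$ There is a constant $C>0$, depending only on $p$, such that the following holds for every real $\tau>2$. The set $W(\tau)$ is a Salem set, with $\dim_H W(\tau)=\dim_F W(\tau)=2/\tau$. Moreover, there is a Borel probability measure $\mu$ with compact support contained in $W(\tau)$ such that $$|\widehat{\mu}(\xi)|\le C\,|\xi|_p^{-1/\tau}\ln^2(1+|\xi|_p)\qquad\text{for all }\xi\in\mathbb{Q}_p\text{ with }|\xi|_p\ge 1,$$ $$\mu(B(x,r))\le C\,r^{2/\tau}\ln^2(1+r^{-1})\qquad\text{for all }x\in\mathbb{Q}_p,\ 0<r\le 1,$$ and, for every real $q$ with $1\le q<1+\frac{1}{2\tau-3}$, there is a constant $C'$ (which may depend on $p$, $\tau$ and $q$) such that $$\Big(\int|\widehat{f}(x)|^2\,d\mu(x)\Big)^{1/2}\le C'\,\|f\|_{L^q(\mathbb{Q}_p)}\qquad\text{for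 all }f\in L^q(\mathbb{Q}_p)\cap L^1(\mathbb{Q}_p).$$ -/

import Mathlib

open MeasureTheory
open scoped ENNReal NNReal

noncomputable section

namespace PadicSalem

variable {p : ℕ} [Fact p.Prime]

/-- `ℚ_p` carries its Borel σ-algebra. -/
instance : MeasurableSpace ℚ_[p] := borel ℚ_[p]

instance : BorelSpace ℚ_[p] := ⟨rfl⟩

/-- The number `n` of digits of `x` after the `p`-adic point: `n = -v` if the valuation `v` of `x`
is negative, and `n = 0` otherwise. -/
def fracLen (x : ℚ_[p]) : ℕ := (-x.valuation).toNat

theorem norm_mul_pow_fracLen_le_one (x : ℚ_[p]) : ‖x * (p : ℚ_[p]) ^ fracLen x‖ ≤ 1 := by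
  rcases eq_or_ne x 0 with rfl | hx
  · simp
  · have hp : (p : ℚ_[p]) ≠ 0 := by exact_mod_cast (Fact.out : p.Prime).ne_zero
    rw [Padic.norm_le_one_iff_val_nonneg, Padic.valuation_mul hx (pow_ne_zero _ hp),
      Padic.valuation_pow, Padic.valuation_p]
    unfold fracLen
    omega

/-- The `p`-adic fractional part `{x}_p ∈ [0, 1)`. If `n = fracLen x`, then `x p ^ n` is a `p`-adic
integer; its first `n` digits form the natural number `appr _ n`, and these are the digits of `x`
at the negative powers of `p`. -/
def fracPart (x : ℚ_[p]) : ℝ :=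
  (PadicInt.appr ⟨x * (p : ℚ_[p]) ^ fracLen x, norm_mul_pow_fracLen_le_one x⟩ (fracLen x) : ℝ) /
    (p : ℝ) ^ fracLen x

/-- The character `x ↦ e({x}_p)`, where `e(t) = exp(2πit)`. -/
def stdChar (x : ℚ_[p]) : ℂ := Complex.exp (2 * Real.pi * Complex.I * (fracPart x : ℂ))

/-- The closed unit ball `ℤ_p` of `ℚ_p`, as a compact set with nonempty interior. -/
def unitBall (p : ℕ) [Fact p.Prime] : TopologicalSpace.PositiveCompacts ℚ_[p] where
  carrier := Metric.closedBall 0 1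
  isCompact' := isCompact_closedBall 0 1
  interior_nonempty' :=
    ⟨0, Metric.ball_subset_interior_closedBall (Metric.mem_ball_self one_pos)⟩

/-- The Haar measure on `ℚ_p` that gives `ℤ_p` measure `1`. -/
def haar (p : ℕ) [Fact p.Prime] : Measure ℚ_[p] := Measure.addHaarMeasure (unitBall p)

/-- The Fourier transform of a finite Borel measure on `ℚ_p`. -/
def fourierMeasure (μ : Measure ℚ_[p]) (s : ℚ_[p]) : ℂ := ∫ x, stdChar (x * s) ∂μ

/-- The Fourier transform of an integrable function on `ℚ_p`. -/
def fourierFun (f : ℚ_[p] → ℂ) (s : ℚ_[p]) : ℂ := ∫ x, stdChar (x * s) * f x ∂(haar p)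

/-- The Borel probability measures on `ℚ_p` with compact support contained in `A`. -/
def probOn (A : Set ℚ_[p]) : Set (Measure ℚ_[p]) :=
  {μ | IsProbabilityMeasure μ ∧ IsCompact μ.support ∧ μ.support ⊆ A}

/-- The Fourier dimension of a subset of `ℚ_p`. -/
def fourierDim (A : Set ℚ_[p]) : ℝ :=
  sSup {β : ℝ | 0 ≤ β ∧ β ≤ 1 ∧
    ∃ μ ∈ probOn A, ∃ C : ℝ, ∀ ξ : ℚ_[p], ξ ≠ 0 → ‖fourierMeasure μ ξ‖ ^ 2 * ‖ξ‖ ^ β ≤ C}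

/-- A Salem set: the Hausdorff and Fourier dimensions coincide. -/
def IsSalem (A : Set ℚ_[p]) : Prop := dimH A = ENNReal.ofReal (fourierDim A)

/-- The set `W(τ)` of `τ`-well-approximable `p`-adic integers. -/
def wellApprox (p : ℕ) [Fact p.Prime] (τ : ℝ) : Set ℚ_[p] :=
  {x | ‖x‖ ≤ 1 ∧
    {z : ℤ × ℤ | ‖x * (z.1 : ℚ_[p]) - (z.2 : ℚ_[p])‖ ≤
      ((max |z.1| |z.2| : ℤ) : ℝ) ^ (-τ)}.Infinite}

end PadicSalem

end

open MeasureTheory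
open scoped ENNReal NNReal

noncomputable section

namespace PadicSalem

variable {p : ℕ} [Fact p.Prime]

/-! The measure is built from the fractions `r / q` themselves. For large `N`, take `q` prime in
`(2p^N, p^(N+4)]` and `r = 1 + a + b` with `a, b < p^N`, all triples being equally likely
(`approxMeasure`). Such `q` are units of `ℤ_p` and `r < q`, so every point within `p^(-τ(N+4))` of
`r / q` satisfies the required inequality with `max(q, r) = q`.

This discrete measure has three properties. It agrees with Haar measure on `ℤ_p` at resolution
`p^(-N)`, so its transform vanishes for `1 < |s| ≤ p^N`. For `|s| = p^m` with `m > N`, the sum over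
`a, b` is a square of a geometric sum, and only those `q` matter for which a certain integer `t_q`
is small. Primes sharing a value of `t_q` all divide one nonzero integer of size at most
`p^(m+N+4)`, so there are `O(m/N)` of them; as the window contains at least `c p^N / N` primes, the
transform is `O(m p^(-N))` (`norm_fourierMeasure_approxMeasure_le`). Finally, two distinct fractions
in one ball of radius `p^(-m)` are far apart as real numbers, because `p^m` divides `rq' - r'q`;
this bounds the mass of balls (`approxMeasure_closedBall_le`).

A measure on `W(τ)` results from iteration. The current density is multiplied by `approxMeasure`,
smoothed at a scale near `τN`, with `N` chosen at least as large as the previous density bound and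
`p^scale`. Integrals of functions constant at a given scale do not change afterwards, so a weak
limit inherits them exactly. Multiplying by a density of scale `n` averages the transform over
shifts `|t| ≤ p^n`, which leave `|s|` unchanged when `|s| > p^n`; the loss is a factor `p^n ≤ N`.
With `m` at most about `τN` this gives decay `m² p^(-m/τ)` and ball mass `m² p^(-2m/τ)`, with
constants independent of `τ` (`exists_salem_measure`).

The ball bound gives `dim_H ≥ 2/τ` by the mass distribution principle, and the Fourier decay gives
`dim_F ≥ 2/τ`. For the upper bounds, the limsup set is covered by balls centred at fractions with
denominator prime to `p`, after solutions divisible by powers of `p` have been reduced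
(`wellApprox_subset`), and `dim_F ≤ dim_H` holds by an energy argument
(`ofReal_le_dimH_of_fourier_decay`).

The restriction estimate follows from the ball and decay bounds alone. The measure is compared with
its average at scale `p^(-k)`: the average has bounded density and is handled by a local Plancherel
inequality, the remainder has small transform and is handled by an `L¹` bound. Choosing `k` for each
dyadic level of `f` gives geometric decay in the level exactly when `q` is below `1 + 1/(2τ-3)`, so
the levels can be summed. -/

theorem one_lt_prime_real (p : ℕ) [Fact p.Prime] : (1 : ℝ) < p :=
  mod_cast (Fact.out : p.Prime).one_lt

theorem prime_real_pos (p : ℕ) [Fact p.Prime] : (0 : ℝ) < p :=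
  zero_lt_one.trans (one_lt_prime_real p)

theorem prime_padic_ne_zero (p : ℕ) [Fact p.Prime] : (p : ℚ_[p]) ≠ 0 :=
  mod_cast (Fact.out : p.Prime).ne_zero

/-! ### Approximation by integers and by fractions with `p`-power denominator. -/

theorem exists_nat_norm_sub_le (x : ℚ_[p]) (hx : ‖x‖ ≤ 1) (n : ℕ) :
    ∃ a : ℕ, a < p ^ n ∧ ‖x - a‖ ≤ (p : ℝ) ^ (-(n : ℤ)) := by
  refine ⟨PadicInt.appr ⟨x, hx⟩ n, PadicInt.appr_lt _ _, ?_⟩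
  have := (PadicInt.norm_le_pow_iff_mem_span_pow _ n).2 (PadicInt.appr_spec n ⟨x, hx⟩)
  rw [PadicInt.norm_def] at this
  exact_mod_cast this

theorem norm_sub_div_pow_le_one_iff (x : ℚ_[p]) (z : ℤ) (m : ℕ) :
    ‖x - z / (p : ℚ_[p]) ^ m‖ ≤ 1 ↔ ‖x * (p : ℚ_[p]) ^ m - z‖ ≤ (p : ℝ) ^ (-(m : ℤ)) := by
  have hp := prime_padic_ne_zero p
  have h : x * (p : ℚ_[p]) ^ m - z = (x - z / (p : ℚ_[p]) ^ m) * (p : ℚ_[p]) ^ m := by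
    field_simp
  rw [h, norm_mul, Padic.norm_p_pow]
  exact (mul_le_iff_le_one_left (zpow_pos (prime_real_pos p) _)).symm

theorem exists_nat_norm_sub_div_le (x : ℚ_[p]) (m : ℕ) (hx : ‖x‖ ≤ (p : ℝ) ^ m) :
    ∃ a : ℕ, a < p ^ m ∧ ‖x - (a : ℤ) / (p : ℚ_[p]) ^ m‖ ≤ 1 := by
  have h1 : ‖x * (p : ℚ_[p]) ^ m‖ ≤ 1 := by
    rw [norm_mul, Padic.norm_p_pow, zpow_neg, zpow_natCast]
    exact mul_inv_le_one_of_le₀ hx (pow_nonneg (prime_real_pos p).le _)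
  obtain ⟨a, ha, h⟩ := exists_nat_norm_sub_le _ h1 m
  exact ⟨a, ha, (norm_sub_div_pow_le_one_iff x a m).2 (by simpa using h)⟩

theorem exists_norm_le_pow (x : ℚ_[p]) : ∃ m : ℕ, ‖x‖ ≤ (p : ℝ) ^ m := by
  obtain ⟨m, hm⟩ := pow_unbounded_of_one_lt ‖x‖ (one_lt_prime_real p)
  exact ⟨m, hm.le⟩

theorem exists_norm_eq_pow (x : ℚ_[p]) (hx : 1 ≤ ‖x‖) : ∃ m : ℕ, ‖x‖ = (p : ℝ) ^ m := by
  have h0 : x ≠ 0 := by rintro rfl; norm_num at hx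
  have h := Padic.norm_eq_zpow_neg_valuation h0
  have hv : 0 ≤ -x.valuation := by
    by_contra! hv
    rw [h] at hx
    exact absurd hx (not_le.2 (zpow_lt_one_of_neg₀ (one_lt_prime_real p) hv))
  lift -x.valuation to ℕ using hv with m hm
  exact ⟨m, by rw [h]; simp⟩

theorem exists_int_norm_sub_div_le (x : ℚ_[p]) :
    ∃ (z : ℤ) (m : ℕ), ‖x - z / (p : ℚ_[p]) ^ m‖ ≤ 1 := by
  obtain ⟨m, hm⟩ := exists_norm_le_pow x
  obtain ⟨a, -, ha⟩ := exists_nat_norm_sub_div_le x m hm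
  exact ⟨a, m, ha⟩

theorem norm_sub_le_of_le {x y : ℚ_[p]} {r : ℝ} (hx : ‖x‖ ≤ r) (hy : ‖y‖ ≤ r) : ‖x - y‖ ≤ r := by
  rw [sub_eq_add_neg]
  exact (Padic.nonarchimedean _ _).trans (max_le hx (by rwa [norm_neg]))

theorem norm_add_le_of_le {x y : ℚ_[p]} {r : ℝ} (hx : ‖x‖ ≤ r) (hy : ‖y‖ ≤ r) : ‖x + y‖ ≤ r :=
  (Padic.nonarchimedean _ _).trans (max_le hx hy)

/-! ### The standard character of `ℚ_p`. -/

/-- A rational number whose denominator is a power of `p` and which is a `p`-adic integer is an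
ordinary integer. This makes the character computable from any representative modulo `ℤ_p`. -/
theorem exp_eq_exp_of_norm_le_one (z w : ℤ) (m n : ℕ)
    (h : ‖(z / (p : ℚ_[p]) ^ m - w / (p : ℚ_[p]) ^ n : ℚ_[p])‖ ≤ 1) :
    Complex.exp (2 * Real.pi * Complex.I * (z / (p : ℂ) ^ m)) =
      Complex.exp (2 * Real.pi * Complex.I * (w / (p : ℂ) ^ n)) := by
  have hp := prime_padic_ne_zero p
  have hpc : (p : ℂ) ≠ 0 := mod_cast (Fact.out : p.Prime).ne_zero
  have e : (z / (p : ℚ_[p]) ^ m - w / (p : ℚ_[p]) ^ n : ℚ_[p]) =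
      0 - ((w * p ^ m - z * p ^ n : ℤ) : ℚ_[p]) / (p : ℚ_[p]) ^ (m + n) := by
    push_cast; field_simp; ring
  rw [e, norm_sub_div_pow_le_one_iff, zero_mul, zero_sub, norm_neg,
    Padic.norm_int_le_pow_iff_dvd] at h
  obtain ⟨k, hk⟩ := h
  rw [Complex.exp_eq_exp_iff_exists_int]
  refine ⟨-k, ?_⟩
  have hk' : (w : ℂ) * p ^ m - z * p ^ n = p ^ (m + n) * k := mod_cast hk
  have : (z : ℂ) / p ^ m = w / p ^ n - k := by
    field_simp
    linear_combination -hk'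
  rw [this]; push_cast; ring

theorem stdChar_eq_exp (x : ℚ_[p]) (z : ℤ) (m : ℕ) (h : ‖x - z / (p : ℚ_[p]) ^ m‖ ≤ 1) :
    stdChar x = Complex.exp (2 * Real.pi * Complex.I * (z / (p : ℂ) ^ m)) := by
  set y : ℤ_[p] := ⟨x * (p : ℚ_[p]) ^ fracLen x, norm_mul_pow_fracLen_le_one x⟩ with hy
  have h1 : ‖x - (y.appr (fracLen x) : ℤ) / (p : ℚ_[p]) ^ fracLen x‖ ≤ 1 := by
    rw [norm_sub_div_pow_le_one_iff]
    have := (PadicInt.norm_le_pow_iff_mem_span_pow _ _).2 (PadicInt.appr_spec (fracLen x) y)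
    rw [PadicInt.norm_def, PadicInt.coe_sub] at this
    simpa only [hy, PadicInt.coe_natCast, Int.cast_natCast] using this
  have h2 := norm_sub_le_of_le h h1
  rw [show x - z / (p : ℚ_[p]) ^ m - (x - (y.appr (fracLen x) : ℤ) / (p : ℚ_[p]) ^ fracLen x) =
    (y.appr (fracLen x) : ℤ) / (p : ℚ_[p]) ^ fracLen x - z / (p : ℚ_[p]) ^ m by ring] at h2
  rw [← exp_eq_exp_of_norm_le_one _ _ _ _ h2]
  simp [stdChar, fracPart, hy]

theorem stdChar_add (x y : ℚ_[p]) : stdChar (x + y) = stdChar x * stdChar y := by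
  have hp := prime_padic_ne_zero p
  have hpc : (p : ℂ) ≠ 0 := mod_cast (Fact.out : p.Prime).ne_zero
  obtain ⟨z, m, hz⟩ := exists_int_norm_sub_div_le x
  obtain ⟨w, n, hw⟩ := exists_int_norm_sub_div_le y
  rw [stdChar_eq_exp x z m hz, stdChar_eq_exp y w n hw,
    stdChar_eq_exp (x + y) (z * p ^ n + w * p ^ m) (m + n), ← Complex.exp_add]
  · congr 1; push_cast; rw [pow_add]; field_simp
  · convert norm_add_le_of_le hz hw using 2
    push_cast; field_simp; ring

theorem norm_stdChar (x : ℚ_[p]) : ‖stdChar x‖ = 1 := by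
  rw [stdChar, show (2 * Real.pi * Complex.I * (fracPart x : ℂ)) =
    ((2 * Real.pi * fracPart x : ℝ) : ℂ) * Complex.I by push_cast; ring]
  exact Complex.norm_exp_ofReal_mul_I _

theorem stdChar_of_norm_le_one {x : ℚ_[p]} (hx : ‖x‖ ≤ 1) : stdChar x = 1 := by
  rw [stdChar_eq_exp x 0 0 (by simpa using hx)]; simp

@[simp] theorem stdChar_zero : stdChar (0 : ℚ_[p]) = 1 := stdChar_of_norm_le_one (by simp)

theorem stdChar_neg (x : ℚ_[p]) : stdChar (-x) = (starRingEnd ℂ) (stdChar x) := by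
  have h : stdChar (-x) * stdChar x = 1 := by rw [← stdChar_add]; simp
  have h2 : (starRingEnd ℂ) (stdChar x) * stdChar x = 1 := by
    rw [mul_comm, Complex.mul_conj, Complex.normSq_eq_norm_sq, norm_stdChar]; simp
  have h0 : stdChar x ≠ 0 := norm_ne_zero_iff.1 (by simp [norm_stdChar])
  exact mul_right_cancel₀ h0 (h.trans h2.symm)

theorem stdChar_sub (x y : ℚ_[p]) : stdChar (x - y) = stdChar x * (starRingEnd ℂ) (stdChar y) := by
  rw [sub_eq_add_neg, stdChar_add, stdChar_neg]

theorem stdChar_inv_prime_ne_one (p : ℕ) [Fact p.Prime] : stdChar ((p : ℚ_[p])⁻¹) ≠ 1 := by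
  have hp1 := (Fact.out : p.Prime).one_lt
  have hpc : (p : ℂ) ≠ 0 := mod_cast (Fact.out : p.Prime).ne_zero
  rw [stdChar_eq_exp _ 1 1 (by simp), Ne, Complex.exp_eq_one_iff]
  rintro ⟨n, hn⟩
  have h2 : (2 * Real.pi * Complex.I) ≠ 0 := Complex.two_pi_I_ne_zero
  have h3 : (1 : ℂ) = n * p := by
    have : ((1 : ℤ) : ℂ) / (p : ℂ) ^ 1 = n := by
      apply mul_left_cancel₀ h2; rw [hn]; ring
    field_simp at this
    simpa [mul_comm] using this
  have h4 : (1 : ℤ) = n * p := mod_cast h3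
  have : (p : ℤ) ∣ 1 := ⟨n, by rw [h4]; ring⟩
  have := Int.le_of_dvd one_pos this
  omega

theorem continuous_stdChar : Continuous (stdChar : ℚ_[p] → ℂ) := by
  rw [continuous_iff_continuousAt]
  intro x
  refine (continuousAt_const (y := stdChar x)).congr ?_
  filter_upwards [Metric.closedBall_mem_nhds x one_pos] with y hy
  rw [Metric.mem_closedBall, dist_eq_norm] at hy
  conv_rhs => rw [← sub_add_cancel y x, stdChar_add, stdChar_of_norm_le_one hy, one_mul]

/-! ### Haar measure of balls and orthogonality of characters. -/

instance : (haar p).IsAddHaarMeasure := by unfold haar; infer_instance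

instance : SigmaFinite (haar p) := by unfold haar; infer_instance

theorem haar_closedBall_center (x : ℚ_[p]) (r : ℝ) :
    haar p (Metric.closedBall x r) = haar p (Metric.closedBall 0 r) := by
  have h := Metric.vadd_closedBall x (0 : ℚ_[p]) r
  rw [vadd_eq_add, add_zero] at h
  rw [← h, measure_vadd]

theorem haar_closedBall_one (x : ℚ_[p]) : haar p (Metric.closedBall x 1) = 1 := by
  rw [haar_closedBall_center]
  exact Measure.addHaarMeasure_self (K₀ := unitBall p)

/-- The push-forward is again translation invariant, so uniqueness of Haar measure leaves only a
constant, which is read off on the unit ball. -/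
theorem map_mul_right_haar {c : ℚ_[p]} (hc : c ≠ 0) :
    (haar p).map (· * c) = haar p (Metric.closedBall 0 ‖c‖⁻¹) • haar p := by
  have hm : Measurable (· * c : ℚ_[p] → ℚ_[p]) := (continuous_mul_const c).measurable
  have hadd : ((haar p).map (· * c)).IsAddLeftInvariant := by
    refine ⟨fun g => ?_⟩
    rw [Measure.map_map (measurable_const_add g) hm]
    have e : ((g + ·) ∘ (· * c) : ℚ_[p] → ℚ_[p]) = (· * c) ∘ (g * c⁻¹ + ·) := by
      ext x; simp only [Function.comp]; field_simp
    rw [e, ← Measure.map_map hm (measurable_const_add _), map_add_left_eq_self]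
  have hsf : SigmaFinite ((haar p).map (· * c)) := by
    have : (haar p).map (· * c) = (haar p).map
      ((Homeomorph.mulRight₀ c hc).toMeasurableEquiv) := rfl
    rw [this]
    exact MeasurableEquiv.sigmaFinite_map _
  have h := Measure.addHaarMeasure_unique ((haar p).map (· * c)) (unitBall p)
  rw [h]
  congr 1
  rw [Measure.map_apply hm (unitBall p).isCompact.measurableSet]
  congr 1
  ext x
  change x * c ∈ Metric.closedBall 0 1 ↔ _
  simp [← one_div, le_div_iff₀ (norm_pos_iff.2 hc)]

theorem measurableSet_closedBall' (x : ℚ_[p]) (r : ℝ) : MeasurableSet (Metric.closedBall x r) :=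
  Metric.isClosed_closedBall.measurableSet

theorem closedBall_one_eq_iUnion (p : ℕ) [Fact p.Prime] (n : ℕ) :
    Metric.closedBall (0 : ℚ_[p]) 1 =
      ⋃ a ∈ Finset.range (p ^ n), Metric.closedBall (a : ℚ_[p]) ((p : ℝ) ^ (-(n : ℤ))) := by
  ext x
  simp only [Metric.mem_closedBall, Set.mem_iUnion, Finset.mem_range, exists_prop, dist_eq_norm,
    sub_zero]
  refine ⟨fun hx => exists_nat_norm_sub_le x hx n, ?_⟩
  rintro ⟨a, -, ha⟩
  rw [← sub_add_cancel x (a : ℚ_[p])]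
  refine norm_add_le_of_le (ha.trans ?_) (by exact_mod_cast Padic.norm_int_le_one (p := p) a)
  exact zpow_le_one_of_nonpos₀ (one_lt_prime_real p).le (by omega)

theorem pairwiseDisjoint_closedBall_nat (p : ℕ) [Fact p.Prime] (n : ℕ) :
    Set.PairwiseDisjoint (Finset.range (p ^ n) : Set ℕ)
      (fun a : ℕ => Metric.closedBall (a : ℚ_[p]) ((p : ℝ) ^ (-(n : ℤ)))) := by
  intro a ha b hb hab
  rw [Function.onFun, Set.disjoint_left]
  intro x hxa hxb
  rw [Metric.mem_closedBall, dist_eq_norm] at hxa hxb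
  have h := norm_sub_le_of_le hxa hxb
  rw [show x - (a : ℚ_[p]) - (x - b) = ((b - a : ℤ) : ℚ_[p]) by push_cast; ring,
    Padic.norm_int_le_pow_iff_dvd] at h
  apply hab
  have ha' : a < p ^ n := by simpa using ha
  have hb' : b < p ^ n := by simpa using hb
  have : a ≡ b [MOD p ^ n] := (Nat.modEq_iff_dvd).2 (by exact_mod_cast h)
  exact Nat.ModEq.eq_of_lt_of_lt this ha' hb'

/-- The unit ball is a disjoint union of `p ^ n` translates of such a ball. -/
theorem haar_closedBall_neg (x : ℚ_[p]) (n : ℕ) :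
    haar p (Metric.closedBall x ((p : ℝ) ^ (-(n : ℤ)))) = ENNReal.ofReal ((p : ℝ) ^ (-(n : ℤ))) := by
  have h := haar_closedBall_one (0 : ℚ_[p])
  rw [closedBall_one_eq_iUnion p n, measure_biUnion_finset (pairwiseDisjoint_closedBall_nat p n)
    (fun _ _ => measurableSet_closedBall' _ _)] at h
  rw [haar_closedBall_center]
  simp_rw [haar_closedBall_center (p := p) (Nat.cast _)] at h
  rw [Finset.sum_const, Finset.card_range, nsmul_eq_mul] at h
  rw [zpow_neg, zpow_natCast, ENNReal.ofReal_inv_of_pos (pow_pos (prime_real_pos p) n),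
    ENNReal.ofReal_pow (prime_real_pos p).le, ENNReal.ofReal_natCast]
  rw [mul_comm] at h
  simpa using ENNReal.eq_inv_of_mul_eq_one_left h

theorem haar_closedBall (x : ℚ_[p]) (k : ℤ) :
    haar p (Metric.closedBall x ((p : ℝ) ^ k)) = ENNReal.ofReal ((p : ℝ) ^ k) := by
  obtain ⟨n, rfl | rfl⟩ := Int.eq_nat_or_neg k
  swap
  · exact haar_closedBall_neg x n
  rw [haar_closedBall_center]
  have hp := prime_padic_ne_zero p
  have hpn : (p : ℚ_[p]) ^ n ≠ 0 := pow_ne_zero _ hp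
  have h := map_mul_right_haar hpn
  have h2 := congrArg (fun ν => ν (Metric.closedBall (0 : ℚ_[p]) ((p : ℝ) ^ (-(n : ℤ))))) h
  simp only [Measure.smul_apply, smul_eq_mul] at h2
  rw [Measure.map_apply (continuous_mul_const _).measurable (measurableSet_closedBall' _ _),
    haar_closedBall_neg] at h2
  have e : (fun x : ℚ_[p] => x * (p : ℚ_[p]) ^ n) ⁻¹' Metric.closedBall 0 ((p : ℝ) ^ (-(n : ℤ))) =
      Metric.closedBall 0 1 := by
    ext x
    simp only [Set.mem_preimage, Metric.mem_closedBall, dist_zero_right, norm_mul,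
      Padic.norm_p_pow]
    exact mul_le_iff_le_one_left (zpow_pos (prime_real_pos p) _)
  rw [e, haar_closedBall_one, Padic.norm_p_pow, zpow_neg, inv_inv] at h2
  rw [ENNReal.eq_inv_of_mul_eq_one_left h2.symm,
    ENNReal.ofReal_inv_of_pos (zpow_pos (prime_real_pos p) _), inv_inv]

theorem haar_real_closedBall (x : ℚ_[p]) (k : ℤ) :
    (haar p).real (Metric.closedBall x ((p : ℝ) ^ k)) = (p : ℝ) ^ k := by
  rw [Measure.real, haar_closedBall, ENNReal.toReal_ofReal (zpow_pos (prime_real_pos p) _).le]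

theorem map_mul_right_haar_of_norm_eq_one {c : ℚ_[p]} (hc : ‖c‖ = 1) :
    (haar p).map (· * c) = haar p := by
  rw [map_mul_right_haar (norm_ne_zero_iff.1 (by simp [hc])), hc, inv_one, haar_closedBall_one,
    one_smul]

theorem setIntegral_closedBall_stdChar (x : ℚ_[p]) (k : ℤ) :
    ∫ t in Metric.closedBall 0 ((p : ℝ) ^ k), stdChar (x * t) ∂haar p =
      if ‖x‖ ≤ (p : ℝ) ^ (-k) then ((p : ℝ) ^ k : ℂ) else 0 := by
  have hp := prime_padic_ne_zero p
  have hpp := prime_real_pos p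
  have hk : 0 < (p : ℝ) ^ k := zpow_pos hpp _
  split_ifs with hx
  · rw [setIntegral_congr_fun (g := fun _ => (1 : ℂ)) (measurableSet_closedBall' _ _)]
    · rw [setIntegral_const, haar_real_closedBall]; simp
    · intro t ht
      refine stdChar_of_norm_le_one ?_
      rw [Metric.mem_closedBall, dist_zero_right] at ht
      rw [norm_mul]
      calc ‖x‖ * ‖t‖ ≤ (p : ℝ) ^ (-k) * (p : ℝ) ^ k := by gcongr
        _ = 1 := by rw [← zpow_add₀ hpp.ne']; simp
  · have hx0 : x ≠ 0 := by
      rintro rfl; exact hx (by simpa using (zpow_pos hpp (-k)).le)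
    -- This translation keeps `t` in the ball precisely because `x` lies outside the dual ball, and
    -- it multiplies the integrand by the value of the character at `1 / p`, which is not `1`.
    set y : ℚ_[p] := x⁻¹ * (p : ℚ_[p])⁻¹ with hy
    have hyk : ‖y‖ ≤ (p : ℝ) ^ k := by
      rw [Padic.norm_le_pow_iff_norm_lt_pow_add_one, ← not_le] at hx
      rw [hy, norm_mul, norm_inv, norm_inv, Padic.norm_p, inv_inv]
      rw [not_le, not_lt] at hx
      rw [inv_mul_le_iff₀ (norm_pos_iff.2 hx0)]
      calc (p : ℝ) = (p : ℝ) ^ (-k + 1) * (p : ℝ) ^ k := by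
            rw [← zpow_add₀ hpp.ne']; simp
        _ ≤ _ := by gcongr
    have hball : ∀ t, t + y ∈ Metric.closedBall (0 : ℚ_[p]) ((p : ℝ) ^ k) ↔
        t ∈ Metric.closedBall (0 : ℚ_[p]) ((p : ℝ) ^ k) := by
      intro t
      simp only [Metric.mem_closedBall, dist_zero_right]
      refine ⟨fun h => ?_, fun h => norm_add_le_of_le h hyk⟩
      simpa using norm_sub_le_of_le h hyk
    set I := ∫ t in Metric.closedBall 0 ((p : ℝ) ^ k), stdChar (x * t) ∂haar p with hI
    have key : I = stdChar ((p : ℚ_[p])⁻¹) * I := by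
      conv_lhs => rw [hI, ← integral_indicator (measurableSet_closedBall' _ _),
        ← integral_add_right_eq_self _ y]
      rw [hI, ← integral_const_mul, ← integral_indicator (measurableSet_closedBall' _ _)]
      congr 1
      ext t
      by_cases ht : t ∈ Metric.closedBall (0 : ℚ_[p]) ((p : ℝ) ^ k)
      · rw [Set.indicator_of_mem ht, Set.indicator_of_mem ((hball t).2 ht)]
        rw [mul_add, stdChar_add, mul_comm, hy, mul_inv_cancel_left₀ hx0]
      · rw [Set.indicator_of_notMem ht, Set.indicator_of_notMem (fun h => ht ((hball t).1 h))]
    have h1 : (1 - stdChar ((p : ℚ_[p])⁻¹)) * I = 0 := by linear_combination key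
    rcases mul_eq_zero.1 h1 with h | h
    · exact absurd (sub_eq_zero.1 h).symm (stdChar_inv_prime_ne_one p)
    · exact h

/-! ### Counting primes and counting separated points. -/

open Filter Topology Asymptotics in
-- The error in the lower bound for `θ` is of order `√x log x`; with `x = y ^ 4` it is at most a
-- multiple of `y ^ 3`.
theorem eventually_mul_log_two_div_two_le_theta :
    ∀ᶠ x : ℝ in atTop, x * Real.log 2 / 2 ≤ Chebyshev.theta x := by
  have hl2 : 0 < Real.log 2 := Real.log_pos one_lt_two
  have h1 : (fun x : ℝ => Real.log x) =o[atTop] (fun x : ℝ => x ^ (1 / 4 : ℝ)) :=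
    isLittleO_log_rpow_atTop (by norm_num)
  have h2 := h1.bound (c := 1) one_pos
  have h3 : Tendsto (fun x : ℝ => x ^ (1 / 4 : ℝ)) atTop atTop := tendsto_rpow_atTop (by norm_num)
  filter_upwards [h2, h3.eventually_ge_atTop (20 / Real.log 2), eventually_ge_atTop 2] with
    x hx hx2 hx3
  have hxp : 0 < x := by linarith
  have ht := Chebyshev.theta_ge' (x := x) (by linarith)
  set y := x ^ (1 / 4 : ℝ) with hy
  have hy0 : 0 < y := by positivity
  have hlog : Real.log x ≤ y := by
    have := le_of_abs_le hx
    simpa [abs_of_pos hy0] using this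
  have hxy : x = y ^ 4 := by
    rw [hy, ← Real.rpow_natCast, ← Real.rpow_mul hxp.le]; norm_num
  have hsq : √x = y ^ 2 := by
    rw [hxy, show y ^ 4 = (y ^ 2) ^ 2 by ring, Real.sqrt_sq (by positivity)]
  have hl : Real.log (x + 2) ≤ 2 * y := by
    have : Real.log (x + 2) ≤ Real.log (x * x) := Real.log_le_log (by linarith) (by nlinarith)
    rw [Real.log_mul hxp.ne' hxp.ne'] at this
    linarith
  have hy1 : 1 ≤ y := by
    rw [hy]; exact Real.one_le_rpow (by linarith) (by norm_num)
  have hl20 : 20 ≤ y * Real.log 2 := by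
    rwa [div_le_iff₀ hl2] at hx2
  have hl2' : Real.log 2 < 1 := by linarith [Real.log_two_lt_d9]
  have h4 : 2 * √x * Real.log x ≤ 2 * y ^ 3 := by
    rw [hsq]
    calc 2 * y ^ 2 * Real.log x ≤ 2 * y ^ 2 * y := by gcongr
      _ = _ := by ring
  have h5 : 20 * y ^ 3 ≤ y ^ 4 * Real.log 2 := by
    calc 20 * y ^ 3 ≤ (y * Real.log 2) * y ^ 3 := by gcongr
      _ = _ := by ring
  have h6 : y ≤ y ^ 3 := le_self_pow₀ hy1 (by norm_num)
  have h7 : (1 : ℝ) ≤ y ^ 3 := one_le_pow₀ hy1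
  rw [← hxy] at h5
  linarith

/-- The primes in the interval `(2 p ^ N, p ^ (N + 4)]`. -/
def window (p N : ℕ) : Finset ℕ := {q ∈ Finset.Ioc (2 * p ^ N) (p ^ (N + 4)) | q.Prime}

theorem mem_window {p N q : ℕ} :
    q ∈ window p N ↔ (2 * p ^ N < q ∧ q ≤ p ^ (N + 4)) ∧ q.Prime := by
  simp [window]

/-- Chebyshev's bounds for `θ` at the two ends of the window. The exponent `N + 4` is there because
`p ^ 4 ≥ 16` makes the lower bound at the top twice the upper bound at the bottom. Each prime
contributes at most `(N + 4) log p ≤ 5 N log p`. -/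
theorem exists_le_card_window (p : ℕ) [Fact p.Prime] :
    ∃ c : ℝ, 0 < c ∧ ∃ N₀ : ℕ, ∀ N ≥ N₀, 1 ≤ N → c * (p : ℝ) ^ N / N ≤ (window p N).card := by
  have hp1 := one_lt_prime_real p
  have hl2 : 0 < Real.log 2 := Real.log_pos one_lt_two
  have hlp : 0 < Real.log p := Real.log_pos hp1
  refine ⟨4 * Real.log 2 / (5 * Real.log p), by positivity, ?_⟩
  have h1 : Filter.Tendsto (fun N : ℕ => (p : ℝ) ^ (N + 4)) Filter.atTop Filter.atTop :=
    (tendsto_pow_atTop_atTop_of_one_lt hp1).comp (Filter.tendsto_add_atTop_nat 4)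
  obtain ⟨N₀, hN₀⟩ := Filter.eventually_atTop.1
    (h1.eventually eventually_mul_log_two_div_two_le_theta)
  refine ⟨N₀, fun N hN hN1 => ?_⟩
  have hlow := hN₀ N hN
  have hup := Chebyshev.theta_le_log4_mul_x (x := 2 * (p : ℝ) ^ N) (by positivity)
  have hsub : Chebyshev.theta ((p : ℝ) ^ (N + 4)) ≤ Chebyshev.theta (2 * (p : ℝ) ^ N) +
      ∑ q ∈ window p N, Real.log q := by
    have e1 : ((p : ℝ) ^ (N + 4)) = ((p ^ (N + 4) : ℕ) : ℝ) := by push_cast; ring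
    have e2 : (2 * (p : ℝ) ^ N) = ((2 * p ^ N : ℕ) : ℝ) := by push_cast; ring
    rw [e1, e2, Chebyshev.theta, Chebyshev.theta, Nat.floor_natCast, Nat.floor_natCast, window]
    rw [← Finset.sum_union]
    · refine Finset.sum_le_sum_of_subset_of_nonneg ?_ ?_
      · intro q hq
        simp only [Finset.mem_union, Finset.mem_filter, Finset.mem_Ioc] at hq ⊢
        rcases le_or_gt q (2 * p ^ N) with h | h
        · exact Or.inl ⟨⟨hq.1.1, h⟩, hq.2⟩
        · exact Or.inr ⟨⟨h, hq.1.2⟩, hq.2⟩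
      · intro q _ _
        exact Real.log_natCast_nonneg q
    · rw [Finset.disjoint_left]
      intro q hq hq'
      simp only [Finset.mem_filter, Finset.mem_Ioc] at hq hq'
      omega
  have hsum : ∑ q ∈ window p N, Real.log q ≤ (window p N).card * ((N + 4) * Real.log p) := by
    rw [← nsmul_eq_mul]
    refine Finset.sum_le_card_nsmul _ _ _ fun q hq => ?_
    rw [mem_window] at hq
    calc Real.log q ≤ Real.log ((p : ℝ) ^ (N + 4)) :=
          Real.log_le_log (mod_cast hq.2.pos) (mod_cast hq.1.2)
      _ = _ := by rw [Real.log_pow]; push_cast; ring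
  have hl4 : Real.log 4 = 2 * Real.log 2 := by
    rw [show (4 : ℝ) = 2 ^ 2 by norm_num, Real.log_pow]; norm_num
  have hp4 : (16 : ℝ) ≤ (p : ℝ) ^ 4 := by
    have : (2 : ℝ) ≤ p := mod_cast (Fact.out : p.Prime).two_le
    calc (16 : ℝ) = 2 ^ 4 := by norm_num
      _ ≤ _ := by gcongr
  have hpN : 0 < (p : ℝ) ^ N := by positivity
  have hN1' : (1 : ℝ) ≤ N := mod_cast hN1
  have hcard : (0 : ℝ) ≤ (window p N).card := by positivity
  have h3 : 4 * Real.log 2 * (p : ℝ) ^ N ≤ (window p N).card * (5 * N * Real.log p) := by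
    have a1 : 8 * Real.log 2 * (p : ℝ) ^ N ≤ (p : ℝ) ^ (N + 4) * Real.log 2 / 2 := by
      rw [pow_add]
      have := mul_le_mul_of_nonneg_left hp4 (by positivity : 0 ≤ (p : ℝ) ^ N * Real.log 2 / 2)
      linarith
    have a2 : (window p N).card * ((N + 4) * Real.log p) ≤
        (window p N).card * (5 * N * Real.log p) := by
      gcongr; linarith
    rw [hl4] at hup
    linarith
  rw [div_mul_eq_mul_div, div_div, div_le_iff₀ (by positivity)]
  linarith

/-- Pigeonhole: separated points fall into different cells of length `δ`. -/
theorem card_le_one_add_inv_of_separated {ι : Type*} (S : Finset ι) (f : ι → ℝ) {δ : ℝ}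
    (hδ : 0 < δ) (h01 : ∀ i ∈ S, 0 ≤ f i ∧ f i ≤ 1)
    (hsep : ∀ i ∈ S, ∀ j ∈ S, i ≠ j → δ ≤ |f i - f j|) : (S.card : ℝ) ≤ 1 + 1 / δ := by
  have hcard : S.card ≤ (Finset.range (⌊1 / δ⌋₊ + 1)).card := by
    refine Finset.card_le_card_of_injOn (fun i => ⌊f i / δ⌋₊) ?_ ?_
    · intro i hi
      simp only [Finset.coe_range, Set.mem_Iio]
      refine Nat.lt_succ_of_le (Nat.floor_le_floor ?_)
      exact div_le_div_of_nonneg_right (h01 i hi).2 hδ.le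
    · intro i hi j hj hij
      by_contra hne
      have h := hsep i hi j hj hne
      simp only at hij
      have hi1 := Nat.floor_le (div_nonneg (h01 i hi).1 hδ.le)
      have hi2 := Nat.lt_floor_add_one (f i / δ)
      have hj1 := Nat.floor_le (div_nonneg (h01 j hj).1 hδ.le)
      have hj2 := Nat.lt_floor_add_one (f j / δ)
      rw [hij] at hi1 hi2
      have : |f i / δ - f j / δ| < 1 := by rw [abs_lt]; constructor <;> linarith
      rw [← sub_div, abs_div, abs_of_pos hδ, div_lt_one hδ] at this
      linarith
  rw [Finset.card_range] at hcard
  have h1 : (S.card : ℝ) ≤ ⌊1 / δ⌋₊ + 1 := mod_cast hcard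
  have h2 := Nat.floor_le (one_div_pos.2 hδ).le
  linarith

/-! ### Point masses at fractions with prime denominator. -/

theorem norm_natCast_window {N q : ℕ} (hN : 1 ≤ N) (hq : q ∈ window p N) : ‖(q : ℚ_[p])‖ = 1 := by
  rw [mem_window] at hq
  rw [Padic.norm_natCast_eq_one_iff, Nat.coprime_primes Fact.out hq.2]
  have : p ≤ p ^ N := Nat.le_self_pow (by omega) p
  omega

theorem natCast_window_ne_zero {N q : ℕ} (hq : q ∈ window p N) : (q : ℚ_[p]) ≠ 0 := by
  rw [mem_window] at hq
  exact_mod_cast hq.2.ne_zero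

/-- The rational number `(1 + a + b) / q` in `ℚ_p` attached to a triple `(q, a, b)`. -/
def ratPoint (p : ℕ) [Fact p.Prime] (z : ℕ × ℕ × ℕ) : ℚ_[p] :=
  ((1 + z.2.1 + z.2.2 : ℕ) : ℚ_[p]) / (z.1 : ℚ_[p])

/-- The triples `(q, a, b)` with `q` a prime in the window and `a, b < p ^ N`. -/
def triples (p N : ℕ) : Finset (ℕ × ℕ × ℕ) :=
  window p N ×ˢ (Finset.range (p ^ N) ×ˢ Finset.range (p ^ N))

theorem mem_triples {p N : ℕ} {z : ℕ × ℕ × ℕ} :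
    z ∈ triples p N ↔ z.1 ∈ window p N ∧ z.2.1 < p ^ N ∧ z.2.2 < p ^ N := by
  simp [triples]

theorem card_triples (p N : ℕ) : (triples p N).card = (window p N).card * (p ^ N * p ^ N) := by
  simp [triples]

/-- The uniform distribution on the points `(1 + a + b) / q`, counted with multiplicity. -/
def approxMeasure (p : ℕ) [Fact p.Prime] (N : ℕ) : Measure ℚ_[p] :=
  ((triples p N).card : ℝ≥0∞)⁻¹ • ∑ z ∈ triples p N, Measure.dirac (ratPoint p z)

theorem isProbabilityMeasure_approxMeasure {N : ℕ} (h : (window p N).Nonempty) :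
    IsProbabilityMeasure (approxMeasure p N) := by
  refine ⟨?_⟩
  have h0 : (triples p N).card ≠ 0 := by
    rw [card_triples]
    have := (Fact.out : p.Prime).pos
    have := h.card_pos
    positivity
  rw [approxMeasure, Measure.smul_apply, Measure.finsetSum_apply]
  simp only [measure_univ, Finset.sum_const, nsmul_eq_mul, mul_one, smul_eq_mul]
  exact ENNReal.inv_mul_cancel (by exact_mod_cast h0) (by simp)

theorem integral_approxMeasure {E : Type*} [NormedAddCommGroup E] [NormedSpace ℝ E]
    [CompleteSpace E] (N : ℕ) (φ : ℚ_[p] → E) :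
    ∫ x, φ x ∂approxMeasure p N =
      ((triples p N).card : ℝ)⁻¹ • ∑ z ∈ triples p N, φ (ratPoint p z) := by
  rw [approxMeasure, integral_smul_measure, integral_finsetSum_measure]
  · simp
  · intro z _
    exact integrable_dirac (by simp)

theorem approxMeasure_real_apply (N : ℕ) {S : Set ℚ_[p]} (hS : MeasurableSet S) :
    (approxMeasure p N).real S =
      ((triples p N).card : ℝ)⁻¹ * ∑ z ∈ triples p N, S.indicator 1 (ratPoint p z) := by
  rw [← integral_indicator_one hS, integral_approxMeasure]
  rfl

/-! ### Locally constant functions and equidistribution at scale `p ^ (-N)`. -/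

/-- `φ` is constant on the balls of radius `p ^ (-n)`. -/
def ConstOnBalls {E : Type*} (n : ℕ) (φ : ℚ_[p] → E) : Prop :=
  ∀ x y : ℚ_[p], ‖y - x‖ ≤ (p : ℝ) ^ (-(n : ℤ)) → φ y = φ x

theorem ConstOnBalls.mono {E : Type*} {m n : ℕ} {φ : ℚ_[p] → E} (h : ConstOnBalls m φ)
    (hmn : m ≤ n) : ConstOnBalls n φ := fun x y hxy =>
  h x y (hxy.trans (zpow_le_zpow_right₀ (one_lt_prime_real p).le (by omega)))

theorem ConstOnBalls.continuous {E : Type*} [TopologicalSpace E] {n : ℕ} {φ : ℚ_[p] → E}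
    (h : ConstOnBalls n φ) : Continuous φ := by
  rw [continuous_iff_continuousAt]
  intro x
  refine (continuousAt_const (y := φ x)).congr ?_
  filter_upwards [Metric.closedBall_mem_nhds x (zpow_pos (prime_real_pos p) (-(n : ℤ)))] with y hy
  exact (h x y (by simpa [dist_eq_norm] using hy)).symm

theorem integrableOn_closedBall {E : Type*} [NormedAddCommGroup E] {φ : ℚ_[p] → E}
    (h : Continuous φ) (x : ℚ_[p]) (r : ℝ) : IntegrableOn φ (Metric.closedBall x r) (haar p) :=
  h.continuousOn.integrableOn_compact (isCompact_closedBall x r)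

theorem ConstOnBalls.setIntegral_eq_sum {E : Type*} [NormedAddCommGroup E] [NormedSpace ℝ E]
    [CompleteSpace E] {n : ℕ} {φ : ℚ_[p] → E} (h : ConstOnBalls n φ) :
    ∫ x in Metric.closedBall 0 1, φ x ∂haar p =
      (p : ℝ) ^ (-(n : ℤ)) • ∑ a ∈ Finset.range (p ^ n), φ a := by
  rw [closedBall_one_eq_iUnion p n, integral_biUnion_finset _
    (fun _ _ => measurableSet_closedBall' _ _) (pairwiseDisjoint_closedBall_nat p n)
    (fun _ _ => integrableOn_closedBall h.continuous _ _), Finset.smul_sum]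
  refine Finset.sum_congr rfl fun a _ => ?_
  rw [setIntegral_congr_fun (g := fun _ => φ a) (measurableSet_closedBall' _ _)]
  · rw [setIntegral_const, haar_real_closedBall]
  · intro x hx
    exact h _ _ (by simpa [dist_eq_norm] using hx)

theorem integral_comp_mul_of_norm_eq_one {E : Type*} [NormedAddCommGroup E] [NormedSpace ℝ E]
    {c : ℚ_[p]} (hc : ‖c‖ = 1) (g : ℚ_[p] → E) :
    ∫ x, g (x * c) ∂haar p = ∫ x, g x ∂haar p := by
  have hc0 : c ≠ 0 := norm_ne_zero_iff.1 (by simp [hc])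
  conv_rhs => rw [← map_mul_right_haar_of_norm_eq_one hc]
  exact (integral_map_equiv (Homeomorph.mulRight₀ c hc0).toMeasurableEquiv g).symm

/-- Since `q` is a unit, `a ↦ (b + a) / q` permutes the residues modulo `p ^ n`. In the proof this
is expressed through the invariance of Haar measure under translation and multiplication by units.
-/
theorem ConstOnBalls.sum_range_eq {E : Type*} [NormedAddCommGroup E] [NormedSpace ℝ E]
    [CompleteSpace E] {n : ℕ} {φ : ℚ_[p] → E} (h : ConstOnBalls n φ) {b q : ℚ_[p]}
    (hb : ‖b‖ ≤ 1) (hq : ‖q‖ = 1) :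
    ∑ a ∈ Finset.range (p ^ n), φ ((b + a) / q) =
      (p : ℝ) ^ n • ∫ x in Metric.closedBall 0 1, φ x ∂haar p := by
  have hψ : ConstOnBalls n (fun x => φ ((b + x) / q)) := by
    intro x y hxy
    refine h _ _ ?_
    rw [← sub_div, add_sub_add_left_eq_sub, norm_div, hq, div_one]
    exact hxy
  have h1 := hψ.setIntegral_eq_sum
  have h2 : ∫ x in Metric.closedBall 0 1, φ ((b + x) / q) ∂haar p =
      ∫ x in Metric.closedBall 0 1, φ x ∂haar p := by
    set g := (Metric.closedBall (0 : ℚ_[p]) 1).indicator φ with hg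
    rw [← integral_indicator (measurableSet_closedBall' _ _),
      ← integral_indicator (measurableSet_closedBall' _ _), ← hg,
      ← integral_comp_mul_of_norm_eq_one (c := q⁻¹) (by simp [hq]) g,
      ← integral_add_left_eq_self (fun x => g (x * q⁻¹)) b]
    congr 1
    ext x
    have hiff : x ∈ Metric.closedBall (0 : ℚ_[p]) 1 ↔
        (b + x) / q ∈ Metric.closedBall (0 : ℚ_[p]) 1 := by
      simp only [Metric.mem_closedBall, dist_zero_right, norm_div, hq, div_one]
      refine ⟨fun hx => norm_add_le_of_le hb hx, fun hx => ?_⟩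
      simpa using norm_sub_le_of_le hx hb
    rw [← div_eq_mul_inv, hg]
    by_cases hx : x ∈ Metric.closedBall (0 : ℚ_[p]) 1
    · rw [Set.indicator_of_mem hx, Set.indicator_of_mem (hiff.1 hx)]
    · rw [Set.indicator_of_notMem hx, Set.indicator_of_notMem (fun h => hx (hiff.2 h))]
  rw [← h2, h1, smul_smul, zpow_neg, zpow_natCast,
    mul_inv_cancel₀ (pow_pos (prime_real_pos p) n).ne', one_smul]

/-- For fixed `q` and `a`, letting `b` run alone already gives exact equidistribution modulo `p ^
N`. -/
theorem ConstOnBalls.integral_approxMeasure_eq {E : Type*} [NormedAddCommGroup E]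
    [NormedSpace ℝ E] [CompleteSpace E] {N : ℕ} (hN : 1 ≤ N) (hw : (window p N).Nonempty)
    {φ : ℚ_[p] → E} (h : ConstOnBalls N φ) :
    ∫ x, φ x ∂approxMeasure p N = ∫ x in Metric.closedBall 0 1, φ x ∂haar p := by
  rw [integral_approxMeasure, triples, Finset.sum_product]
  have : ∀ q ∈ window p N, ∑ y ∈ Finset.range (p ^ N) ×ˢ Finset.range (p ^ N),
      φ (ratPoint p (q, y)) =
        ((p : ℝ) ^ N * (p : ℝ) ^ N) • ∫ x in Metric.closedBall 0 1, φ x ∂haar p := by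
    intro q hq
    rw [Finset.sum_product]
    have h2 : ∀ a ∈ Finset.range (p ^ N), ∑ b ∈ Finset.range (p ^ N), φ (ratPoint p (q, a, b)) =
        (p : ℝ) ^ N • ∫ x in Metric.closedBall 0 1, φ x ∂haar p := by
      intro a _
      rw [← h.sum_range_eq (b := ((1 + a : ℕ) : ℚ_[p])) (q := q) _ (norm_natCast_window hN hq)]
      · refine Finset.sum_congr rfl fun b _ => ?_
        simp [ratPoint]
      · exact_mod_cast Padic.norm_int_le_one (p := p) ((1 + a : ℕ) : ℤ)
    rw [Finset.sum_congr rfl h2, Finset.sum_const, Finset.card_range, ← Nat.cast_smul_eq_nsmul ℝ,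
      smul_smul]
    push_cast; rfl
  rw [Finset.sum_congr rfl this, Finset.sum_const, ← Nat.cast_smul_eq_nsmul ℝ, smul_smul, smul_smul,
    ← triples, card_triples]
  have h0 : ((window p N).card : ℝ) ≠ 0 := mod_cast hw.card_pos.ne'
  have hp := (prime_real_pos p).ne'
  push_cast
  rw [mul_assoc, inv_mul_cancel₀ (by positivity), one_smul]

theorem constOnBalls_stdChar {s : ℚ_[p]} {m : ℕ} (hs : ‖s‖ ≤ (p : ℝ) ^ m) :
    ConstOnBalls m (fun x => stdChar (x * s)) := by
  intro x y hxy
  have e : y * s = (y - x) * s + x * s := by ring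
  simp only [e, stdChar_add]
  rw [stdChar_of_norm_le_one, one_mul]
  rw [norm_mul]
  calc ‖y - x‖ * ‖s‖ ≤ (p : ℝ) ^ (-(m : ℤ)) * (p : ℝ) ^ m := by gcongr
    _ = 1 := by rw [zpow_neg, zpow_natCast, inv_mul_cancel₀ (pow_pos (prime_real_pos p) m).ne']

theorem fourierMeasure_approxMeasure_eq_zero {N : ℕ} (hN : 1 ≤ N) (hw : (window p N).Nonempty)
    {s : ℚ_[p]} (h1 : 1 < ‖s‖) (hs : ‖s‖ ≤ (p : ℝ) ^ N) :
    fourierMeasure (approxMeasure p N) s = 0 := by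
  rw [fourierMeasure, (constOnBalls_stdChar hs).integral_approxMeasure_eq hN hw]
  have := setIntegral_closedBall_stdChar s 0
  simp only [zpow_zero, neg_zero, if_neg h1.not_ge] at this
  simpa only [mul_comm] using this

/-! ### Fourier decay of the discrete measures. -/

theorem norm_geom_sum_le (θ : ℝ) (h0 : θ ≠ 0) (h : |θ| ≤ 1 / 2) (R : ℕ) :
    ‖∑ r ∈ Finset.range R, Complex.exp (2 * Real.pi * Complex.I * θ) ^ r‖ ≤ 1 / (2 * |θ|) := by
  set ω := Complex.exp (2 * Real.pi * Complex.I * θ) with hω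
  have hω' : ω = Complex.exp (Complex.I * ((2 * Real.pi * θ : ℝ) : ℂ)) := by
    rw [hω]; congr 1; push_cast; ring
  have hn : ‖ω - 1‖ = 2 * |Real.sin (Real.pi * θ)| := by
    rw [hω', Complex.norm_exp_I_mul_ofReal_sub_one, norm_mul, Real.norm_eq_abs, Real.norm_eq_abs]
    norm_num
    congr 2; ring
  have hsin : 2 * |θ| ≤ |Real.sin (Real.pi * θ)| := by
    have h3 : |Real.sin (Real.pi * θ)| = Real.sin (Real.pi * |θ|) := by
      have hnn : 0 ≤ Real.sin (Real.pi * |θ|) := by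
        apply Real.sin_nonneg_of_nonneg_of_le_pi (by positivity)
        nlinarith [Real.pi_pos]
      rcases abs_cases θ with ⟨e, _⟩ | ⟨e, _⟩
      · rw [e] at hnn ⊢; exact abs_of_nonneg hnn
      · rw [e] at hnn ⊢
        rw [mul_neg, Real.sin_neg] at hnn ⊢
        exact abs_of_nonpos (by linarith)
    rw [h3]
    -- Jordan's inequality, available because `|θ| ≤ 1 / 2`.
    have := Real.mul_le_sin (x := Real.pi * |θ|) (by positivity) (by nlinarith [Real.pi_pos])
    calc 2 * |θ| = 2 / Real.pi * (Real.pi * |θ|) := by field_simp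
      _ ≤ _ := this
  have hθ : 0 < |θ| := abs_pos.2 h0
  have hpos : 0 < ‖ω - 1‖ := by rw [hn]; linarith
  have hne : ω ≠ 1 := fun h => by simp [h] at hpos
  have hω1 : ‖ω‖ = 1 := by rw [hω', mul_comm]; exact Complex.norm_exp_ofReal_mul_I _
  rw [geom_sum_eq hne, norm_div]
  have hnum : ‖ω ^ R - 1‖ ≤ 2 := by
    refine (norm_sub_le _ _).trans ?_
    rw [norm_pow, hω1]; norm_num
  calc ‖ω ^ R - 1‖ / ‖ω - 1‖ ≤ 2 / (4 * |θ|) := by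
        gcongr
        rw [hn]; linarith
    _ = 1 / (2 * |θ|) := by field_simp; norm_num

/-- Modulo `ℤ_p`, `(r / q) s` equals `r j / p ^ m`, since `j` represents `a / q` modulo `p ^ m`. The
character becomes a pure power, and sums over `r` become geometric. -/
theorem stdChar_ratPoint_mul {q r m : ℕ} {s : ℚ_[p]} {a j : ℤ} (hq : ‖(q : ℚ_[p])‖ = 1)
    (hs : ‖s - a / (p : ℚ_[p]) ^ m‖ ≤ 1) (hj : (p : ℤ) ^ m ∣ j * q - a) :
    stdChar (p := p) ((r : ℚ_[p]) / (q : ℚ_[p]) * s) =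
      Complex.exp (2 * Real.pi * Complex.I * ((j / (p : ℝ) ^ m : ℝ) : ℂ)) ^ r := by
  have hp := prime_padic_ne_zero p
  have hq0 : (q : ℚ_[p]) ≠ 0 := norm_ne_zero_iff.1 (by simp [hq])
  obtain ⟨k, hk⟩ := hj
  have hk' : (j : ℚ_[p]) * q - a = (p : ℚ_[p]) ^ m * k := mod_cast hk
  rw [stdChar_eq_exp _ (r * j) m, ← Complex.exp_nat_mul]
  · congr 1; push_cast; ring
  · have e : (r : ℚ_[p]) / q * s - ((r * j : ℤ) : ℚ_[p]) / (p : ℚ_[p]) ^ m =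
        (r : ℚ_[p]) / q * ((s - a / (p : ℚ_[p]) ^ m) - k) := by
      have : (k : ℚ_[p]) = (j * q - a) / (p : ℚ_[p]) ^ m := by rw [hk']; field_simp
      rw [this]; push_cast; field_simp; ring
    rw [e, norm_mul, norm_div, hq, div_one]
    have hr : ‖(r : ℚ_[p])‖ ≤ 1 := by exact_mod_cast Padic.norm_int_le_one (p := p) (r : ℤ)
    exact mul_le_one₀ hr (norm_nonneg _) (norm_sub_le_of_le hs (Padic.norm_int_le_one k))

/-- The balanced residue is chosen so that the phase `j / p ^ m` has absolute value at most `1 / 2`.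
-/
theorem exists_small_inverse_mul {q : ℕ} (hq : p.Coprime q) (a : ℤ) (m : ℕ) :
    ∃ j : ℤ, (p : ℤ) ^ m ∣ j * q - a ∧ 2 * |j| ≤ (p : ℤ) ^ m := by
  have hc : IsCoprime ((p : ℤ) ^ m) (q : ℤ) := (Nat.isCoprime_iff_coprime.2 hq).pow_left
  obtain ⟨u, v, huv⟩ := hc
  have hpm : 0 < p ^ m := pow_pos (Fact.out : p.Prime).pos m
  refine ⟨Int.bmod (a * v) (p ^ m), ?_, ?_⟩
  · have h1 : ((p ^ m : ℕ) : ℤ) ∣ Int.bmod (a * v) (p ^ m) - a * v := by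
      exact Int.dvd_bmod_sub_self
    push_cast at h1
    obtain ⟨k, hk⟩ := h1
    refine ⟨k * q - a * u, ?_⟩
    linear_combination (q : ℤ) * hk + a * huv
  · have h1 := Int.le_bmod (x := a * v) (m := p ^ m) hpm
    have h2 := Int.bmod_le (x := a * v) (m := p ^ m) hpm
    push_cast at h1 h2
    rcases abs_cases (Int.bmod (a * v) (p ^ m)) with ⟨e, _⟩ | ⟨e, _⟩ <;> rw [e]
    · generalize (p : ℤ) ^ m = X at *
      omega
    · generalize (p : ℤ) ^ m = X at *
      omega

/-- The product of the distinct primes in `F` divides `v`, and each factor is at least `p ^ N`. -/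
theorem card_mul_le_of_primes_dvd {N M v : ℕ} (F : Finset ℕ) (hv : v ≠ 0) (hvM : v ≤ p ^ M)
    (hF : ∀ q ∈ F, q.Prime ∧ p ^ N ≤ q ∧ q ∣ v) : N * F.card ≤ M := by
  have h1 : ∏ q ∈ F, q ∣ v := Finset.prod_primes_dvd v (fun q hq => (hF q hq).1.prime)
    (fun q hq => (hF q hq).2.2)
  have h2 : ∏ q ∈ F, q ≤ v := Nat.le_of_dvd (Nat.pos_of_ne_zero hv) h1
  have h3 : (p ^ N) ^ F.card ≤ ∏ q ∈ F, q := Finset.pow_card_le_prod _ _ _ fun q hq => (hF q hq).2.1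
  rw [← pow_mul] at h3
  exact (Nat.pow_le_pow_iff_right (Fact.out : p.Prime).one_lt).1 (h3.trans (h2.trans hvM))

theorem summable_one_div_one_add_sq : Summable fun t : ℤ => 1 / (1 + (t : ℝ) ^ 2) := by
  have h := (Real.summable_one_div_int_pow (p := 2)).2 one_lt_two
  refine Summable.of_norm_bounded_eventually h ?_
  filter_upwards [(Set.finite_singleton (0 : ℤ)).compl_mem_cofinite] with t ht
  have ht0 : (t : ℝ) ≠ 0 := by simpa using ht
  rw [Real.norm_of_nonneg (by positivity)]
  gcongr
  linarith

/-- The phase is `θ = j / p ^ m` with `j q = a + p ^ m t` and `|a| ≤ p ^ m`, hence `|θ| ≥ (|t| - 1)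
/ q`. The trivial bound serves for `|t| ≤ 1`, the geometric sum for `|t| ≥ 2`; the factor `p ^ 8` is
the square of the ratio between `p ^ (N + 4)` and `p ^ N`. -/
theorem sum_norm_sq_geom_sum_le {N m q : ℕ} {a j t : ℤ} (hqN : q ≤ p ^ (N + 4)) (hq0 : 0 < q)
    (ha : |a| ≤ (p : ℤ) ^ m) (hj2 : 2 * |j| ≤ (p : ℤ) ^ m) (ht : j * q - a = (p : ℤ) ^ m * t) :
    ‖∑ r ∈ Finset.range (p ^ N),
        Complex.exp (2 * Real.pi * Complex.I * ((j / (p : ℝ) ^ m : ℝ) : ℂ)) ^ r‖ ^ 2 ≤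
      ((p : ℝ) ^ N) ^ 2 * (2 * (p : ℝ) ^ 8 * (1 / (1 + (t : ℝ) ^ 2))) := by
  have hp1 := one_lt_prime_real p
  have hpp := prime_real_pos p
  have hpm : 0 < (p : ℝ) ^ m := by positivity
  have hp8 : (1 : ℝ) ≤ (p : ℝ) ^ 8 := one_le_pow₀ hp1.le
  set ω := Complex.exp (2 * Real.pi * Complex.I * ((j / (p : ℝ) ^ m : ℝ) : ℂ)) with hω
  have hω1 : ‖ω‖ = 1 := by
    rw [hω, show 2 * Real.pi * Complex.I * ((j / (p : ℝ) ^ m : ℝ) : ℂ) =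
      ((2 * Real.pi * (j / (p : ℝ) ^ m) : ℝ) : ℂ) * Complex.I by push_cast; ring]
    exact Complex.norm_exp_ofReal_mul_I _
  rcases le_or_gt |t| 1 with h1 | h1
  · have htriv : ‖∑ r ∈ Finset.range (p ^ N), ω ^ r‖ ≤ (p : ℝ) ^ N := by
      refine (norm_sum_le _ _).trans ?_
      simp [norm_pow, hω1]
    have ht2 : (t : ℝ) ^ 2 ≤ 1 := by
      rw [sq_le_one_iff_abs_le_one]; exact_mod_cast h1
    have h2 : 1 ≤ 2 * (p : ℝ) ^ 8 * (1 / (1 + (t : ℝ) ^ 2)) := by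
      rw [mul_one_div, le_div_iff₀ (by positivity)]
      linarith
    calc ‖∑ r ∈ Finset.range (p ^ N), ω ^ r‖ ^ 2 ≤ ((p : ℝ) ^ N) ^ 2 * 1 := by
          rw [mul_one]; gcongr
      _ ≤ _ := by gcongr
  · set θ : ℝ := j / (p : ℝ) ^ m with hθ
    have htR : (2 : ℝ) ≤ |(t : ℝ)| := by exact_mod_cast h1
    have hqR : (0 : ℝ) < q := mod_cast hq0
    have hqQ : (q : ℝ) ≤ (p : ℝ) ^ (N + 4) := mod_cast hqN
    have haR : |(a : ℝ)| ≤ (p : ℝ) ^ m := mod_cast ha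
    have hjR : 2 * |(j : ℝ)| ≤ (p : ℝ) ^ m := mod_cast hj2
    have hv : (j : ℝ) * q = a + (p : ℝ) ^ m * t := by
      have : (j : ℝ) * q - a = (p : ℝ) ^ m * t := mod_cast ht
      linarith
    have h3 : (|(t : ℝ)| - 1) * (p : ℝ) ^ m ≤ |(j : ℝ)| * q := by
      have e : |(j : ℝ)| * q = |(a : ℝ) + (p : ℝ) ^ m * t| := by
        rw [← hv, abs_mul, abs_of_pos hqR]
      rw [e]
      have := abs_sub_abs_le_abs_sub ((p : ℝ) ^ m * t) (-a)
      rw [abs_mul, abs_of_pos hpm, abs_neg, sub_neg_eq_add, add_comm _ (a : ℝ)] at this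
      linarith
    have hθa : |θ| = |(j : ℝ)| / (p : ℝ) ^ m := by rw [hθ, abs_div, abs_of_pos hpm]
    have h4 : (|(t : ℝ)| - 1) ≤ |θ| * (p : ℝ) ^ (N + 4) := by
      rw [hθa, div_mul_eq_mul_div, le_div_iff₀ hpm]
      exact h3.trans (by gcongr)
    have hθ0 : 0 < |θ| := by
      by_contra! h
      have : |θ| * (p : ℝ) ^ (N + 4) ≤ 0 := mul_nonpos_of_nonpos_of_nonneg h (by positivity)
      linarith
    have h5 := norm_geom_sum_le θ (abs_pos.1 hθ0) (by
      rw [hθa, div_le_iff₀ hpm]; linarith) (p ^ N)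
    calc ‖∑ r ∈ Finset.range (p ^ N), ω ^ r‖ ^ 2 ≤ (1 / (2 * |θ|)) ^ 2 := by gcongr
      _ ≤ ((p : ℝ) ^ (N + 4) / (2 * (|(t : ℝ)| - 1))) ^ 2 := by
        have ht1 : 0 < |(t : ℝ)| - 1 := by linarith
        refine pow_le_pow_left₀ (by positivity) ?_ 2
        rw [div_le_div_iff₀ (by positivity) (by positivity)]
        linarith
      _ ≤ _ := by
        have e : (t : ℝ) ^ 2 = |(t : ℝ)| ^ 2 := (sq_abs _).symm
        rw [e]
        generalize |(t : ℝ)| = u at *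
        have hu : 0 < u - 1 := by linarith
        rw [div_pow, pow_add, mul_pow, ← pow_mul, ← pow_mul, mul_one_div, ← mul_div_assoc,
          div_le_div_iff₀ (by positivity) (by positivity)]
        have h6 : 1 + u ^ 2 ≤ 2 * (2 * (u - 1)) ^ 2 := by nlinarith
        calc (p : ℝ) ^ (N * 2) * (p : ℝ) ^ (4 * 2) * (1 + u ^ 2) ≤
            (p : ℝ) ^ (N * 2) * (p : ℝ) ^ (4 * 2) * (2 * (2 * (u - 1)) ^ 2) := by gcongr
          _ = _ := by ring

theorem fourierMeasure_approxMeasure (N : ℕ) (hN : 1 ≤ N) {m : ℕ} {s : ℚ_[p]} {a : ℤ}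
    (hs : ‖s - a / (p : ℚ_[p]) ^ m‖ ≤ 1) (j : ℕ → ℤ)
    (hj : ∀ q ∈ window p N, (p : ℤ) ^ m ∣ j q * q - a) :
    ‖fourierMeasure (approxMeasure p N) s‖ ≤ ((triples p N).card : ℝ)⁻¹ *
      ∑ q ∈ window p N, ‖∑ r ∈ Finset.range (p ^ N),
        Complex.exp (2 * Real.pi * Complex.I * ((j q / (p : ℝ) ^ m : ℝ) : ℂ)) ^ r‖ ^ 2 := by
  rw [fourierMeasure, integral_approxMeasure, norm_smul, Real.norm_of_nonneg (by positivity),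
    triples, Finset.sum_product]
  gcongr
  refine (norm_sum_le _ _).trans (Finset.sum_le_sum fun q hq => ?_)
  have hq1 := norm_natCast_window hN hq
  set ω := Complex.exp (2 * Real.pi * Complex.I * ((j q / (p : ℝ) ^ m : ℝ) : ℂ)) with hω
  have hω1 : ‖ω‖ = 1 := by
    rw [hω, show 2 * Real.pi * Complex.I * ((j q / (p : ℝ) ^ m : ℝ) : ℂ) =
      ((2 * Real.pi * (j q / (p : ℝ) ^ m) : ℝ) : ℂ) * Complex.I by push_cast; ring]
    exact Complex.norm_exp_ofReal_mul_I _
  -- The numerator `1 + a + b` makes the double sum a square. The squared geometric sum decays like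
  -- `t ^ (-2)`, which is summable; a single sum would only give `1 / |t|`.
  have e : ∑ y ∈ Finset.range (p ^ N) ×ˢ Finset.range (p ^ N), stdChar (ratPoint p (q, y) * s) =
      ω * ((∑ r ∈ Finset.range (p ^ N), ω ^ r) * ∑ r ∈ Finset.range (p ^ N), ω ^ r) := by
    rw [Finset.sum_mul_sum, ← Finset.sum_product', Finset.mul_sum]
    refine Finset.sum_congr rfl fun y _ => ?_
    rw [ratPoint, stdChar_ratPoint_mul hq1 hs (hj q hq), ← hω, pow_add, pow_add, pow_one]
    ring
  rw [e, norm_mul, hω1, one_mul, norm_mul, sq]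

/-- The constant in the Fourier decay of `approxMeasure`. -/
def decayConst (p : ℕ) (c : ℝ) : ℝ := 12 * (p : ℝ) ^ 8 * (∑' t : ℤ, 1 / (1 + (t : ℝ) ^ 2)) / c

theorem norm_fourierMeasure_approxMeasure_le {N : ℕ} (hN : 1 ≤ N) {c : ℝ} (hc : 0 < c)
    (hw : c * (p : ℝ) ^ N / N ≤ (window p N).card) {m : ℕ} (hm : N < m) {s : ℚ_[p]}
    (hs : ‖s‖ = (p : ℝ) ^ m) :
    ‖fourierMeasure (approxMeasure p N) s‖ ≤ decayConst p c * m * (p : ℝ) ^ (-(N : ℤ)) := by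
  have hp1 := one_lt_prime_real p
  have hpp := prime_real_pos p
  obtain ⟨a, ha, hsa⟩ := exists_nat_norm_sub_div_le s m hs.le
  -- The norm of `s` is exactly `p ^ m`, so the fraction `a / p ^ m` cannot be reduced.
  have hpa : ¬ (p : ℤ) ∣ a := by
    rintro ⟨k, hk⟩
    obtain ⟨m, rfl⟩ : ∃ m', m = m' + 1 := ⟨m - 1, by omega⟩
    have h1 : ‖((a : ℤ) : ℚ_[p]) / (p : ℚ_[p]) ^ (m + 1)‖ ≤ (p : ℝ) ^ m := by
      rw [hk, norm_div, Padic.norm_p_pow]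
      push_cast
      rw [norm_mul, Padic.norm_p, zpow_neg, div_inv_eq_mul,
        zpow_add_one₀ hpp.ne', zpow_natCast]
      calc (p : ℝ)⁻¹ * ‖(k : ℚ_[p])‖ * ((p : ℝ) ^ m * p) = ‖(k : ℚ_[p])‖ * (p : ℝ) ^ m := by
            field_simp
        _ ≤ 1 * (p : ℝ) ^ m := by gcongr; exact Padic.norm_int_le_one k
        _ = _ := one_mul _
    have h2 := norm_add_le_of_le (hsa.trans (one_le_pow₀ hp1.le)) h1
    rw [sub_add_cancel, hs] at h2
    exact absurd h2 (not_le.2 (pow_lt_pow_right₀ hp1 (by omega)))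
  have hex : ∀ q : ℕ, ∃ j : ℤ, q ∈ window p N →
      (p : ℤ) ^ m ∣ j * q - a ∧ 2 * |j| ≤ (p : ℤ) ^ m := by
    intro q
    by_cases hq : q ∈ window p N
    · obtain ⟨j, hj⟩ := exists_small_inverse_mul
        (Padic.norm_natCast_eq_one_iff.1 (norm_natCast_window hN hq)) a m
      exact ⟨j, fun _ => hj⟩
    · exact ⟨0, fun h => absurd h hq⟩
  choose j hj using hex
  have hex2 : ∀ q : ℕ, ∃ t : ℤ, q ∈ window p N → j q * q - a = (p : ℤ) ^ m * t := by
    intro q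
    by_cases hq : q ∈ window p N
    · obtain ⟨t, ht⟩ := (hj q hq).1
      exact ⟨t, fun _ => ht⟩
    · exact ⟨0, fun h => absurd h hq⟩
  choose t ht using hex2
  -- Every `q` in the fibre over `u` divides the one integer `a + p ^ m u = j q * q`. It is nonzero
  -- because `p` does not divide `a`, and at most `p ^ (m + N + 4)` because `2 |j q| ≤ p ^ m`.
  have hfib : ∀ u : ℤ, N * {q ∈ window p N | t q = u}.card ≤ m + (N + 4) := by
    intro u
    rcases Finset.eq_empty_or_nonempty {q ∈ window p N | t q = u} with h | ⟨q₀, hq₀⟩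
    · simp [h]
    refine card_mul_le_of_primes_dvd (p := p) (v := ((a : ℤ) + (p : ℤ) ^ m * u).natAbs) _ ?_ ?_ ?_
    · rw [Int.natAbs_ne_zero]
      intro h0
      apply hpa
      have : (p : ℤ) ∣ (p : ℤ) ^ m * u := (dvd_pow_self _ (by omega)).mul_right _
      exact (dvd_add_left this).1 (h0 ▸ dvd_zero _)
    · rw [Finset.mem_filter] at hq₀
      have e := ht q₀ hq₀.1
      rw [hq₀.2] at e
      have e2 : (a : ℤ) + (p : ℤ) ^ m * u = j q₀ * q₀ := by linarith
      rw [e2, Int.natAbs_mul, Int.natAbs_natCast, pow_add]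
      refine Nat.mul_le_mul ?_ (mem_window.1 hq₀.1).1.2
      have h2 := (hj q₀ hq₀.1).2
      zify
      linarith [abs_nonneg (j q₀)]
    · intro q hq
      rw [Finset.mem_filter] at hq
      have hq' := mem_window.1 hq.1
      refine ⟨hq'.2, by omega, ?_⟩
      have e := ht q hq.1
      rw [hq.2] at e
      have e2 : (a : ℤ) + (p : ℤ) ^ m * u = j q * q := by linarith
      rw [e2, Int.natAbs_mul, Int.natAbs_natCast]
      exact Nat.dvd_mul_left _ _
  have hN0 : (0 : ℝ) < N := mod_cast hN
  have hfib' : ∀ u : ℤ, (({q ∈ window p N | t q = u}.card : ℕ) : ℝ) ≤ 6 * (m : ℝ) / N := by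
    intro u
    rw [le_div_iff₀ hN0, mul_comm]
    -- `m + (N + 4) ≤ 6 m` uses `1 ≤ N < m`.
    have h1 : N * {q ∈ window p N | t q = u}.card ≤ 6 * m := (hfib u).trans (by omega)
    exact_mod_cast h1
  have hsum : ∑ q ∈ window p N, 1 / (1 + (t q : ℝ) ^ 2) ≤
      6 * (m : ℝ) / N * ∑' u : ℤ, 1 / (1 + (u : ℝ) ^ 2) := by
    rw [← Finset.sum_fiberwise_of_maps_to (t := (window p N).image t) (g := t)
      (fun q hq => Finset.mem_image_of_mem _ hq)]
    calc ∑ u ∈ (window p N).image t, ∑ q ∈ window p N with t q = u, 1 / (1 + (t q : ℝ) ^ 2)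
        ≤ ∑ u ∈ (window p N).image t, 6 * (m : ℝ) / N * (1 / (1 + (u : ℝ) ^ 2)) := by
          refine Finset.sum_le_sum fun u _ => ?_
          rw [Finset.sum_congr rfl (g := fun _ => 1 / (1 + (u : ℝ) ^ 2)), Finset.sum_const,
            nsmul_eq_mul]
          · gcongr
            exact hfib' u
          · intro q hq
            rw [(Finset.mem_filter.1 hq).2]
      _ = 6 * (m : ℝ) / N * ∑ u ∈ (window p N).image t, (1 / (1 + (u : ℝ) ^ 2)) := by
          rw [Finset.mul_sum]
      _ ≤ _ := by
          gcongr
          exact summable_one_div_one_add_sq.sum_le_tsum _ fun u _ => by positivity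
  have haabs : |((a : ℕ) : ℤ)| ≤ (p : ℤ) ^ m := by
    rw [abs_of_nonneg (by positivity)]; exact_mod_cast ha.le
  have hcard : 0 < ((window p N).card : ℝ) := lt_of_lt_of_le (by positivity) hw
  set S := ∑' u : ℤ, 1 / (1 + (u : ℝ) ^ 2) with hS
  have hS0 : 0 ≤ S := tsum_nonneg fun u => by positivity
  calc ‖fourierMeasure (approxMeasure p N) s‖ ≤ ((triples p N).card : ℝ)⁻¹ *
      ∑ q ∈ window p N, ‖∑ r ∈ Finset.range (p ^ N),
        Complex.exp (2 * Real.pi * Complex.I * ((j q / (p : ℝ) ^ m : ℝ) : ℂ)) ^ r‖ ^ 2 :=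
        fourierMeasure_approxMeasure N hN hsa j fun q hq => (hj q hq).1
    _ ≤ ((triples p N).card : ℝ)⁻¹ * ∑ q ∈ window p N,
        ((p : ℝ) ^ N) ^ 2 * (2 * (p : ℝ) ^ 8 * (1 / (1 + (t q : ℝ) ^ 2))) := by
        gcongr with q hq
        have hq' := mem_window.1 hq
        exact sum_norm_sq_geom_sum_le hq'.1.2 hq'.2.pos haabs (hj q hq).2 (ht q hq)
    _ = 2 * (p : ℝ) ^ 8 / (window p N).card * ∑ q ∈ window p N, 1 / (1 + (t q : ℝ) ^ 2) := by
        rw [← Finset.mul_sum, ← Finset.mul_sum, card_triples]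
        push_cast
        field_simp
    _ ≤ 2 * (p : ℝ) ^ 8 / (c * (p : ℝ) ^ N / N) * (6 * (m : ℝ) / N * S) := by gcongr
    _ = decayConst p c * m * (p : ℝ) ^ (-(N : ℤ)) := by
        rw [decayConst, ← hS, zpow_neg, zpow_natCast]
        field_simp
        ring

/-! ### Ball bounds for the discrete measures. -/

/-- Both fractions have prime denominator, and `0 < r < q` makes the first one reduced. -/
theorem ratPoint_pair_eq {p N q q' r r' : ℕ} (hq : q ∈ window p N) (hq' : q' ∈ window p N)
    (hr : 0 < r) (hrq : r < q) (h : r * q' = r' * q) :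
    (q, r) = (q', r') := by
  have hpq := (mem_window.1 hq).2
  have hpq' := (mem_window.1 hq').2
  have hdvd : q ∣ r * q' := ⟨r', by rw [h, mul_comm]⟩
  rcases hpq.dvd_mul.1 hdvd with h1 | h1
  · exact absurd (Nat.le_of_dvd hr h1) (by omega)
  · have e := (Nat.prime_dvd_prime_iff_eq hpq hpq').1 h1
    subst e
    rw [Nat.eq_of_mul_eq_mul_right hpq.pos h]

/-- A lattice argument that plays the two absolute values against each other: fractions that are
`p`-adically close have `p ^ m ∣ r q' - r' q ≠ 0`, so as real numbers in `[0, 1]` they are at least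
`p ^ m / p ^ (2 (N + 4))` apart. -/
theorem card_pairs_le {N m : ℕ} (hN : 1 ≤ N) (x : ℚ_[p]) (F : Finset (ℕ × ℕ))
    (hF : ∀ z ∈ F, z.1 ∈ window p N ∧ 0 < z.2 ∧ z.2 < z.1 ∧
      ‖(z.2 : ℚ_[p]) / (z.1 : ℚ_[p]) - x‖ ≤ (p : ℝ) ^ (-(m : ℤ))) :
    (F.card : ℝ) ≤ 1 + ((p : ℝ) ^ (N + 4)) ^ 2 / (p : ℝ) ^ m := by
  have hpp := prime_real_pos p
  rw [← one_div_div]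
  refine card_le_one_add_inv_of_separated F (fun z => (z.2 : ℝ) / z.1) (by positivity) ?_ ?_
  · intro z hz
    obtain ⟨-, h1, h2, -⟩ := hF z hz
    refine ⟨by positivity, ?_⟩
    rw [div_le_one (by exact_mod_cast (h1.trans h2))]
    exact_mod_cast h2.le
  · rintro ⟨q, r⟩ hz ⟨q', r'⟩ hz' hne
    obtain ⟨hq, h1, h2, h3⟩ := hF _ hz
    obtain ⟨hq', h1', h2', h3'⟩ := hF _ hz'
    simp only at *
    have hq0 := natCast_window_ne_zero hq
    have hq0' := natCast_window_ne_zero hq'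
    have hd := norm_sub_le_of_le h3 h3'
    have e : (r : ℚ_[p]) / q - x - ((r' : ℚ_[p]) / q' - x) =
        ((r * q' - r' * q : ℤ) : ℚ_[p]) / (q * q') := by
      push_cast; field_simp; ring
    rw [e, norm_div, norm_mul, norm_natCast_window hN hq, norm_natCast_window hN hq', mul_one,
      div_one, Padic.norm_int_le_pow_iff_dvd] at hd
    have hne0 : (r * q' - r' * q : ℤ) ≠ 0 := by
      intro h0
      apply hne
      exact ratPoint_pair_eq hq hq' h1 h2 (by exact_mod_cast sub_eq_zero.1 h0)
    have hge : (p : ℤ) ^ m ≤ |(r * q' - r' * q : ℤ)| :=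
      Int.le_of_dvd (abs_pos.2 hne0) ((dvd_abs _ _).2 hd)
    have hge' : (p : ℝ) ^ m ≤ |(r * q' - r' * q : ℝ)| := by exact_mod_cast hge
    have hqR : (0 : ℝ) < q := by exact_mod_cast (h1.trans h2)
    have hqR' : (0 : ℝ) < q' := by exact_mod_cast (h1'.trans h2')
    have hqQ : (q : ℝ) ≤ (p : ℝ) ^ (N + 4) := mod_cast (mem_window.1 hq).1.2
    have hqQ' : (q' : ℝ) ≤ (p : ℝ) ^ (N + 4) := mod_cast (mem_window.1 hq').1.2
    have e2 : (r : ℝ) / q - r' / q' = (r * q' - r' * q) / (q * q') := by field_simp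
    rw [e2, abs_div, abs_of_pos (mul_pos hqR hqR'), sq]
    gcongr

theorem approxMeasure_closedBall_le {N : ℕ} (hN : 1 ≤ N) {c : ℝ} (hc : 0 < c)
    (hw : c * (p : ℝ) ^ N / N ≤ (window p N).card) (x : ℚ_[p]) (m : ℕ) :
    (approxMeasure p N).real (Metric.closedBall x ((p : ℝ) ^ (-(m : ℤ)))) ≤
      (p : ℝ) ^ 8 / c * N * (((p : ℝ) ^ (2 * N))⁻¹ + ((p : ℝ) ^ m)⁻¹) := by
  classical
  have hpp := prime_real_pos p
  have hp1 := one_lt_prime_real p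
  set B := Metric.closedBall x ((p : ℝ) ^ (-(m : ℤ))) with hB
  set T := {z ∈ triples p N | ratPoint p z ∈ B} with hT
  have h1 : (approxMeasure p N).real B = ((triples p N).card : ℝ)⁻¹ * T.card := by
    rw [approxMeasure_real_apply N (measurableSet_closedBall' _ _)]
    congr 1
    rw [hT, Finset.card_filter]
    push_cast
    refine Finset.sum_congr rfl fun z _ => ?_
    simp only [Set.indicator_apply, Pi.one_apply, hB]
  set g : ℕ × ℕ × ℕ → ℕ × ℕ := fun z => (z.1, 1 + z.2.1 + z.2.2) with hg
  -- Once the fraction is fixed, `a` determines `b`, so each fraction has at most `p ^ N`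
  -- representations.
  have h2 : T.card ≤ p ^ N * (T.image g).card := by
    refine Finset.card_le_mul_card_image _ _ fun y _ => ?_
    rw [← Finset.card_range (p ^ N)]
    refine Finset.card_le_card_of_injOn (fun z => z.2.1) ?_ ?_
    · intro z hz
      simp only [Finset.coe_filter, Set.mem_ofPred_eq, hT, Finset.mem_filter] at hz
      simpa using (mem_triples.1 hz.1.1).2.1
    · rintro ⟨a, b, c⟩ hz ⟨a', b', c'⟩ hz' hzz
      simp only [Finset.coe_filter, Set.mem_ofPred_eq, hg] at hz hz'
      have := hz.2.trans hz'.2.symm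
      simp only [Prod.mk.injEq] at this hzz ⊢
      omega
  have h3 : ((T.image g).card : ℝ) ≤ 1 + ((p : ℝ) ^ (N + 4)) ^ 2 / (p : ℝ) ^ m := by
    refine card_pairs_le hN x _ fun y hy => ?_
    obtain ⟨z, hz, rfl⟩ := Finset.mem_image.1 hy
    rw [hT, Finset.mem_filter] at hz
    have hz1 := mem_triples.1 hz.1
    have hz2 := mem_window.1 hz1.1
    refine ⟨hz1.1, by simp [hg], by simp only [hg]; omega, ?_⟩
    have := hz.2
    rw [hB, Metric.mem_closedBall, dist_eq_norm] at this
    exact this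
  have hN0 : (0 : ℝ) < N := mod_cast hN
  have hcard : 0 < ((window p N).card : ℝ) := lt_of_lt_of_le (by positivity) hw
  have hp8 : (1 : ℝ) ≤ (p : ℝ) ^ 8 := one_le_pow₀ hp1.le
  have hT' : (T.card : ℝ) ≤ (p : ℝ) ^ N * (1 + ((p : ℝ) ^ (N + 4)) ^ 2 / (p : ℝ) ^ m) := by
    calc (T.card : ℝ) ≤ (p : ℝ) ^ N * (T.image g).card := by exact_mod_cast h2
      _ ≤ _ := by gcongr
  rw [h1, card_triples]
  push_cast
  calc ((window p N).card * ((p : ℝ) ^ N * (p : ℝ) ^ N))⁻¹ * (T.card : ℝ)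
      ≤ ((c * (p : ℝ) ^ N / N) * ((p : ℝ) ^ N * (p : ℝ) ^ N))⁻¹ *
        ((p : ℝ) ^ N * ((p : ℝ) ^ 8 + ((p : ℝ) ^ (N + 4)) ^ 2 / (p : ℝ) ^ m)) := by
        gcongr
        refine hT'.trans ?_
        gcongr
    _ = _ := by
        field_simp
        ring

/-! ### The multiplicative construction. -/

section Stages

variable {E : Type*} [NormedAddCommGroup E] [NormedSpace ℝ E]

theorem ConstOnBalls.smul {n : ℕ} {h : ℚ_[p] → ℝ} {φ : ℚ_[p] → E} (hh : ConstOnBalls n h)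
    (hφ : ConstOnBalls n φ) : ConstOnBalls n (fun x => h x • φ x) := by
  intro x y hxy
  simp only [hh x y hxy, hφ x y hxy]

theorem constOnBalls_closedBall_indicator {F : Type*} [Zero F] {m n : ℕ} (hmn : m ≤ n) (x : ℚ_[p])
    (b : F) : ConstOnBalls n
      ((Metric.closedBall x ((p : ℝ) ^ (-(m : ℤ)))).indicator (fun _ => b)) := by
  refine ConstOnBalls.mono ?_ hmn
  intro y z hyz
  have : z ∈ Metric.closedBall x ((p : ℝ) ^ (-(m : ℤ))) ↔
      y ∈ Metric.closedBall x ((p : ℝ) ^ (-(m : ℤ))) := by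
    simp only [Metric.mem_closedBall, dist_eq_norm]
    constructor <;> intro h
    · simpa using norm_sub_le_of_le h hyz
    · simpa using norm_add_le_of_le h hyz
  by_cases hy : y ∈ Metric.closedBall x ((p : ℝ) ^ (-(m : ℤ)))
  · rw [Set.indicator_of_mem hy, Set.indicator_of_mem (this.2 hy)]
  · rw [Set.indicator_of_notMem hy, Set.indicator_of_notMem (fun h => hy (this.1 h))]

theorem constOnBalls_real_closedBall (μ : Measure ℚ_[p]) (n : ℕ) :
    ConstOnBalls n (fun x => μ.real (Metric.closedBall x ((p : ℝ) ^ (-(n : ℤ))))) := by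
  intro x y hxy
  beta_reduce
  rw [IsUltrametricDist.closedBall_eq_of_mem (y := y) (x := x)
    (by rwa [Metric.mem_closedBall, dist_eq_norm])]

/-- Averaging `approxMeasure` over balls of radius `p ^ (-n)` does not change the integrals of
functions which are constant on such balls. -/
theorem ConstOnBalls.integral_smoothing [CompleteSpace E] {n : ℕ} (N : ℕ) {φ : ℚ_[p] → E} (h : ConstOnBalls n φ) :
    ∫ x, ((p : ℝ) ^ n * (approxMeasure p N).real (Metric.closedBall x ((p : ℝ) ^ (-(n : ℤ))))) • φ x
      ∂haar p = ∫ x, φ x ∂approxMeasure p N := by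
  have hpn : (p : ℝ) ^ n ≠ 0 := (pow_pos (prime_real_pos p) n).ne'
  have h1 : ∀ x, ((p : ℝ) ^ n * (approxMeasure p N).real
      (Metric.closedBall x ((p : ℝ) ^ (-(n : ℤ))))) • φ x =
      ∑ z ∈ triples p N, ((p : ℝ) ^ n * ((triples p N).card : ℝ)⁻¹) •
        (Metric.closedBall (ratPoint p z) ((p : ℝ) ^ (-(n : ℤ)))).indicator φ x := by
    intro x
    rw [approxMeasure_real_apply N (measurableSet_closedBall' _ _), ← mul_assoc, mul_smul,
      ← Finset.smul_sum, Finset.sum_smul]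
    congr 1
    refine Finset.sum_congr rfl fun z _ => ?_
    by_cases hz : ratPoint p z ∈ Metric.closedBall x ((p : ℝ) ^ (-(n : ℤ)))
    · rw [Set.indicator_of_mem hz, Set.indicator_of_mem (Metric.mem_closedBall_comm.1 hz)]
      simp
    · rw [Set.indicator_of_notMem hz,
        Set.indicator_of_notMem (fun h => hz (Metric.mem_closedBall_comm.1 h))]
      simp
  simp_rw [h1]
  rw [integral_finsetSum, integral_approxMeasure, Finset.smul_sum]
  · refine Finset.sum_congr rfl fun z _ => ?_
    rw [integral_smul, integral_indicator (measurableSet_closedBall' _ _),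
      setIntegral_congr_fun (g := fun _ => φ (ratPoint p z)) (measurableSet_closedBall' _ _),
      setIntegral_const, haar_real_closedBall, smul_smul, zpow_neg, zpow_natCast]
    · congr 1; field_simp
    · intro x hx
      exact h _ _ (by simpa [dist_eq_norm] using hx)
  · intro z _
    exact ((integrableOn_closedBall h.continuous _ _).integrable_indicator
      (measurableSet_closedBall' _ _)).smul _

/-- A probability density on `ℤ_p` which is constant on the balls of radius `p ^ (-scale)`. -/
structure Stage (p : ℕ) [Fact p.Prime] where
  /-- The density is constant on balls of radius `p ^ (-scale)`. -/
  scale : ℕ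
  /-- The density. -/
  density : ℚ_[p] → ℝ
  /-- An upper bound of the density. -/
  bound : ℝ
  const : ConstOnBalls scale density
  nonneg : ∀ x, 0 ≤ density x
  le_bound : ∀ x, density x ≤ bound
  eq_zero : ∀ x, 1 < ‖x‖ → density x = 0
  integral_eq : ∫ x, density x ∂haar p = 1

theorem Stage.integral_smul_eq (S : Stage p) (φ : ℚ_[p] → E) :
    ∫ x, S.density x • φ x ∂haar p = ∫ x in Metric.closedBall 0 1, S.density x • φ x ∂haar p := by
  refine (setIntegral_eq_integral_of_forall_compl_eq_zero fun x hx => ?_).symm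
  rw [S.eq_zero x (by simpa using hx), zero_smul]

/-- Haar measure on `ℤ_p`. -/
def Stage.init (p : ℕ) [Fact p.Prime] : Stage p where
  scale := 0
  density := (Metric.closedBall (0 : ℚ_[p]) 1).indicator (fun _ => 1)
  bound := 1
  const := by simpa using constOnBalls_closedBall_indicator (p := p) (le_refl 0) 0 (1 : ℝ)
  nonneg x := Set.indicator_nonneg (fun _ _ => zero_le_one) x
  le_bound x := Set.indicator_le' (fun _ _ => le_rfl) (fun _ _ => zero_le_one) x
  eq_zero x hx := Set.indicator_of_notMem (by simpa using hx) _
  integral_eq := by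
    rw [integral_indicator (measurableSet_closedBall' _ _), setIntegral_const, Measure.real,
      haar_closedBall_one]
    simp

/-- The index `N` of the measure `approxMeasure p N` used to refine a stage. -/
def Stage.freq (N₀ : ℕ) (S : Stage p) : ℕ :=
  p ^ S.scale + ⌈S.bound⌉₊ + S.scale + N₀ + 1

/-- The scale of the refinement of a stage. -/
def Stage.nextScale (N₀ : ℕ) (τ : ℝ) (S : Stage p) : ℕ :=
  max (S.freq N₀) ⌈τ * (S.freq N₀ + 4)⌉₊

/-- The density of the refinement of a stage. -/
def Stage.nextDensity (N₀ : ℕ) (τ : ℝ) (S : Stage p) (x : ℚ_[p]) : ℝ :=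
  S.density x * ((p : ℝ) ^ (S.nextScale N₀ τ) * (approxMeasure p (S.freq N₀)).real
    (Metric.closedBall x ((p : ℝ) ^ (-(S.nextScale N₀ τ : ℤ)))))

theorem Stage.scale_lt_freq (N₀ : ℕ) (S : Stage p) : S.scale < S.freq N₀ := by
  unfold Stage.freq; omega

theorem Stage.freq_le_nextScale (N₀ : ℕ) (τ : ℝ) (S : Stage p) : S.freq N₀ ≤ S.nextScale N₀ τ :=
  le_max_left _ _

theorem Stage.bound_nonneg (S : Stage p) : 0 ≤ S.bound := (S.nonneg 0).trans (S.le_bound 0)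

/-- Lets the supremum of the old density be absorbed as one factor `m` in the ball estimate. -/
theorem Stage.bound_le_freq (N₀ : ℕ) (S : Stage p) : S.bound ≤ S.freq N₀ := by
  refine (Nat.le_ceil _).trans ?_
  unfold Stage.freq
  exact_mod_cast (by omega)

/-- Lets the loss caused by the frequency shifts be absorbed as one factor `m` in the Fourier
estimate. -/
theorem Stage.pow_scale_le_freq (N₀ : ℕ) (S : Stage p) : (p : ℝ) ^ S.scale ≤ S.freq N₀ := by
  unfold Stage.freq
  exact_mod_cast (by omega)

theorem Stage.lt_freq (N₀ : ℕ) (S : Stage p) : N₀ < S.freq N₀ := by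
  unfold Stage.freq; omega

theorem Stage.integral_nextDensity [CompleteSpace E] (N₀ : ℕ) (τ : ℝ) (S : Stage p) {φ : ℚ_[p] → E}
    (hφ : ConstOnBalls (S.nextScale N₀ τ) φ) :
    ∫ x, S.nextDensity N₀ τ x • φ x ∂haar p =
      ∫ x, S.density x • φ x ∂approxMeasure p (S.freq N₀) := by
  have hc : ConstOnBalls (S.nextScale N₀ τ) (fun x => S.density x • φ x) :=
    (S.const.mono ((S.scale_lt_freq N₀).le.trans (S.freq_le_nextScale N₀ τ))).smul hφ
  rw [← hc.integral_smoothing]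
  congr 1
  ext x
  rw [nextDensity, mul_comm, mul_smul]

/-- The product of the density with `φ` is still constant at scale `p ^ (-N)`, where the discrete
measure looks like Haar measure. This is why refining a stage preserves total mass and all coarse
integrals. -/
theorem Stage.integral_approxMeasure_eq [CompleteSpace E] {N₀ : ℕ} (hN₀ : ∀ N > N₀, (window p N).Nonempty)
    (S : Stage p) {φ : ℚ_[p] → E} (hφ : ConstOnBalls (S.freq N₀) φ) :
    ∫ x, S.density x • φ x ∂approxMeasure p (S.freq N₀) = ∫ x, S.density x • φ x ∂haar p := by
  have hc : ConstOnBalls (S.freq N₀) (fun x => S.density x • φ x) :=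
    (S.const.mono (S.scale_lt_freq N₀).le).smul hφ
  rw [hc.integral_approxMeasure_eq (by unfold freq; omega) (hN₀ _ (by unfold freq; omega)),
    ← S.integral_smul_eq]

/-- The refinement of a stage. -/
def Stage.next {N₀ : ℕ} (hN₀ : ∀ N > N₀, (window p N).Nonempty) (τ : ℝ) (S : Stage p) :
    Stage p where
  scale := S.nextScale N₀ τ
  density := S.nextDensity N₀ τ
  bound := S.bound * (p : ℝ) ^ (S.nextScale N₀ τ)
  const := (S.const.mono ((S.scale_lt_freq N₀).le.trans (S.freq_le_nextScale N₀ τ))).smul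
    (fun x y hxy => by simp only [constOnBalls_real_closedBall _ _ x y hxy])
  nonneg x := mul_nonneg (S.nonneg x) (by positivity)
  le_bound x := by
    have := isProbabilityMeasure_approxMeasure (hN₀ (S.freq N₀) (by unfold freq; omega))
    unfold nextDensity
    have h1 : (approxMeasure p (S.freq N₀)).real
      (Metric.closedBall x ((p : ℝ) ^ (-(S.nextScale N₀ τ : ℤ)))) ≤ 1 := measureReal_le_one
    have h2 := S.bound_nonneg
    have h3 := S.le_bound x
    calc _ ≤ S.bound * ((p : ℝ) ^ (S.nextScale N₀ τ) * 1) := by gcongr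
      _ = _ := by rw [mul_one]
  eq_zero x hx := by simp [nextDensity, S.eq_zero x hx]
  integral_eq := by
    have h1 : ConstOnBalls (S.freq N₀) (fun _ : ℚ_[p] => (1 : ℝ)) := fun _ _ _ => rfl
    have h2 := S.integral_nextDensity N₀ τ (h1.mono (S.freq_le_nextScale N₀ τ))
    rw [S.integral_approxMeasure_eq hN₀ h1] at h2
    simpa [S.integral_eq] using h2

/-- The sequence of stages. -/
def stages {N₀ : ℕ} (hN₀ : ∀ N > N₀, (window p N).Nonempty) (τ : ℝ) : ℕ → Stage p
  | 0 => Stage.init p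
  | k + 1 => (stages hN₀ τ k).next hN₀ τ

/-- The probability measure of a stage. -/
def Stage.measure (S : Stage p) : Measure ℚ_[p] :=
  (haar p).withDensity fun x => ENNReal.ofReal (S.density x)

theorem Stage.integral_measure (S : Stage p) (φ : ℚ_[p] → E) :
    ∫ x, φ x ∂S.measure = ∫ x, S.density x • φ x ∂haar p := by
  rw [measure, integral_withDensity_eq_integral_toReal_smul
    S.const.continuous.measurable.ennreal_ofReal (by simp)]
  simp_rw [ENNReal.toReal_ofReal (S.nonneg _)]

theorem Stage.integrable (S : Stage p) : Integrable S.density (haar p) := by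
  by_contra h
  have := S.integral_eq
  rw [integral_undef h] at this
  norm_num at this

instance (S : Stage p) : IsProbabilityMeasure S.measure := by
  refine ⟨?_⟩
  rw [Stage.measure, withDensity_apply _ MeasurableSet.univ, Measure.restrict_univ,
    ← ofReal_integral_eq_lintegral_ofReal S.integrable (Filter.Eventually.of_forall S.nonneg),
    S.integral_eq, ENNReal.ofReal_one]

theorem Stage.measure_compl_closedBall (S : Stage p) :
    S.measure (Metric.closedBall 0 1)ᶜ = 0 := by
  rw [Stage.measure, withDensity_apply _ (measurableSet_closedBall' _ _).compl,
    setLIntegral_congr_fun (g := fun _ => 0) (measurableSet_closedBall' _ _).compl]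
  · simp
  · intro x hx
    simp [S.eq_zero x (by simpa using hx)]

theorem stages_integral_succ [CompleteSpace E] {N₀ : ℕ} (hN₀ : ∀ N > N₀, (window p N).Nonempty) (τ : ℝ) (k : ℕ)
    {φ : ℚ_[p] → E} (hφ : ConstOnBalls (stages hN₀ τ (k + 1)).scale φ) :
    ∫ x, φ x ∂(stages hN₀ τ (k + 1)).measure =
      ∫ x, (stages hN₀ τ k).density x • φ x ∂approxMeasure p ((stages hN₀ τ k).freq N₀) := by
  rw [Stage.integral_measure]
  exact (stages hN₀ τ k).integral_nextDensity N₀ τ hφ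

theorem stages_integral_succ_eq [CompleteSpace E] {N₀ : ℕ} (hN₀ : ∀ N > N₀, (window p N).Nonempty) (τ : ℝ) (k : ℕ)
    {φ : ℚ_[p] → E} (hφ : ConstOnBalls (stages hN₀ τ k).scale φ) :
    ∫ x, φ x ∂(stages hN₀ τ (k + 1)).measure = ∫ x, φ x ∂(stages hN₀ τ k).measure := by
  set S := stages hN₀ τ k with hS
  have h1 : ConstOnBalls (S.freq N₀) φ := hφ.mono (S.scale_lt_freq N₀).le
  rw [stages_integral_succ hN₀ τ k (h1.mono (S.freq_le_nextScale N₀ τ)),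
    Stage.integral_measure, ← hS, S.integral_approxMeasure_eq hN₀ h1]

theorem stages_scale_lt_succ {N₀ : ℕ} (hN₀ : ∀ N > N₀, (window p N).Nonempty) (τ : ℝ) (k : ℕ) :
    (stages hN₀ τ k).scale < (stages hN₀ τ (k + 1)).scale :=
  ((stages hN₀ τ k).scale_lt_freq N₀).trans_le ((stages hN₀ τ k).freq_le_nextScale N₀ τ)

theorem stages_scale_strictMono {N₀ : ℕ} (hN₀ : ∀ N > N₀, (window p N).Nonempty) (τ : ℝ) :
    StrictMono fun k => (stages hN₀ τ k).scale :=
  strictMono_nat_of_lt_succ (stages_scale_lt_succ hN₀ τ)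

theorem stages_integral_eq_of_le [CompleteSpace E] {N₀ : ℕ} (hN₀ : ∀ N > N₀, (window p N).Nonempty) (τ : ℝ)
    {k l : ℕ} (hkl : k ≤ l) {φ : ℚ_[p] → E} (hφ : ConstOnBalls (stages hN₀ τ k).scale φ) :
    ∫ x, φ x ∂(stages hN₀ τ l).measure = ∫ x, φ x ∂(stages hN₀ τ k).measure := by
  induction l, hkl using Nat.le_induction with
  | base => rfl
  | succ l hkl ih =>
    rw [stages_integral_succ_eq hN₀ τ l
      (hφ.mono ((stages_scale_strictMono hN₀ τ).monotone hkl)), ih]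

end Stages

/-! ### The limit measure: existence, Fourier decay and mass of balls. -/

open Filter Topology BoundedContinuousFunction in
/-- A weak limit of the measures of the stages. -/
theorem exists_limit_measure {N₀ : ℕ} (hN₀ : ∀ N > N₀, (window p N).Nonempty) (τ : ℝ) :
    ∃ μ : Measure ℚ_[p], IsProbabilityMeasure μ ∧ ∀ (k : ℕ) (φ : ℚ_[p] → ℂ) (C : ℝ),
      (∀ x, ‖φ x‖ ≤ C) → ConstOnBalls (stages hN₀ τ k).scale φ →
        ∫ x, φ x ∂μ = ∫ x, φ x ∂(stages hN₀ τ k).measure := by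
  set M : ℕ → ProbabilityMeasure ℚ_[p] := fun k =>
    ⟨(stages hN₀ τ k).measure, inferInstance⟩ with hM
  -- All stages live on the compact ball `ℤ_p`, so tightness holds with mass `0` outside.
  have hcomp := isCompact_setOfPred_probabilityMeasure_mass_eq_compl_isCompact_le
    (u := fun _ => 0) (K := fun _ => Metric.closedBall (0 : ℚ_[p]) 1)
    tendsto_const_nhds (fun _ => isCompact_closedBall _ _) (Or.inl inferInstance)
  obtain ⟨μ, -, hμ⟩ := hcomp.ultrafilter_le_nhds ((hyperfilter ℕ).map M) (by
    rw [le_principal_iff]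
    refine Filter.mem_map.2 (Filter.univ_mem' fun k n => ?_)
    have h := (stages hN₀ τ k).measure_compl_closedBall
    have h' : (M k) (Metric.closedBall 0 1)ᶜ = 0 := by
      rw [← ENNReal.coe_eq_zero, ProbabilityMeasure.ennreal_coeFn_eq_coeFn_toMeasure]
      exact h
    exact h'.le)
  refine ⟨μ, inferInstance, fun k φ C hC hφ => ?_⟩
  have hlim : Tendsto M (hyperfilter ℕ) (𝓝 μ) := hμ
  rw [ProbabilityMeasure.tendsto_iff_forall_integral_rclike_tendsto ℂ] at hlim
  have h1 := hlim (BoundedContinuousFunction.ofNormedAddCommGroup φ hφ.continuous C hC)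
  -- From stage `k` on these integrals are constant, so every limit along an ultrafilter has the
  -- same value.
  have h2 : Tendsto (fun l => ∫ x, φ x ∂(M l : Measure ℚ_[p])) (hyperfilter ℕ)
      (𝓝 (∫ x, φ x ∂(stages hN₀ τ k).measure)) := by
    refine tendsto_const_nhds.congr' ?_
    have : ∀ᶠ l in (hyperfilter ℕ : Filter ℕ), k ≤ l :=
      Nat.hyperfilter_le_atTop (eventually_ge_atTop k)
    filter_upwards [this] with l hl
    exact (stages_integral_eq_of_le hN₀ τ hl hφ).symm
  exact tendsto_nhds_unique h1 h2

/-- Fourier inversion for a function constant at scale `n`: the inner integral is `p ^ n` times the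
indicator of the ball of radius `p ^ (-n)`. Only frequencies `‖t‖ ≤ p ^ n` occur. -/
theorem Stage.density_eq_integral (S : Stage p) (x : ℚ_[p]) :
    (S.density x : ℂ) = ∫ z, S.density z •
      ∫ t in Metric.closedBall 0 ((p : ℝ) ^ (S.scale : ℤ)), stdChar ((x - z) * t) ∂haar p
        ∂haar p := by
  have hpn : ((p : ℝ) ^ (S.scale : ℤ)) ≠ 0 := (zpow_pos (prime_real_pos p) _).ne'
  have h1 : ∀ z, S.density z •
      ∫ t in Metric.closedBall 0 ((p : ℝ) ^ (S.scale : ℤ)), stdChar ((x - z) * t) ∂haar p =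
      (Metric.closedBall x ((p : ℝ) ^ (-(S.scale : ℤ)))).indicator
        (fun _ => S.density x • ((p : ℝ) ^ (S.scale : ℤ) : ℂ)) z := by
    intro z
    rw [setIntegral_closedBall_stdChar]
    by_cases hz : z ∈ Metric.closedBall x ((p : ℝ) ^ (-(S.scale : ℤ)))
    · rw [Set.indicator_of_mem hz]
      rw [Metric.mem_closedBall, dist_eq_norm] at hz
      rw [if_pos (by rwa [norm_sub_rev]), S.const x z hz]
    · rw [Set.indicator_of_notMem hz]
      rw [Metric.mem_closedBall, dist_eq_norm] at hz
      rw [if_neg (by rwa [norm_sub_rev]), smul_zero]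
  simp_rw [h1]
  rw [integral_indicator (measurableSet_closedBall' _ _), setIntegral_const, haar_real_closedBall,
    zpow_neg]
  simp only [Complex.real_smul]
  push_cast
  have : ((p : ℂ) ^ (S.scale : ℤ)) ≠ 0 := by exact_mod_cast hpn
  field_simp

/-- Inserting the inversion formula turns multiplication by the density into an average of the
transform over shifts `t`. The factor `p ^ scale` is the Haar measure of the set of shifts, and the
density itself integrates to `1`. -/
theorem norm_integral_density_stdChar_le (S : Stage p) (N : ℕ) (s : ℚ_[p]) {A : ℝ}
    (hA : ∀ t : ℚ_[p], ‖t‖ ≤ (p : ℝ) ^ S.scale →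
      ‖fourierMeasure (approxMeasure p N) (s + t)‖ ≤ A) :
    ‖∫ x, S.density x • stdChar (x * s) ∂approxMeasure p N‖ ≤ (p : ℝ) ^ S.scale * A := by
  set B := Metric.closedBall (0 : ℚ_[p]) ((p : ℝ) ^ (S.scale : ℤ)) with hB
  set F : ℚ_[p] → ℂ := fun z => ∫ t in B,
    stdChar (-(z * t)) * fourierMeasure (approxMeasure p N) (s + t) ∂haar p with hF
  have hFb : ∀ z, ‖F z‖ ≤ (p : ℝ) ^ S.scale * A := by
    intro z
    rw [hF]
    have := norm_setIntegral_le_of_norm_le_const (μ := haar p) (s := B) (C := A)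
      (f := fun t => stdChar (-(z * t)) * fourierMeasure (approxMeasure p N) (s + t))
      (isCompact_closedBall _ _).measure_lt_top (by
        intro t ht
        rw [norm_mul, norm_stdChar, one_mul]
        exact hA t (by simpa [hB] using ht))
    rwa [hB, haar_real_closedBall, zpow_natCast, mul_comm] at this
  have hInteg : ∀ x, Integrable (fun z => S.density z •
      (stdChar (x * s) * ∫ t in B, stdChar ((x - z) * t) ∂haar p)) (haar p) := by
    intro x
    have hm : Measurable fun z : ℚ_[p] => if ‖x - z‖ ≤ (p : ℝ) ^ (-(S.scale : ℤ)) then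
        (((p : ℝ) ^ (S.scale : ℤ) : ℝ) : ℂ) else 0 := by
      refine Measurable.ite ?_ measurable_const measurable_const
      exact measurableSet_le (by fun_prop) measurable_const
    have h2 : (fun z => S.density z •
        (stdChar (x * s) * ∫ t in B, stdChar ((x - z) * t) ∂haar p)) =
        fun z => S.density z • (stdChar (x * s) * if ‖x - z‖ ≤ (p : ℝ) ^ (-(S.scale : ℤ)) then
        (((p : ℝ) ^ (S.scale : ℤ) : ℝ) : ℂ) else 0) := by
      ext z
      rw [hB, setIntegral_closedBall_stdChar]
      push_cast; rfl
    rw [h2]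
    refine Integrable.smul_bdd S.integrable ((p : ℝ) ^ (S.scale : ℤ))
      (hm.const_mul _).aestronglyMeasurable (Filter.Eventually.of_forall fun z => ?_)
    rw [norm_mul, norm_stdChar, one_mul]
    have hpos : 0 < (p : ℝ) ^ (S.scale : ℤ) := zpow_pos (prime_real_pos p) _
    split_ifs
    · rw [Complex.norm_real, Real.norm_of_nonneg hpos.le]
    · simp
  have key : ∫ x, S.density x • stdChar (x * s) ∂approxMeasure p N =
      ∫ z, S.density z • F z ∂haar p := by
    rw [integral_approxMeasure]
    have h1 : ∀ w ∈ triples p N, S.density (ratPoint p w) • stdChar (ratPoint p w * s) =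
        ∫ z, S.density z • (stdChar (ratPoint p w * s) *
          ∫ t in B, stdChar ((ratPoint p w - z) * t) ∂haar p) ∂haar p := by
      intro w _
      rw [Complex.real_smul, S.density_eq_integral, mul_comm, ← integral_const_mul]
      congr 1; ext z
      rw [Complex.real_smul, Complex.real_smul]; ring
    rw [Finset.sum_congr rfl h1, ← integral_finsetSum _ (fun w _ => hInteg _), ← integral_smul]
    congr 1; ext z
    rw [← Finset.smul_sum, smul_comm]
    congr 1
    rw [hF]
    simp_rw [fourierMeasure, integral_approxMeasure, ← integral_const_mul]
    rw [← integral_finsetSum, ← integral_smul]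
    · congr 1; ext t
      rw [mul_smul_comm, Finset.mul_sum]
      congr 1
      refine Finset.sum_congr rfl fun w _ => ?_
      rw [← stdChar_add, ← stdChar_add]
      congr 1; ring
    · intro w _
      refine integrableOn_closedBall ?_ _ _
      exact continuous_const.mul (continuous_stdChar.comp (by fun_prop))
  rw [key]
  refine (norm_integral_le_of_norm_le (g := fun z => S.density z * ((p : ℝ) ^ S.scale * A))
    (S.integrable.mul_const _) (Filter.Eventually.of_forall fun z => ?_)).trans ?_
  · rw [norm_smul, Real.norm_of_nonneg (S.nonneg z)]
    exact mul_le_mul_of_nonneg_left (hFb z) (S.nonneg z)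
  · rw [integral_mul_const, S.integral_eq, one_mul]

theorem norm_add_eq_of_lt {s t : ℚ_[p]} (h : ‖t‖ < ‖s‖) : ‖s + t‖ = ‖s‖ := by
  rw [Padic.add_eq_max_of_ne h.ne', max_eq_left h.le]

/-- An index with `scale k < m ≤ scale (k + 1)`. -/
theorem exists_stages_scale_lt_le {N₀ : ℕ} (hN₀ : ∀ N > N₀, (window p N).Nonempty) (τ : ℝ) {m : ℕ}
    (hm : 1 ≤ m) :
    ∃ k, (stages hN₀ τ k).scale < m ∧ m ≤ (stages hN₀ τ (k + 1)).scale := by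
  have hmono := stages_scale_strictMono hN₀ τ
  have hex : ∃ k, m ≤ (stages hN₀ τ k).scale := ⟨m, hmono.le_apply⟩
  classical
  have h0 : Nat.find hex ≠ 0 := by
    intro h
    have := Nat.find_spec hex
    rw [h] at this
    have h2 : (stages hN₀ τ 0).scale = 0 := rfl
    omega
  obtain ⟨k, hk⟩ := Nat.exists_eq_succ_of_ne_zero h0
  refine ⟨k, ?_, ?_⟩
  · exact not_le.1 (Nat.find_min hex (by omega))
  · have := Nat.find_spec hex
    rwa [hk] at this

/-- In the exponent `5`, four units come from the top `p ^ (N + 4)` of the window and one from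
rounding up; since the scale is about `τ (N + 5)` and the exponent is divided by `τ`, the constant
is independent of `τ`. -/
theorem Stage.pow_neg_freq_le {N₀ : ℕ} {τ : ℝ} (hτ : 2 < τ) (S : Stage p) {m : ℕ}
    (hm : m ≤ S.nextScale N₀ τ) :
    ((p : ℝ) ^ S.freq N₀)⁻¹ ≤ (p : ℝ) ^ 5 * (p : ℝ) ^ (-((m : ℝ) / τ)) := by
  have hpp := prime_real_pos p
  have hp1 := one_lt_prime_real p
  have hτ0 : 0 < τ := by linarith
  have h1 : (m : ℝ) ≤ τ * (S.freq N₀ + 5) := by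
    have h2 : (m : ℝ) ≤ max (S.freq N₀ : ℝ) ⌈τ * (S.freq N₀ + 4)⌉₊ := by
      rw [← Nat.cast_max]; exact Nat.cast_le.2 hm
    refine h2.trans (max_le ?_ ?_)
    · nlinarith [(Nat.cast_nonneg (S.freq N₀) : (0 : ℝ) ≤ _)]
    · have := (Nat.ceil_lt_add_one (a := τ * (S.freq N₀ + 4)) (by positivity)).le
      linarith
  have h2 : (m : ℝ) / τ ≤ S.freq N₀ + 5 := by
    rw [div_le_iff₀ hτ0]; linarith
  rw [← Real.rpow_natCast, ← Real.rpow_natCast, ← Real.rpow_neg hpp.le, ← Real.rpow_add hpp]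
  refine Real.rpow_le_rpow_of_exponent_le hp1.le ?_
  push_cast
  linarith

theorem decayConst_nonneg (p : ℕ) {c : ℝ} (hc : 0 < c) : 0 ≤ decayConst p c := by
  have : 0 ≤ ∑' t : ℤ, 1 / (1 + (t : ℝ) ^ 2) := tsum_nonneg fun t => by positivity
  unfold decayConst
  positivity

/-- The property of a measure to be the limit of the stages. -/
def IsLimit {N₀ : ℕ} (hN₀ : ∀ N > N₀, (window p N).Nonempty) (τ : ℝ) (μ : Measure ℚ_[p]) : Prop :=
  ∀ (k : ℕ) (φ : ℚ_[p] → ℂ) (C : ℝ), (∀ x, ‖φ x‖ ≤ C) → ConstOnBalls (stages hN₀ τ k).scale φ →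
    ∫ x, φ x ∂μ = ∫ x, φ x ∂(stages hN₀ τ k).measure

section Limit

variable {N₀ : ℕ} {hN₀ : ∀ N > N₀, (window p N).Nonempty} {τ : ℝ} {μ : Measure ℚ_[p]}

/-- With `scale k < m ≤ scale (k + 1)`, stage `k + 1` determines the transform. By the ultrametric
inequality the shifted frequencies `s + t` still have norm `p ^ m`. Up to `m = N` the discrete
transform vanishes, beyond that its decay applies, and `p ^ scale ≤ N < m` supplies the second
factor `m`. -/
theorem IsLimit.norm_fourierMeasure_le (hμ : IsLimit hN₀ τ μ) (hτ : 2 < τ) {c : ℝ} (hc : 0 < c)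
    (hw : ∀ N > N₀, c * (p : ℝ) ^ N / N ≤ (window p N).card) {m : ℕ} (hm : 1 ≤ m) {s : ℚ_[p]}
    (hs : ‖s‖ = (p : ℝ) ^ m) :
    ‖fourierMeasure μ s‖ ≤ decayConst p c * (p : ℝ) ^ 5 * (m : ℝ) ^ 2 *
      (p : ℝ) ^ (-((m : ℝ) / τ)) := by
  have hp1 := one_lt_prime_real p
  have hD := decayConst_nonneg p hc
  obtain ⟨k, hk1, hk2⟩ := exists_stages_scale_lt_le hN₀ τ hm
  have hconst := (constOnBalls_stdChar hs.le).mono hk2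
  have h1 : fourierMeasure μ s = ∫ x, (stages hN₀ τ k).density x • stdChar (x * s)
      ∂approxMeasure p ((stages hN₀ τ k).freq N₀) := by
    rw [fourierMeasure, hμ (k + 1) _ 1 (fun x => (norm_stdChar _).le) hconst,
      stages_integral_succ hN₀ τ k hconst]
  set S := stages hN₀ τ k with hS
  have hN1 : 1 ≤ S.freq N₀ := by have := S.lt_freq N₀; omega
  have hst : ∀ t : ℚ_[p], ‖t‖ ≤ (p : ℝ) ^ S.scale → ‖s + t‖ = (p : ℝ) ^ m := by
    intro t ht
    rw [norm_add_eq_of_lt, hs]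
    rw [hs]
    exact ht.trans_lt (pow_lt_pow_right₀ hp1 hk1)
  rw [h1]
  rcases le_or_gt m (S.freq N₀) with hmN | hmN
  · refine (norm_integral_density_stdChar_le S (S.freq N₀) s (A := 0) fun t ht => ?_).trans ?_
    · rw [fourierMeasure_approxMeasure_eq_zero hN1 (hN₀ _ (S.lt_freq N₀)), norm_zero]
      · rw [hst t ht]; exact one_lt_pow₀ hp1 (by omega)
      · rw [hst t ht]; exact pow_le_pow_right₀ hp1.le hmN
    · rw [mul_zero]; positivity
  · refine (norm_integral_density_stdChar_le S (S.freq N₀) s fun t ht =>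
      norm_fourierMeasure_approxMeasure_le hN1 hc (hw _ (S.lt_freq N₀)) hmN (hst t ht)).trans ?_
    have h2 := S.pow_neg_freq_le hτ (m := m) hk2
    have h3 : (p : ℝ) ^ S.scale ≤ m :=
      (S.pow_scale_le_freq N₀).trans (by exact_mod_cast hmN.le)
    rw [zpow_neg, zpow_natCast]
    calc (p : ℝ) ^ S.scale * (decayConst p c * m * ((p : ℝ) ^ S.freq N₀)⁻¹) ≤
        m * (decayConst p c * m * ((p : ℝ) ^ 5 * (p : ℝ) ^ (-((m : ℝ) / τ)))) := by gcongr
      _ = _ := by ring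

theorem measureReal_eq_of_integral_eq {μ ν : Measure ℚ_[p]} {B : Set ℚ_[p]} (hB : MeasurableSet B)
    (h : ∫ x, B.indicator (fun _ => (1 : ℂ)) x ∂μ = ∫ x, B.indicator (fun _ => (1 : ℂ)) x ∂ν) :
    μ.real B = ν.real B := by
  rw [integral_indicator_const _ hB, integral_indicator_const _ hB] at h
  simpa using h

theorem IsLimit.measureReal_closedBall (hμ : IsLimit hN₀ τ μ) {k m : ℕ}
    (hm : m ≤ (stages hN₀ τ k).scale) (x : ℚ_[p]) :
    μ.real (Metric.closedBall x ((p : ℝ) ^ (-(m : ℤ)))) =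
      (stages hN₀ τ k).measure.real (Metric.closedBall x ((p : ℝ) ^ (-(m : ℤ)))) := by
  refine measureReal_eq_of_integral_eq (measurableSet_closedBall' _ _) (hμ k _ 1 (fun y => ?_) ?_)
  · exact (norm_indicator_le_norm_self _ _).trans (by simp)
  · exact constOnBalls_closedBall_indicator hm x (1 : ℂ)

theorem Stage.measureReal_closedBall (S : Stage p) {m : ℕ} (hm : S.scale ≤ m) (x : ℚ_[p]) :
    S.measure.real (Metric.closedBall x ((p : ℝ) ^ (-(m : ℤ)))) =
      S.density x * (p : ℝ) ^ (-(m : ℤ)) := by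
  rw [← integral_indicator_one (measurableSet_closedBall' _ _), S.integral_measure]
  have : ∀ y, S.density y • (Metric.closedBall x ((p : ℝ) ^ (-(m : ℤ)))).indicator
      (1 : ℚ_[p] → ℝ) y =
      (Metric.closedBall x ((p : ℝ) ^ (-(m : ℤ)))).indicator (fun _ => S.density x) y := by
    intro y
    by_cases hy : y ∈ Metric.closedBall x ((p : ℝ) ^ (-(m : ℤ)))
    · rw [Set.indicator_of_mem hy, Set.indicator_of_mem hy]
      rw [Metric.mem_closedBall, dist_eq_norm] at hy
      rw [S.const.mono hm x y hy]; simp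
    · rw [Set.indicator_of_notMem hy, Set.indicator_of_notMem hy, smul_zero]
  simp_rw [this]
  rw [integral_indicator_const _ (measurableSet_closedBall' _ _), haar_real_closedBall, smul_eq_mul,
    mul_comm]

/-- Up to `m = N` the measure is spread uniformly inside the balls of the previous scale, which
reduces the claim to a smaller radius by induction. Beyond, the density bound (at most `m`) and the
ball bound for the discrete measure apply. -/
theorem IsLimit.measureReal_closedBall_le (hμ : IsLimit hN₀ τ μ) (hτ : 2 < τ) {c : ℝ} (hc : 0 < c)
    (hw : ∀ N > N₀, c * (p : ℝ) ^ N / N ≤ (window p N).card) (x : ℚ_[p]) {m : ℕ} (hm : 1 ≤ m) :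
    μ.real (Metric.closedBall x ((p : ℝ) ^ (-(m : ℤ)))) ≤
      (1 + (p : ℝ) ^ 8 / c * ((p : ℝ) ^ 10 + 1)) * (m : ℝ) ^ 2 *
        (p : ℝ) ^ (-(2 * (m : ℝ) / τ)) := by
  have hp1 := one_lt_prime_real p
  have hpp := prime_real_pos p
  have hτ0 : 0 < τ := by linarith
  set K := 1 + (p : ℝ) ^ 8 / c * ((p : ℝ) ^ 10 + 1) with hK
  have hK1 : 1 ≤ K := by rw [hK]; linarith [(by positivity :
    0 ≤ (p : ℝ) ^ 8 / c * ((p : ℝ) ^ 10 + 1))]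
  have hdecay : ∀ d : ℕ, (p : ℝ) ^ (-(d : ℤ)) ≤ (p : ℝ) ^ (-(2 * (d : ℝ) / τ)) := by
    intro d
    rw [← Real.rpow_intCast]
    refine Real.rpow_le_rpow_of_exponent_le hp1.le ?_
    push_cast
    rw [neg_le_neg_iff, div_le_iff₀ hτ0]
    nlinarith [(Nat.cast_nonneg d : (0 : ℝ) ≤ d)]
  induction m using Nat.strong_induction_on generalizing x with
  | _ m ih =>
    have hm1 : (1 : ℝ) ≤ m := mod_cast hm
    obtain ⟨k, hk1, hk2⟩ := exists_stages_scale_lt_le hN₀ τ hm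
    rw [hμ.measureReal_closedBall hk2]
    set B := Metric.closedBall x ((p : ℝ) ^ (-(m : ℤ))) with hB
    have hconst : ConstOnBalls m (B.indicator (1 : ℚ_[p] → ℝ)) :=
      constOnBalls_closedBall_indicator le_rfl x (1 : ℝ)
    have h1 : (stages hN₀ τ (k + 1)).measure.real B = ∫ y, (stages hN₀ τ k).density y •
        B.indicator (1 : ℚ_[p] → ℝ) y ∂approxMeasure p ((stages hN₀ τ k).freq N₀) := by
      rw [← integral_indicator_one (measurableSet_closedBall' _ _),
        stages_integral_succ hN₀ τ k (hconst.mono hk2)]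
    rw [h1]
    rcases le_or_gt m ((stages hN₀ τ k).freq N₀) with hmN | hmN
    · rw [Stage.integral_approxMeasure_eq hN₀ _ (hconst.mono hmN), ← Stage.integral_measure,
        integral_indicator_one (measurableSet_closedBall' _ _),
        Stage.measureReal_closedBall _ hk1.le]
      rcases Nat.eq_zero_or_pos (stages hN₀ τ k).scale with h0 | h0
      -- The scales increase strictly from `0`, so only the initial stage has scale `0`.
      · have hk0 : k = 0 := by
          by_contra hne
          have := stages_scale_strictMono hN₀ τ (Nat.pos_of_ne_zero hne)
          simp only at this
          omega
        subst hk0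
        have hd : (stages hN₀ τ 0).density x ≤ 1 := (Stage.init p).le_bound x
        calc (stages hN₀ τ 0).density x * (p : ℝ) ^ (-(m : ℤ)) ≤
            1 * (p : ℝ) ^ (-(2 * (m : ℝ) / τ)) := by gcongr; exact hdecay m
          _ ≤ _ := by
            gcongr
            exact one_le_mul_of_one_le_of_one_le hK1 (one_le_pow₀ hm1)
      · have h2 := ih _ hk1 x h0
        rw [hμ.measureReal_closedBall le_rfl, Stage.measureReal_closedBall _ le_rfl] at h2
        set n := (stages hN₀ τ k).scale with hn
        -- Shrinking the radius by `p ^ (-d)` gains a full factor `p ^ (-d)`, better than the needed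
        -- `p ^ (-2 d / τ)` since `τ > 2`.
        obtain ⟨d, rfl⟩ : ∃ d, m = n + d := ⟨m - n, by omega⟩
        have e1 : (p : ℝ) ^ (-((n + d : ℕ) : ℤ)) = (p : ℝ) ^ (-(n : ℤ)) * (p : ℝ) ^ (-(d : ℤ)) := by
          rw [← zpow_add₀ hpp.ne']; push_cast; congr 1; ring
        have e2 : (p : ℝ) ^ (-(2 * ((n + d : ℕ) : ℝ) / τ)) =
            (p : ℝ) ^ (-(2 * (n : ℝ) / τ)) * (p : ℝ) ^ (-(2 * (d : ℝ) / τ)) := by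
          rw [← Real.rpow_add hpp]; push_cast; congr 1; ring
        rw [e1, e2, ← mul_assoc, ← mul_assoc]
        have h3 : (n : ℝ) ^ 2 ≤ ((n + d : ℕ) : ℝ) ^ 2 := by
          gcongr
        calc _ ≤ K * (n : ℝ) ^ 2 * (p : ℝ) ^ (-(2 * (n : ℝ) / τ)) *
              (p : ℝ) ^ (-(2 * (d : ℝ) / τ)) := by
              gcongr
              exact hdecay d
          _ ≤ _ := by gcongr
    · set S := stages hN₀ τ k with hS
      set N := S.freq N₀ with hN
      have hN1 : 1 ≤ N := by have := S.lt_freq N₀; omega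
      have hprob := isProbabilityMeasure_approxMeasure (hN₀ N (S.lt_freq N₀))
      have h2 : ∫ y, S.density y • B.indicator (1 : ℚ_[p] → ℝ) y ∂approxMeasure p N ≤
          S.bound * (approxMeasure p N).real B := by
        rw [integral_approxMeasure, approxMeasure_real_apply N (measurableSet_closedBall' _ _),
          mul_left_comm, smul_eq_mul]
        refine mul_le_mul_of_nonneg_left ?_ (by positivity)
        rw [Finset.mul_sum]
        refine Finset.sum_le_sum fun z _ => ?_
        exact mul_le_mul_of_nonneg_right (S.le_bound _)
          (Set.indicator_nonneg (fun _ _ => zero_le_one) _)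
      have h3 := approxMeasure_closedBall_le hN1 hc (hw N (S.lt_freq N₀)) x m
      have hNm : (N : ℝ) ≤ m := mod_cast hmN.le
      have h4 : S.bound ≤ m := (S.bound_le_freq N₀).trans hNm
      have h5 : ((p : ℝ) ^ (2 * N))⁻¹ ≤ (p : ℝ) ^ 10 * (p : ℝ) ^ (-(2 * (m : ℝ) / τ)) := by
        have h6 := S.pow_neg_freq_le hτ (m := m) hk2
        calc ((p : ℝ) ^ (2 * N))⁻¹ = (((p : ℝ) ^ N)⁻¹) ^ 2 := by rw [inv_pow]; ring
          _ ≤ ((p : ℝ) ^ 5 * (p : ℝ) ^ (-((m : ℝ) / τ))) ^ 2 := by gcongr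
          _ = _ := by
            rw [mul_pow, ← pow_mul, ← Real.rpow_natCast (_ ^ _) 2, ← Real.rpow_mul hpp.le]
            congr 2; push_cast; ring
      have h7 : ((p : ℝ) ^ m)⁻¹ ≤ (p : ℝ) ^ (-(2 * (m : ℝ) / τ)) := by
        have := hdecay m
        rwa [zpow_neg, zpow_natCast] at this
      have hb := S.bound_nonneg
      calc _ ≤ S.bound * (approxMeasure p N).real B := h2
        _ ≤ m * ((p : ℝ) ^ 8 / c * m * ((p : ℝ) ^ 10 * (p : ℝ) ^ (-(2 * (m : ℝ) / τ)) +
            (p : ℝ) ^ (-(2 * (m : ℝ) / τ)))) := by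
            gcongr
            refine h3.trans ?_
            gcongr
        _ = ((p : ℝ) ^ 8 / c * ((p : ℝ) ^ 10 + 1)) * (m : ℝ) ^ 2 *
            (p : ℝ) ^ (-(2 * (m : ℝ) / τ)) := by ring
        _ ≤ _ := by
            gcongr
            rw [hK]; linarith

end Limit

/-! ### The support lies in the set of well-approximable points. -/

/-- The neighbourhood of the support of `approxMeasure` at the next scale. -/
def Stage.target (N₀ : ℕ) (τ : ℝ) (S : Stage p) : Set ℚ_[p] :=
  {x | ∃ z ∈ triples p (S.freq N₀), ‖x - ratPoint p z‖ ≤ (p : ℝ) ^ (-(S.nextScale N₀ τ : ℤ))}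

theorem constOnBalls_indicator_iff_mem {n : ℕ} {A : Set ℚ_[p]}
    (hA : ∀ x y : ℚ_[p], ‖y - x‖ ≤ (p : ℝ) ^ (-(n : ℤ)) → x ∈ A → y ∈ A) :
    ConstOnBalls n (A.indicator (fun _ => (1 : ℂ))) := by
  intro x y hxy
  by_cases hx : x ∈ A
  · rw [Set.indicator_of_mem hx, Set.indicator_of_mem (hA x y hxy hx)]
  · rw [Set.indicator_of_notMem hx,
      Set.indicator_of_notMem (fun hy => hx (hA y x (by rwa [norm_sub_rev]) hy))]

theorem Stage.isClosed_target (N₀ : ℕ) (τ : ℝ) (S : Stage p) : IsClosed (S.target N₀ τ) := by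
  have : S.target N₀ τ = ⋃ z ∈ (triples p (S.freq N₀) : Set (ℕ × ℕ × ℕ)),
      Metric.closedBall (ratPoint p z) ((p : ℝ) ^ (-(S.nextScale N₀ τ : ℤ))) := by
    ext x
    simp only [target, Set.mem_ofPred_eq, Set.mem_iUnion, Metric.mem_closedBall, dist_eq_norm,
      exists_prop, Finset.mem_coe]
  rw [this]
  exact (Finset.finite_toSet _).isClosed_biUnion fun _ _ => Metric.isClosed_closedBall

section Limit

variable {N₀ : ℕ} {hN₀ : ∀ N > N₀, (window p N).Nonempty} {τ : ℝ} {μ : Measure ℚ_[p]}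

/-- All atoms of the discrete measure lie in the target, which is a union of balls at the next
scale; hence stage `k + 1`, and with it the limit, gives this closed set full mass. -/
theorem IsLimit.support_subset_target [IsProbabilityMeasure μ] (hμ : IsLimit hN₀ τ μ) (k : ℕ) :
    μ.support ⊆ (stages hN₀ τ k).target N₀ τ := by
  set S := stages hN₀ τ k with hS
  have hcl := S.isClosed_target N₀ τ
  have hprob := isProbabilityMeasure_approxMeasure (hN₀ _ (S.lt_freq N₀))
  refine Measure.support_subset_of_isClosed hcl ?_
  have hconst : ConstOnBalls (S.nextScale N₀ τ)
      ((S.target N₀ τ).indicator (fun _ => (1 : ℂ))) := by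
    refine constOnBalls_indicator_iff_mem fun x y hxy => ?_
    rintro ⟨z, hz, hxz⟩
    exact ⟨z, hz, by simpa using norm_add_le_of_le hxy hxz⟩
  have h1 := hμ (k + 1) _ 1 (fun y => (norm_indicator_le_norm_self _ _).trans (by simp)) hconst
  rw [stages_integral_succ hN₀ τ k hconst] at h1
  have h2 : ∫ x, S.density x • (S.target N₀ τ).indicator (fun _ => (1 : ℂ)) x
      ∂approxMeasure p (S.freq N₀) = ∫ x, S.density x • (1 : ℂ) ∂approxMeasure p (S.freq N₀) := by
    rw [integral_approxMeasure, integral_approxMeasure]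
    congr 1
    refine Finset.sum_congr rfl fun z hz => ?_
    rw [Set.indicator_of_mem]
    exact ⟨z, hz, by simp⟩
  have hc1 : ConstOnBalls (S.freq N₀) (fun _ : ℚ_[p] => (1 : ℂ)) := fun _ _ _ => rfl
  rw [← hS, h2, S.integral_approxMeasure_eq hN₀ hc1, integral_indicator_const _ hcl.measurableSet,
    integral_smul_const, S.integral_eq] at h1
  have h3 : μ.real (S.target N₀ τ) = 1 := by simpa using h1
  rw [mem_ae_iff, prob_compl_eq_zero_iff hcl.measurableSet]
  rwa [Measure.real, ENNReal.toReal_eq_one_iff] at h3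

theorem IsLimit.support_subset_closedBall [IsProbabilityMeasure μ] (hμ : IsLimit hN₀ τ μ) :
    μ.support ⊆ Metric.closedBall 0 1 := by
  refine Measure.support_subset_of_isClosed Metric.isClosed_closedBall ?_
  have h := hμ.measureReal_closedBall (Nat.zero_le (stages hN₀ τ 0).scale) 0
  simp only [Nat.cast_zero, neg_zero, zpow_zero] at h
  have h2 : (stages hN₀ τ 0).measure (Metric.closedBall 0 1) = 1 :=
    (prob_compl_eq_zero_iff (measurableSet_closedBall' _ _)).1
      (stages hN₀ τ 0).measure_compl_closedBall
  rw [Measure.real, Measure.real, h2, ENNReal.toReal_one, ENNReal.toReal_eq_one_iff] at h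
  rwa [mem_ae_iff, prob_compl_eq_zero_iff (measurableSet_closedBall' _ _)]

theorem Stage.approx_of_mem_target (hτ : 2 < τ) (S : Stage p) {x : ℚ_[p]}
    (hx : x ∈ S.target N₀ τ) : ∃ q r : ℕ, S.freq N₀ < q ∧
      ‖x * ((q : ℤ) : ℚ_[p]) - ((r : ℤ) : ℚ_[p])‖ ≤ ((max |(q : ℤ)| |(r : ℤ)| : ℤ) : ℝ) ^ (-τ) := by
  obtain ⟨z, hz, hxz⟩ := hx
  have hN1 : 1 ≤ S.freq N₀ := by have := S.lt_freq N₀; omega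
  have hz1 := mem_triples.1 hz
  have hz2 := mem_window.1 hz1.1
  have hpp := prime_real_pos p
  have hp1 := one_lt_prime_real p
  refine ⟨z.1, 1 + z.2.1 + z.2.2, ?_, ?_⟩
  · have : S.freq N₀ < p ^ S.freq N₀ := Nat.lt_pow_self (Fact.out : p.Prime).one_lt
    omega
  · have hmax : (max |(z.1 : ℤ)| |((1 + z.2.1 + z.2.2 : ℕ) : ℤ)| : ℤ) = z.1 := by
      rw [abs_of_nonneg (by positivity), abs_of_nonneg (by positivity)]
      refine max_eq_left ?_
      exact_mod_cast (by omega)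
    rw [hmax]
    have hq0 := natCast_window_ne_zero hz1.1
    have e : x * ((z.1 : ℤ) : ℚ_[p]) - (((1 + z.2.1 + z.2.2 : ℕ) : ℤ) : ℚ_[p]) =
        (x - ratPoint p z) * (z.1 : ℚ_[p]) := by
      rw [ratPoint, sub_mul, div_mul_cancel₀ _ hq0]
      simp
    rw [e, norm_mul, norm_natCast_window hN1 hz1.1, mul_one]
    refine hxz.trans ?_
    have hz0 : (0 : ℝ) < z.1 := mod_cast hz2.2.pos
    have hle : (z.1 : ℝ) ≤ (p : ℝ) ^ (S.freq N₀ + 4) := mod_cast hz2.1.2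
    have hceil : τ * (S.freq N₀ + 4) ≤ (S.nextScale N₀ τ : ℝ) :=
      (Nat.le_ceil _).trans (Nat.cast_le.2 (le_max_right _ _))
    calc (p : ℝ) ^ (-(S.nextScale N₀ τ : ℤ)) ≤ ((p : ℝ) ^ (S.freq N₀ + 4)) ^ (-τ) := by
          rw [← Real.rpow_intCast, ← Real.rpow_natCast, ← Real.rpow_mul hpp.le]
          refine Real.rpow_le_rpow_of_exponent_le hp1.le ?_
          push_cast
          linarith
      _ ≤ (z.1 : ℝ) ^ (-τ) := Real.rpow_le_rpow_of_nonpos hz0 hle (by linarith)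
      _ = _ := by norm_num

theorem IsLimit.mem_probOn [IsProbabilityMeasure μ] (hμ : IsLimit hN₀ τ μ) (hτ : 2 < τ) :
    μ ∈ probOn (wellApprox p τ) := by
  refine ⟨inferInstance, (isCompact_closedBall 0 1).of_isClosed_subset Measure.isClosed_support
    hμ.support_subset_closedBall, fun x hx => ⟨?_, ?_⟩⟩
  · simpa using hμ.support_subset_closedBall hx
  · intro hfin
    obtain ⟨b, hb⟩ := (hfin.image Prod.fst).bddAbove
    obtain ⟨k, hk⟩ : ∃ k : ℕ, b ≤ k := ⟨b.toNat, Int.self_le_toNat b⟩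
    obtain ⟨q, r, hq, hqr⟩ := (stages hN₀ τ k).approx_of_mem_target hτ
      (hμ.support_subset_target k hx)
    have h1 : (q : ℤ) ≤ b := hb ⟨((q : ℤ), (r : ℤ)), hqr, rfl⟩
    -- Later stages give denominators `q > freq > scale ≥ k`, so the solutions are unbounded in `q`.
    have h2 : k ≤ (stages hN₀ τ k).scale := (stages_scale_strictMono hN₀ τ).le_apply
    have h3 := (stages hN₀ τ k).scale_lt_freq N₀
    omega

end Limit

/-! ### Passing from powers of `p` to arbitrary frequencies and radii. -/

theorem norm_fourierMeasure_le_one (μ : Measure ℚ_[p]) [IsProbabilityMeasure μ] (s : ℚ_[p]) :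
    ‖fourierMeasure μ s‖ ≤ 1 := by
  refine (norm_integral_le_of_norm_le_const (C := 1)
    (Filter.Eventually.of_forall fun x => (norm_stdChar _).le)).trans ?_
  simp

theorem exists_closedBall_eq_pow (p : ℕ) [Fact p.Prime] {r : ℝ} (hr0 : 0 < r) (hr1 : r ≤ 1) :
    ∃ m : ℕ, (p : ℝ) ^ (-(m : ℤ)) ≤ r ∧ r < (p : ℝ) ^ (-(m : ℤ) + 1) ∧
      ∀ x : ℚ_[p], Metric.closedBall x r = Metric.closedBall x ((p : ℝ) ^ (-(m : ℤ))) := by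
  have hp1 := one_lt_prime_real p
  obtain ⟨n, hn1, hn2⟩ := exists_mem_Ico_zpow hr0 hp1
  have hn0 : n ≤ 0 := by
    by_contra! h
    exact absurd (hn1.trans hr1) (not_le.2 (one_lt_zpow₀ hp1 h))
  obtain ⟨m, rfl⟩ : ∃ m : ℕ, n = -(m : ℤ) := ⟨n.natAbs, by omega⟩
  refine ⟨m, hn1, hn2, fun x => Set.Subset.antisymm ?_ (Metric.closedBall_subset_closedBall hn1)⟩
  intro y hy
  rw [Metric.mem_closedBall, dist_eq_norm] at hy ⊢
  rw [Padic.norm_le_pow_iff_norm_lt_pow_add_one]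
  exact hy.trans_lt hn2

theorem exists_salem_measure (p : ℕ) [Fact p.Prime] :
    ∃ C : ℝ, 0 < C ∧ ∀ τ : ℝ, 2 < τ → ∃ μ ∈ probOn (wellApprox p τ),
      (∀ ξ : ℚ_[p], 1 ≤ ‖ξ‖ →
        ‖fourierMeasure μ ξ‖ ≤ C * (‖ξ‖ ^ (-1 / τ) * Real.log (1 + ‖ξ‖) ^ 2)) ∧
      (∀ (x : ℚ_[p]) (r : ℝ), 0 < r → r ≤ 1 →
        μ.real (Metric.closedBall x r) ≤ C * (r ^ (2 / τ) * Real.log (1 + r⁻¹) ^ 2)) := by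
  have hp1 := one_lt_prime_real p
  have hpp := prime_real_pos p
  have hp2 : (2 : ℝ) ≤ p := mod_cast (Fact.out : p.Prime).two_le
  obtain ⟨c, hc, N₀, hN⟩ := exists_le_card_window p
  have hw : ∀ N > N₀, c * (p : ℝ) ^ N / N ≤ (window p N).card :=
    fun N h => hN N (le_of_lt h) (by omega)
  have hN₀ : ∀ N > N₀, (window p N).Nonempty := by
    intro N h
    have h1 := hw N h
    have h2 : (0 : ℝ) < N := by exact_mod_cast (by omega : 0 < N)
    have h3 : (0 : ℝ) < (window p N).card := lt_of_lt_of_le (by positivity) h1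
    exact Finset.card_pos.1 (by exact_mod_cast h3)
  set D := decayConst p c * (p : ℝ) ^ 5 with hD
  set K := 1 + (p : ℝ) ^ 8 / c * ((p : ℝ) ^ 10 + 1) with hK
  have hD0 : 0 ≤ D := mul_nonneg (decayConst_nonneg p hc) (by positivity)
  have hK0 : 0 ≤ K := by positivity
  have hl2 : 0 < Real.log 2 := Real.log_pos one_lt_two
  -- The summand `1` covers `‖ξ‖ = 1` and `r = 1`, where the logarithm is `log 2`; `D` is for the
  -- decay, and `4 K` allows for the loss of a factor `2` in the logarithm for balls. None of these
  -- depends on `τ`.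
  set C := (1 + D + 4 * K) / Real.log 2 ^ 2 with hC
  have hCl : C * Real.log 2 ^ 2 = 1 + D + 4 * K := by rw [hC]; field_simp
  have hC0 : 0 < C := by positivity
  refine ⟨C, hC0, fun τ hτ => ?_⟩
  have hτ0 : 0 < τ := by linarith
  obtain ⟨μ, hprob, hμ⟩ := exists_limit_measure hN₀ τ
  replace hμ : IsLimit hN₀ τ μ := hμ
  refine ⟨μ, hμ.mem_probOn hτ, ?_, ?_⟩
  · intro ξ hξ
    obtain ⟨m, hm⟩ := exists_norm_eq_pow ξ hξ
    rcases Nat.eq_zero_or_pos m with rfl | hm0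
    · refine (norm_fourierMeasure_le_one μ ξ).trans ?_
      rw [hm, pow_zero, Real.one_rpow, one_mul, one_add_one_eq_two, hCl]
      linarith
    · refine (hμ.norm_fourierMeasure_le hτ hc hw hm0 hm).trans ?_
      have hlog : m * Real.log 2 ≤ Real.log (1 + (p : ℝ) ^ m) := by
        rw [← Real.log_pow]
        refine Real.log_le_log (by positivity) ?_
        have : (2 : ℝ) ^ m ≤ (p : ℝ) ^ m := by gcongr
        linarith
      have e : ((p : ℝ) ^ m) ^ (-1 / τ) = (p : ℝ) ^ (-((m : ℝ) / τ)) := by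
        rw [← Real.rpow_natCast, ← Real.rpow_mul hpp.le]
        congr 1; ring
      rw [hm, e, ← hD]
      calc D * (m : ℝ) ^ 2 * (p : ℝ) ^ (-((m : ℝ) / τ)) ≤
          (1 + D + 4 * K) * (m : ℝ) ^ 2 * (p : ℝ) ^ (-((m : ℝ) / τ)) := by
            gcongr; linarith
        _ = C * ((p : ℝ) ^ (-((m : ℝ) / τ)) * (m * Real.log 2) ^ 2) := by rw [← hCl]; ring
        _ ≤ _ := by gcongr
  · intro x r hr0 hr1
    obtain ⟨m, hm1, hm2, hball⟩ := exists_closedBall_eq_pow p hr0 hr1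
    rw [hball]
    rcases Nat.eq_zero_or_pos m with rfl | hm0
    · have hr : r = 1 := le_antisymm hr1 (by simpa using hm1)
      refine measureReal_le_one.trans ?_
      rw [hr, Real.one_rpow, inv_one, one_mul, one_add_one_eq_two, hCl]
      linarith
    · refine (hμ.measureReal_closedBall_le hτ hc hw x hm0).trans ?_
      have hm1' : (1 : ℝ) ≤ m := mod_cast hm0
      -- Since only `r < p ^ (-m + 1)` is known, the direct bound is `(m - 1) log 2`; averaging it
      -- with the bound `log 2` gives half of `m log 2`.
      have hlog : m * Real.log 2 / 2 ≤ Real.log (1 + r⁻¹) := by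
        have h1 : (2 : ℝ) ^ (m - 1) ≤ r⁻¹ := by
          rw [le_inv_comm₀ (by positivity) hr0]
          refine hm2.le.trans ?_
          rw [show -(m : ℤ) + 1 = -((m - 1 : ℕ) : ℤ) by omega, zpow_neg, zpow_natCast]
          gcongr
        have h2 : (m - 1 : ℝ) * Real.log 2 ≤ Real.log (1 + r⁻¹) := by
          rw [show (m - 1 : ℝ) = ((m - 1 : ℕ) : ℝ) by push_cast [Nat.cast_sub hm0]; ring,
            ← Real.log_pow]
          exact Real.log_le_log (by positivity) (by linarith)
        have h3 : Real.log 2 ≤ Real.log (1 + r⁻¹) := by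
          refine Real.log_le_log (by positivity) ?_
          have := (one_le_inv₀ hr0).2 hr1
          linarith
        nlinarith
      have e : (p : ℝ) ^ (-(2 * (m : ℝ) / τ)) ≤ r ^ (2 / τ) := by
        calc (p : ℝ) ^ (-(2 * (m : ℝ) / τ)) = ((p : ℝ) ^ (-(m : ℤ))) ^ (2 / τ) := by
              rw [← Real.rpow_intCast, ← Real.rpow_mul hpp.le]
              congr 1; push_cast; ring
          _ ≤ _ := by gcongr
      rw [← hK]
      calc K * (m : ℝ) ^ 2 * (p : ℝ) ^ (-(2 * (m : ℝ) / τ)) ≤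
          ((1 + D + 4 * K) / 4) * (m : ℝ) ^ 2 * (p : ℝ) ^ (-(2 * (m : ℝ) / τ)) := by
            gcongr; linarith
        _ = C * ((p : ℝ) ^ (-(2 * (m : ℝ) / τ)) * (m * Real.log 2 / 2) ^ 2) := by rw [← hCl]; ring
        _ ≤ _ := by gcongr

/-! ### Upper bound for the Hausdorff dimension. -/

theorem ediam_closedBall_le (x : ℚ_[p]) (r : ℝ) :
    Metric.ediam (Metric.closedBall x r) ≤ ENNReal.ofReal r := by
  refine Metric.ediam_le fun y hy z hz => ?_
  rw [edist_dist]
  refine ENNReal.ofReal_le_ofReal ?_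
  rw [Metric.mem_closedBall, dist_eq_norm] at hy hz
  rw [dist_eq_norm]
  simpa using norm_sub_le_of_le hy hz

theorem summable_max_abs_rpow {k : ℝ} (hk : 2 < k) :
    Summable fun z : ℤ × ℤ => ((max |z.1| |z.2| : ℤ) : ℝ) ^ (-k) := by
  have h := EisensteinSeries.summable_one_div_norm_rpow hk
  rw [← (finTwoArrowEquiv ℤ).symm.summable_iff] at h
  refine h.congr fun z => ?_
  simp only [Function.comp, finTwoArrowEquiv_symm_apply, EisensteinSeries.norm_eq_max_natAbs]
  congr 1
  simp [Nat.cast_natAbs]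

/-- The points with infinitely many approximations by fractions with denominator prime to `p`. -/
def primApprox (p : ℕ) [Fact p.Prime] (τ : ℝ) : Set ℚ_[p] :=
  {x | {z : ℤ × ℤ | ¬ (p : ℤ) ∣ z.1 ∧ ‖x * (z.1 : ℚ_[p]) - (z.2 : ℚ_[p])‖ ≤
      ((max |z.1| |z.2| : ℤ) : ℝ) ^ (-τ)}.Infinite}

theorem norm_intCast_eq_one_of_not_dvd {q : ℤ} (h : ¬ (p : ℤ) ∣ q) : ‖(q : ℚ_[p])‖ = 1 := by
  rw [Padic.norm_intCast_eq_one_iff, isCoprime_comm]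
  exact (Prime.coprime_iff_not_dvd (Nat.prime_iff_prime_int.1 Fact.out)).2 h

open Filter Topology in
-- For `q` a unit, `‖x q - r‖ = ‖x - r / q‖`. Any cofinite family of the balls covers the limsup
-- set, and the sum of `max(|q|, |r|) ^ (-τ s)` over `ℤ²` converges because `τ s > 2`.
theorem hausdorffMeasure_primApprox_eq_zero {τ s : ℝ} (hτ : 2 < τ) (hs : 2 / τ < s) :
    Measure.hausdorffMeasure s (primApprox p τ) = 0 := by
  have hτ0 : 0 < τ := by linarith
  have hs0 : 0 < s := lt_trans (by positivity) hs
  set f : ℤ × ℤ → ℝ≥0∞ := fun z => ENNReal.ofReal (((max |z.1| |z.2| : ℤ) : ℝ) ^ (-τ)) with hf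
  have hM : ∀ z : ℤ × ℤ, (0 : ℝ) ≤ ((max |z.1| |z.2| : ℤ) : ℝ) := fun z => by
    exact_mod_cast le_max_of_le_left (abs_nonneg z.1)
  have hsum1 : ∑' z, f z ≠ ∞ := (summable_max_abs_rpow hτ).tsum_ofReal_ne_top
  have hsum2 : ∑' z, f z ^ s ≠ ∞ := by
    have h1 : 2 < τ * s := by rwa [div_lt_iff₀' hτ0] at hs
    have h2 := (summable_max_abs_rpow h1).tsum_ofReal_ne_top
    convert h2 using 3 with z
    rw [hf, ENNReal.ofReal_rpow_of_nonneg (Real.rpow_nonneg (hM z) _) hs0.le,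
      ← Real.rpow_mul (hM z)]
    congr 2; ring
  have hr := ENNReal.tendsto_tsum_compl_atTop_zero hsum1
  have hr2 := ENNReal.tendsto_tsum_compl_atTop_zero hsum2
  have hdiam : ∀ z : ℤ × ℤ, Metric.ediam (Metric.closedBall ((z.2 : ℚ_[p]) / (z.1 : ℚ_[p]))
      (((max |z.1| |z.2| : ℤ) : ℝ) ^ (-τ))) ≤ f z := fun z =>
    ediam_closedBall_le _ _
  have key := Measure.hausdorffMeasure_le_liminf_tsum (ι := fun S : Finset (ℤ × ℤ) => {z // z ∉ S})
    s (primApprox p τ) (l := atTop) _ hr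
    (fun S z => Metric.closedBall ((z.1.2 : ℚ_[p]) / (z.1.1 : ℚ_[p]))
      (((max |z.1.1| |z.1.2| : ℤ) : ℝ) ^ (-τ)))
    (Eventually.of_forall fun S z => (hdiam z.1).trans (ENNReal.le_tsum z))
    (Eventually.of_forall fun S x hx => by
      obtain ⟨z, hz, hzS⟩ := (show Set.Infinite _ from hx).exists_notMem_finset S
      refine Set.mem_iUnion.2 ⟨⟨z, hzS⟩, ?_⟩
      have hz1 := norm_intCast_eq_one_of_not_dvd hz.1
      have hz0 : (z.1 : ℚ_[p]) ≠ 0 := norm_ne_zero_iff.1 (by simp [hz1])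
      rw [Metric.mem_closedBall, dist_eq_norm]
      have e : x - (z.2 : ℚ_[p]) / (z.1 : ℚ_[p]) =
          (x * (z.1 : ℚ_[p]) - (z.2 : ℚ_[p])) / (z.1 : ℚ_[p]) := by field_simp
      rw [e, norm_div, hz1, div_one]
      exact hz.2)
  refine le_antisymm (key.trans ?_) zero_le
  refine (liminf_le_liminf (Eventually.of_forall fun S => ?_)).trans hr2.liminf_eq.le
  exact ENNReal.tsum_le_tsum fun z => ENNReal.rpow_le_rpow (hdiam z.1) hs0.le

theorem inv_abs_le_norm_intCast {r : ℤ} (hr : r ≠ 0) : |(r : ℝ)|⁻¹ ≤ ‖(r : ℚ_[p])‖ := by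
  have hr' : (r : ℚ_[p]) ≠ 0 := mod_cast hr
  have hpp := prime_real_pos p
  set v := padicValInt p r with hv
  have hdvd : (p : ℤ) ^ v ∣ r := by rw [hv]; exact padicValInt_dvd r
  have h1 : (p : ℝ) ^ v ≤ |(r : ℝ)| := by
    have := Int.le_of_dvd (abs_pos.2 hr) ((dvd_abs _ _).2 hdvd)
    exact_mod_cast this
  have h2 : ‖(r : ℚ_[p])‖ = ((p : ℝ) ^ v)⁻¹ := by
    rw [Padic.norm_eq_zpow_neg_valuation hr', Padic.valuation_intCast, zpow_neg, zpow_natCast]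
  rw [h2]
  gcongr

/-- Every good approximation is a multiple by a power of `p` of one with denominator prime to
`p`. -/
theorem exists_primitive_of_approx {τ : ℝ} (hτ : 2 < τ) {x : ℚ_[p]} (hx : ‖x‖ ≤ 1) {z : ℤ × ℤ}
    (hz : ‖x * (z.1 : ℚ_[p]) - (z.2 : ℚ_[p])‖ ≤ ((max |z.1| |z.2| : ℤ) : ℝ) ^ (-τ))
    (hz2 : 2 ≤ max |z.1| |z.2|) :
    ∃ (a : ℕ) (w : ℤ × ℤ), z = ((p : ℤ) ^ a * w.1, (p : ℤ) ^ a * w.2) ∧ ¬ (p : ℤ) ∣ w.1 ∧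
      ‖x * (w.1 : ℚ_[p]) - (w.2 : ℚ_[p])‖ ≤ ((max |w.1| |w.2| : ℤ) : ℝ) ^ (-τ) ∧
      ‖x * (w.1 : ℚ_[p]) - (w.2 : ℚ_[p])‖ ≤ ((p : ℝ) ^ a)⁻¹ := by
  obtain ⟨q, r⟩ := z
  simp only at hz hz2
  have hpp := prime_real_pos p
  have hp1 := one_lt_prime_real p
  set M := max |q| |r| with hM
  have hM2 : (2 : ℝ) ≤ M := mod_cast hz2
  have hlt : (M : ℝ) ^ (-τ) < (M : ℝ)⁻¹ := by
    rw [← Real.rpow_neg_one]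
    exact Real.rpow_lt_rpow_of_exponent_lt (by linarith) (by linarith)
  -- A nonzero integer `r` has `‖r‖ ≥ 1 / |r| ≥ 1 / M`, which exceeds `M ^ (-τ)`.
  have hfar : r ≠ 0 → ‖(r : ℚ_[p])‖ ≤ (M : ℝ) ^ (-τ) → False := by
    intro hr h
    have h1 := inv_abs_le_norm_intCast (p := p) hr
    have h2 : (M : ℝ)⁻¹ ≤ |(r : ℝ)|⁻¹ := by
      have h3 : 0 < |(r : ℝ)| := abs_pos.2 (mod_cast hr)
      have h4 : |(r : ℝ)| ≤ M := by
        have : |r| ≤ M := le_max_right _ _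
        exact_mod_cast this
      gcongr
    linarith
  have hq : q ≠ 0 := by
    rintro rfl
    have hr : r ≠ 0 := by
      rintro rfl
      simp [hM] at hz2
    refine hfar hr ?_
    simpa using hz
  obtain ⟨a, q', hq', rfl⟩ : ∃ (a : ℕ) (q' : ℤ), ¬ (p : ℤ) ∣ q' ∧ q = (p : ℤ) ^ a * q' := by
    have hfin : FiniteMultiplicity (p : ℤ) q := by
      rw [Int.finiteMultiplicity_iff]
      exact ⟨by simpa using (Fact.out : p.Prime).ne_one, hq⟩
    obtain ⟨q', h1, h2⟩ := hfin.exists_eq_pow_mul_and_not_dvd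
    exact ⟨_, q', h2, h1⟩
  have hqn : ‖(((p : ℤ) ^ a * q' : ℤ) : ℚ_[p])‖ = (p : ℝ) ^ (-(a : ℤ)) := by
    push_cast
    rw [norm_mul, Padic.norm_p_pow, norm_intCast_eq_one_of_not_dvd hq', mul_one]
  -- Otherwise `‖x q‖ ≤ ‖q‖ < ‖r‖`, so `‖x q - r‖ = ‖r‖`, which is too large.
  have hr : (p : ℤ) ^ a ∣ r := by
    by_contra hnd
    have hr0 : r ≠ 0 := fun h => hnd (h ▸ dvd_zero _)
    rw [← Padic.norm_int_le_pow_iff_dvd, not_le] at hnd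
    have hxq : ‖x * (((p : ℤ) ^ a * q' : ℤ) : ℚ_[p])‖ < ‖(r : ℚ_[p])‖ := by
      refine lt_of_le_of_lt ?_ hnd
      rw [norm_mul, hqn]
      exact mul_le_of_le_one_left (zpow_pos hpp _).le hx
    refine hfar hr0 ?_
    rw [norm_sub_rev, sub_eq_add_neg, norm_add_eq_of_lt (by rwa [norm_neg])] at hz
    exact hz
  obtain ⟨r', rfl⟩ := hr
  refine ⟨a, (q', r'), rfl, hq', ?_⟩
  simp only
  have hMM : M = (p : ℤ) ^ a * max |q'| |r'| := by
    rw [hM, abs_mul, abs_mul, abs_of_nonneg (by positivity : (0 : ℤ) ≤ (p : ℤ) ^ a),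
      mul_max_of_nonneg _ _ (by positivity)]
  set M' := max |q'| |r'| with hM'
  have hM'1 : (1 : ℝ) ≤ M' := by
    have h1 : 1 ≤ |q'| := Int.one_le_abs (fun h => hq' (h ▸ dvd_zero _))
    have h2 : 1 ≤ M' := h1.trans (le_max_left _ _)
    exact_mod_cast h2
  have hpa : 0 < (p : ℝ) ^ a := by positivity
  have e : ‖x * (q' : ℚ_[p]) - (r' : ℚ_[p])‖ =
      (p : ℝ) ^ a * ‖x * (((p : ℤ) ^ a * q' : ℤ) : ℚ_[p]) - (((p : ℤ) ^ a * r' : ℤ) : ℚ_[p])‖ := by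
    have : x * (((p : ℤ) ^ a * q' : ℤ) : ℚ_[p]) - (((p : ℤ) ^ a * r' : ℤ) : ℚ_[p]) =
        (p : ℚ_[p]) ^ a * (x * (q' : ℚ_[p]) - (r' : ℚ_[p])) := by push_cast; ring
    rw [this, norm_mul, Padic.norm_p_pow, zpow_neg, zpow_natCast, ← mul_assoc,
      mul_inv_cancel₀ hpa.ne', one_mul]
  -- Dividing by `p ^ a` enlarges the norm by `p ^ a`, while `M ^ (-τ)` contains `p ^ (-a τ)`, at
  -- most `p ^ (-2 a)`. The surplus `p ^ (-a)` yields the second inequality of the conclusion.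
  have h1 : ‖x * (q' : ℚ_[p]) - (r' : ℚ_[p])‖ ≤ ((p : ℝ) ^ a)⁻¹ * (M' : ℝ) ^ (-τ) := by
    rw [e]
    have h2 : (M : ℝ) ^ (-τ) ≤ ((p : ℝ) ^ a)⁻¹ ^ 2 * (M' : ℝ) ^ (-τ) := by
      have hMR : (M : ℝ) = (p : ℝ) ^ a * M' := by rw [hMM]; push_cast; ring
      rw [hMR, Real.mul_rpow hpa.le (by linarith)]
      gcongr
      rw [← Real.rpow_neg_one, ← Real.rpow_natCast (_ ^ (-1 : ℝ)), ← Real.rpow_mul hpa.le]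
      refine Real.rpow_le_rpow_of_exponent_le (one_le_pow₀ hp1.le) ?_
      push_cast; linarith
    calc _ ≤ (p : ℝ) ^ a * (((p : ℝ) ^ a)⁻¹ ^ 2 * (M' : ℝ) ^ (-τ)) := by
          gcongr; exact hz.trans h2
      _ = _ := by field_simp
  have hpa1 : ((p : ℝ) ^ a)⁻¹ ≤ 1 := inv_le_one_of_one_le₀ (one_le_pow₀ hp1.le)
  have hM'2 : (M' : ℝ) ^ (-τ) ≤ 1 := Real.rpow_le_one_of_one_le_of_nonpos hM'1 (by linarith)
  have hM'0 : 0 ≤ (M' : ℝ) ^ (-τ) := Real.rpow_nonneg (by linarith) _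
  exact ⟨h1.trans (mul_le_of_le_one_left hM'0 hpa1),
    h1.trans (mul_le_of_le_one_right (by positivity) hM'2)⟩

theorem finite_max_abs_lt_two : {z : ℤ × ℤ | max |z.1| |z.2| < 2}.Finite := by
  refine ((Set.finite_Icc (-2 : ℤ) 2).prod (Set.finite_Icc (-2 : ℤ) 2)).subset ?_
  intro z hz
  have h1 := (max_lt_iff.1 (show max |z.1| |z.2| < 2 from hz))
  have h2 := abs_lt.1 h1.1
  have h3 := abs_lt.1 h1.2
  exact ⟨⟨h2.1.le, h2.2.le⟩, ⟨h3.1.le, h3.2.le⟩⟩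

/-- If `x` is not rational, a primitive pair `w` has `x w₁ ≠ w₂`, and the bound by `p ^ (-a)` then
allows only finitely many multiples `p ^ a w`. So infinitely many solutions require infinitely many
primitive ones. -/
theorem wellApprox_subset {τ : ℝ} (hτ : 2 < τ) :
    wellApprox p τ ⊆ Set.range (fun r : ℚ => (r : ℚ_[p])) ∪ primApprox p τ := by
  rintro x ⟨hx, hinf⟩
  by_contra hnot
  rw [Set.mem_union, not_or] at hnot
  obtain ⟨hrat, hprim⟩ := hnot
  have hfin := Set.not_infinite.1 hprim
  set G := {z : ℤ × ℤ | ¬ (p : ℤ) ∣ z.1 ∧ ‖x * (z.1 : ℚ_[p]) - (z.2 : ℚ_[p])‖ ≤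
      ((max |z.1| |z.2| : ℤ) : ℝ) ^ (-τ)} with hG
  have hA : ∀ w ∈ G, {a : ℕ | ‖x * (w.1 : ℚ_[p]) - (w.2 : ℚ_[p])‖ ≤ ((p : ℝ) ^ a)⁻¹}.Finite := by
    intro w hw
    have hne : 0 < ‖x * (w.1 : ℚ_[p]) - (w.2 : ℚ_[p])‖ := by
      refine norm_pos_iff.2 fun h0 => hrat ⟨(w.2 : ℚ) / w.1, ?_⟩
      have hw0 : (w.1 : ℚ_[p]) ≠ 0 :=
        norm_ne_zero_iff.1 (by simp [norm_intCast_eq_one_of_not_dvd hw.1])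
      push_cast
      rw [div_eq_iff hw0]
      exact (sub_eq_zero.1 h0).symm
    obtain ⟨b, hb⟩ := pow_unbounded_of_one_lt (‖x * (w.1 : ℚ_[p]) - (w.2 : ℚ_[p])‖)⁻¹
      (one_lt_prime_real p)
    refine (Set.finite_lt_nat b).subset fun a ha => ?_
    have h1 : (p : ℝ) ^ a ≤ (‖x * (w.1 : ℚ_[p]) - (w.2 : ℚ_[p])‖)⁻¹ :=
      (le_inv_comm₀ hne (pow_pos (prime_real_pos p) _)).1 ha
    exact (pow_lt_pow_iff_right₀ (one_lt_prime_real p)).1 (h1.trans_lt hb)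
  refine hinf ((finite_max_abs_lt_two.union (hfin.biUnion fun w hw => (hA w hw).image
    (fun a => ((p : ℤ) ^ a * w.1, (p : ℤ) ^ a * w.2)))).subset ?_)
  intro z hz
  rcases lt_or_ge (max |z.1| |z.2|) 2 with h2 | h2
  · exact Or.inl h2
  · obtain ⟨a, w, rfl, hw1, hw2, hw3⟩ := exists_primitive_of_approx hτ hx hz h2
    exact Or.inr (Set.mem_biUnion (show w ∈ G from ⟨hw1, hw2⟩) ⟨a, hw3, rfl⟩)

theorem dimH_wellApprox_le {τ : ℝ} (hτ : 2 < τ) :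
    dimH (wellApprox p τ) ≤ ENNReal.ofReal (2 / τ) := by
  refine (dimH_mono (wellApprox_subset hτ)).trans ?_
  rw [dimH_union, dimH_countable (Set.countable_range _)]
  refine max_le zero_le (dimH_le fun d hd => ?_)
  by_contra! hlt
  rw [ENNReal.ofReal_lt_iff_lt_toReal (div_nonneg zero_le_two (by linarith)) (by simp),
    ENNReal.coe_toReal] at hlt
  rw [hausdorffMeasure_primApprox_eq_zero hτ hlt] at hd
  exact ENNReal.zero_ne_top hd

/-! ### Lower bounds for the Hausdorff dimension from balls and from energy. -/

/-- Mass distribution principle. -/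
theorem le_dimH_of_measureReal_closedBall_le (μ : Measure ℚ_[p]) [IsFiniteMeasure μ]
    {A : Set ℚ_[p]} (hA : MeasurableSet A) (hμA : μ A ≠ 0) {s : ℝ≥0} (hs : 0 < s) {K : ℝ}
    (hK : 0 < K) (h : ∀ x ∈ A, ∀ m : ℕ, μ.real (Metric.closedBall x ((p : ℝ) ^ (-(m : ℤ)))) ≤
      K * ((p : ℝ) ^ (-(m : ℤ))) ^ (s : ℝ)) : (s : ℝ≥0∞) ≤ dimH A := by
  have hp1 := one_lt_prime_real p
  have hs' : (0 : ℝ) < s := hs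
  have hball : ∀ x ∈ A, ∀ m : ℕ, μ (Metric.closedBall x ((p : ℝ) ^ (-(m : ℤ)))) ≤
      ENNReal.ofReal (K * ((p : ℝ) ^ (-(m : ℤ))) ^ (s : ℝ)) := fun x hx m => by
    rw [← ENNReal.ofReal_toReal (measure_ne_top μ _)]
    exact ENNReal.ofReal_le_ofReal (h x hx m)
  have hK0 : ENNReal.ofReal K ≠ 0 := by simpa using hK
  have hle : (ENNReal.ofReal K)⁻¹ • μ.restrict A ≤ Measure.hausdorffMeasure (s : ℝ) := by
    refine Measure.le_hausdorffMeasure _ _ 1 one_pos fun E hE => ?_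
    rw [Measure.smul_apply, Measure.restrict_apply' hA, smul_eq_mul,
      ENNReal.inv_mul_le_iff hK0 ENNReal.ofReal_ne_top]
    rcases Set.eq_empty_or_nonempty (E ∩ A) with h0 | ⟨x, hxE, hxA⟩
    · simp [h0]
    have hfin : Metric.ediam E ≠ ∞ := ne_top_of_le_ne_top ENNReal.one_ne_top hE
    have hsub : ∀ y ∈ E, dist y x ≤ (Metric.ediam E).toReal := by
      intro y hy
      rw [dist_edist]
      exact ENNReal.toReal_mono hfin (Metric.edist_le_ediam_of_mem hy hxE)
    -- Sets of diameter zero have no scale of their own; their mass is bounded at every scale `m`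
    -- and hence vanishes.
    rcases eq_or_ne (Metric.ediam E) 0 with h0 | h0
    · have hz : μ (E ∩ A) = 0 := by
        have hlim : Filter.Tendsto (fun m : ℕ =>
            ENNReal.ofReal (K * ((p : ℝ) ^ (-(m : ℤ))) ^ (s : ℝ))) Filter.atTop (nhds 0) := by
          rw [← ENNReal.ofReal_zero]
          refine ENNReal.tendsto_ofReal ?_
          have h2 : Filter.Tendsto (fun m : ℕ => (p : ℝ) ^ (-(m : ℤ))) Filter.atTop (nhds 0) := by
            simp only [zpow_neg, zpow_natCast, ← inv_pow]
            exact tendsto_pow_atTop_nhds_zero_of_lt_one (by positivity) (inv_lt_one_of_one_lt₀ hp1)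
          have h3 := (h2.rpow_const (p := (s : ℝ)) (Or.inr hs'.le)).const_mul K
          rwa [Real.zero_rpow hs'.ne', mul_zero] at h3
        refine le_antisymm (ge_of_tendsto' hlim fun m => ?_) zero_le
        refine (measure_mono fun y hy => ?_).trans (hball x hxA m)
        have := hsub y hy.1
        rw [h0, ENNReal.toReal_zero] at this
        rw [Metric.mem_closedBall]
        exact this.trans (by positivity)
      rw [hz]; exact zero_le
    · have hr0 : 0 < (Metric.ediam E).toReal := ENNReal.toReal_pos h0 hfin
      have hr1 : (Metric.ediam E).toReal ≤ 1 := by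
        have := ENNReal.toReal_mono ENNReal.one_ne_top hE
        simpa using this
      obtain ⟨m, hm1, -, hm⟩ := exists_closedBall_eq_pow p hr0 hr1
      calc μ (E ∩ A) ≤ μ (Metric.closedBall x ((p : ℝ) ^ (-(m : ℤ)))) := by
            refine measure_mono fun y hy => ?_
            rw [← hm, Metric.mem_closedBall]
            exact hsub y hy.1
        _ ≤ ENNReal.ofReal (K * ((p : ℝ) ^ (-(m : ℤ))) ^ (s : ℝ)) := hball x hxA m
        _ ≤ ENNReal.ofReal (K * (Metric.ediam E).toReal ^ (s : ℝ)) := by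
            gcongr
        _ = _ := by
            rw [ENNReal.ofReal_mul hK.le, ← ENNReal.ofReal_rpow_of_nonneg hr0.le hs'.le,
              ENNReal.ofReal_toReal hfin]
  refine le_dimH_of_hausdorffMeasure_ne_zero fun h0 => ?_
  have h1 := hle A
  rw [h0, Measure.smul_apply, Measure.restrict_apply_self, smul_eq_mul] at h1
  have h2 : (ENNReal.ofReal K)⁻¹ * μ A ≠ 0 :=
    mul_ne_zero (ENNReal.inv_ne_zero.2 ENNReal.ofReal_ne_top) hμA
  exact h2 (le_antisymm h1 zero_le)

theorem measure_support_eq_one (μ : Measure ℚ_[p]) [IsProbabilityMeasure μ] : μ μ.support = 1 :=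
  (prob_compl_eq_zero_iff Measure.isClosed_support.measurableSet).1 Measure.measure_compl_support

theorem exists_log_sq_le_rpow {ε : ℝ} (hε : 0 < ε) :
    ∃ K : ℝ, 0 < K ∧ ∀ y : ℝ, 1 ≤ y → Real.log (1 + y) ^ 2 ≤ K * y ^ ε := by
  refine ⟨2 ^ ε * (4 / ε ^ 2), by positivity, fun y hy => ?_⟩
  have hy0 : 0 ≤ y := by linarith
  have h1 := Real.log_le_rpow_div (x := 1 + y) (by linarith) (ε := ε / 2) (by positivity)
  have h0 : 0 ≤ Real.log (1 + y) := Real.log_nonneg (by linarith)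
  calc Real.log (1 + y) ^ 2 ≤ ((1 + y) ^ (ε / 2) / (ε / 2)) ^ 2 := by gcongr
    _ = (1 + y) ^ ε * (4 / ε ^ 2) := by
      rw [div_pow, ← Real.rpow_natCast, ← Real.rpow_mul (by linarith)]
      field_simp
      norm_num [mul_comm]
    _ ≤ (2 * y) ^ ε * (4 / ε ^ 2) := by gcongr; linarith
    _ = _ := by rw [Real.mul_rpow zero_le_two hy0]; ring

/-- For every `t < a` the squared logarithm is absorbed by the spare power `r ^ (a - t)`. -/
theorem ofReal_le_dimH_of_ball_condition {A : Set ℚ_[p]} {μ : Measure ℚ_[p]} (hμ : μ ∈ probOn A)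
    {C a : ℝ} (hC : 0 < C) (h : ∀ (x : ℚ_[p]) (r : ℝ), 0 < r → r ≤ 1 →
      μ.real (Metric.closedBall x r) ≤ C * (r ^ a * Real.log (1 + r⁻¹) ^ 2)) :
    ENNReal.ofReal a ≤ dimH A := by
  obtain ⟨hprob, -, hsub⟩ := hμ
  refine le_of_forall_lt fun s hs => ?_
  obtain ⟨t, hst, hta⟩ := ENNReal.lt_iff_exists_nnreal_btwn.1 hs
  have ht0 : 0 < t := by
    have : (0 : ℝ≥0∞) < t := lt_of_le_of_lt zero_le hst
    exact_mod_cast this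
  have hta' : (t : ℝ) < a := by
    rwa [ENNReal.lt_ofReal_iff_toReal_lt (by simp), ENNReal.coe_toReal] at hta
  refine hst.trans_le (le_trans ?_ (dimH_mono hsub))
  obtain ⟨K, hK0, hK⟩ := exists_log_sq_le_rpow (ε := a - t) (by linarith)
  have hpp := prime_real_pos p
  refine le_dimH_of_measureReal_closedBall_le μ Measure.isClosed_support.measurableSet
    (by simp [measure_support_eq_one]) ht0 (K := C * K) (by positivity) fun x _ m => ?_
  have hr0 : 0 < (p : ℝ) ^ (-(m : ℤ)) := zpow_pos hpp _
  have hr1 : (p : ℝ) ^ (-(m : ℤ)) ≤ 1 :=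
    zpow_le_one_of_nonpos₀ (one_lt_prime_real p).le (by omega)
  refine (h x _ hr0 hr1).trans ?_
  set r := (p : ℝ) ^ (-(m : ℤ)) with hr
  calc C * (r ^ a * Real.log (1 + r⁻¹) ^ 2) ≤ C * (r ^ a * (K * r⁻¹ ^ (a - t))) := by
        gcongr
        exact hK _ ((one_le_inv₀ hr0).2 hr1)
    _ = C * K * (r ^ a * r ^ (-(a - t))) := by
        rw [Real.inv_rpow hr0.le, Real.rpow_neg hr0.le]; ring
    _ = _ := by rw [← Real.rpow_add hr0]; congr 2; ring

theorem continuous_fourierMeasure (ν : Measure ℚ_[p]) [IsFiniteMeasure ν] :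
    Continuous (fourierMeasure ν) := by
  refine continuous_of_dominated (bound := fun _ => 1) (fun s => ?_) (fun s => ?_)
    (integrable_const _) ?_
  · exact (continuous_stdChar.comp (by fun_prop)).aestronglyMeasurable
  · exact Filter.Eventually.of_forall fun x => (norm_stdChar _).le
  · exact Filter.Eventually.of_forall fun x => continuous_stdChar.comp (by fun_prop)

theorem norm_sq_fourierMeasure (μ : Measure ℚ_[p]) [IsProbabilityMeasure μ] (t : ℚ_[p]) :
    ((‖fourierMeasure μ t‖ ^ 2 : ℝ) : ℂ) = ∫ z, stdChar ((z.1 - z.2) * t) ∂μ.prod μ := by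
  have h1 : (starRingEnd ℂ) (fourierMeasure μ t) = ∫ y, (starRingEnd ℂ) (stdChar (y * t)) ∂μ :=
    integral_conj.symm
  rw [← Complex.normSq_eq_norm_sq, ← Complex.mul_conj, h1, fourierMeasure,
    ← integral_prod_mul]
  congr 1; ext z
  rw [sub_mul, stdChar_sub]

/-- Write `|μ̂|²` as a double integral over `μ × μ` and integrate in `t` first: orthogonality leaves
`p ^ m` times the indicator of `‖x - y‖ ≤ p ^ (-m)`. -/
theorem energy_eq (μ : Measure ℚ_[p]) [IsProbabilityMeasure μ] (m : ℕ) :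
    ∫ t in Metric.closedBall 0 ((p : ℝ) ^ (m : ℤ)), ‖fourierMeasure μ t‖ ^ 2 ∂haar p =
      (p : ℝ) ^ m * ∫ x, μ.real (Metric.closedBall x ((p : ℝ) ^ (-(m : ℤ)))) ∂μ := by
  have hpp := prime_real_pos p
  set B := Metric.closedBall (0 : ℚ_[p]) ((p : ℝ) ^ (m : ℤ)) with hB
  have hfin : IsFiniteMeasure ((haar p).restrict B) :=
    ⟨by rw [Measure.restrict_apply_univ]; exact (isCompact_closedBall _ _).measure_lt_top⟩
  rw [← Complex.ofReal_inj, ← integral_complex_ofReal]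
  simp_rw [norm_sq_fourierMeasure]
  rw [integral_integral_swap]
  swap
  · refine Integrable.of_bound (C := 1) ?_ (Filter.Eventually.of_forall fun z => ?_)
    · exact (continuous_stdChar.comp (by fun_prop)).aestronglyMeasurable
    · exact (norm_stdChar _).le
  simp_rw [hB, setIntegral_closedBall_stdChar]
  have hset : MeasurableSet {z : ℚ_[p] × ℚ_[p] | ‖z.1 - z.2‖ ≤ (p : ℝ) ^ (-(m : ℤ))} :=
    measurableSet_le (by fun_prop) measurable_const
  have h1 : ∀ z : ℚ_[p] × ℚ_[p], (if ‖z.1 - z.2‖ ≤ (p : ℝ) ^ (-(m : ℤ)) then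
      ((p : ℝ) ^ (m : ℤ) : ℂ) else 0) =
      {z : ℚ_[p] × ℚ_[p] | ‖z.1 - z.2‖ ≤ (p : ℝ) ^ (-(m : ℤ))}.indicator
        (fun _ => ((p : ℝ) ^ (m : ℤ) : ℂ)) z := by
    intro z
    rw [Set.indicator_apply]
    rfl
  simp_rw [h1]
  rw [integral_indicator_const _ hset]
  have h2 : (μ.prod μ).real {z : ℚ_[p] × ℚ_[p] | ‖z.1 - z.2‖ ≤ (p : ℝ) ^ (-(m : ℤ))} =
      ∫ x, μ.real (Metric.closedBall x ((p : ℝ) ^ (-(m : ℤ)))) ∂μ := by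
    rw [Measure.real, Measure.prod_apply hset, integral_eq_lintegral_of_nonneg_ae]
    · congr 1
      refine lintegral_congr fun x => ?_
      rw [ofReal_measureReal]
      congr 1
      ext y
      simp [dist_eq_norm, norm_sub_rev]
    · exact Filter.Eventually.of_forall fun x => measureReal_nonneg
    · exact (constOnBalls_real_closedBall μ m).continuous.aestronglyMeasurable
  rw [h2, Complex.real_smul, zpow_natCast]
  push_cast
  ring

/-- Each shell `‖t‖ = X` has measure at most `X` and contributes at most `C X ^ (1 - β)`. As `β ≤ 1`
the last shell dominates, and there are `m` of them besides the unit ball. -/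
theorem setIntegral_norm_sq_fourierMeasure_le (μ : Measure ℚ_[p]) [IsProbabilityMeasure μ]
    {β C : ℝ} (hβ1 : β ≤ 1) (hC : 0 ≤ C)
    (h : ∀ ξ : ℚ_[p], ξ ≠ 0 → ‖fourierMeasure μ ξ‖ ^ 2 * ‖ξ‖ ^ β ≤ C) (m : ℕ) :
    ∫ t in Metric.closedBall 0 ((p : ℝ) ^ (m : ℤ)), ‖fourierMeasure μ t‖ ^ 2 ∂haar p ≤
      (1 + C * m) * ((p : ℝ) ^ m) ^ (1 - β) := by
  have hpp := prime_real_pos p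
  have hp1 := one_lt_prime_real p
  have hcont : Continuous fun t => ‖fourierMeasure μ t‖ ^ 2 :=
    (continuous_fourierMeasure μ).norm.pow 2
  induction m with
  | zero =>
    have := norm_setIntegral_le_of_norm_le_const (μ := haar p)
      (s := Metric.closedBall (0 : ℚ_[p]) 1) (C := 1)
      (f := fun t => ‖fourierMeasure μ t‖ ^ 2) (isCompact_closedBall _ _).measure_lt_top (by
        intro t _
        rw [Real.norm_of_nonneg (by positivity)]
        exact pow_le_one₀ (norm_nonneg _) (norm_fourierMeasure_le_one μ t))
    rw [Measure.real, haar_closedBall_one] at this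
    simpa using (le_abs_self _).trans this
  | succ m ih =>
    have hsub : Metric.closedBall (0 : ℚ_[p]) ((p : ℝ) ^ (m : ℤ)) ⊆
        Metric.closedBall 0 ((p : ℝ) ^ ((m + 1 : ℕ) : ℤ)) :=
      Metric.closedBall_subset_closedBall (zpow_le_zpow_right₀ hp1.le (by omega))
    rw [← Set.sdiff_union_of_subset hsub, setIntegral_union Set.disjoint_sdiff_left
      (measurableSet_closedBall' _ _) ((integrableOn_closedBall hcont _ _).mono_set Set.sdiff_subset)
      (integrableOn_closedBall hcont _ _)]
    set X := (p : ℝ) ^ (m + 1) with hX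
    have hX0 : 0 < X := by positivity
    have h2 : ∫ t in Metric.closedBall (0 : ℚ_[p]) ((p : ℝ) ^ ((m + 1 : ℕ) : ℤ)) \
        Metric.closedBall 0 ((p : ℝ) ^ (m : ℤ)), ‖fourierMeasure μ t‖ ^ 2 ∂haar p ≤
        C * X ^ (1 - β) := by
      have h3 := norm_setIntegral_le_of_norm_le_const (μ := haar p)
        (s := Metric.closedBall (0 : ℚ_[p]) ((p : ℝ) ^ ((m + 1 : ℕ) : ℤ)) \
          Metric.closedBall 0 ((p : ℝ) ^ (m : ℤ))) (C := C * X ^ (-β))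
        (f := fun t => ‖fourierMeasure μ t‖ ^ 2)
        (lt_of_le_of_lt (measure_mono Set.sdiff_subset)
          (isCompact_closedBall _ _).measure_lt_top) (by
          rintro t ⟨ht1, ht2⟩
          have htX : ‖t‖ = X := by
            rw [Metric.mem_closedBall, dist_zero_right] at ht1 ht2
            refine le_antisymm (by rwa [zpow_natCast] at ht1) ?_
            rw [Padic.norm_le_pow_iff_norm_lt_pow_add_one, not_lt] at ht2
            rw [hX]; exact_mod_cast ht2
          have ht0 : t ≠ 0 := norm_ne_zero_iff.1 (by rw [htX]; exact hX0.ne')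
          have h4 := h t ht0
          rw [htX] at h4
          rw [Real.norm_of_nonneg (by positivity), Real.rpow_neg hX0.le, ← div_eq_mul_inv,
            le_div_iff₀ (by positivity)]
          exact h4)
      refine (le_abs_self _).trans (h3.trans ?_)
      have h5 : (haar p).real (Metric.closedBall (0 : ℚ_[p]) ((p : ℝ) ^ ((m + 1 : ℕ) : ℤ)) \
          Metric.closedBall 0 ((p : ℝ) ^ (m : ℤ))) ≤ X := by
        refine (measureReal_mono Set.sdiff_subset
          (isCompact_closedBall _ _).measure_lt_top.ne).trans ?_
        rw [haar_real_closedBall, zpow_natCast]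
      calc C * X ^ (-β) * _ ≤ C * X ^ (-β) * X := by gcongr
        _ = C * (X ^ (-β) * X ^ (1 : ℝ)) := by rw [Real.rpow_one]; ring
        _ = _ := by rw [← Real.rpow_add hX0]; congr 2; ring
    have h6 : ((p : ℝ) ^ m) ^ (1 - β) ≤ X ^ (1 - β) := by
      have : (p : ℝ) ^ m ≤ X := pow_le_pow_right₀ hp1.le (by omega)
      have h7 : 0 ≤ 1 - β := by linarith
      gcongr
    have h8 : (1 + C * m) * ((p : ℝ) ^ m) ^ (1 - β) ≤ (1 + C * m) * X ^ (1 - β) := by gcongr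
    push_cast at *
    linarith

/-- For `t < β` the functions `p ^ (m t) μ(B(x, p ^ (-m)))` have `μ`-integrals summable in `m`.
Hence they are bounded in `m` at almost every `x`, and uniformly so on a set of positive measure,
where the mass distribution principle applies. -/
theorem ofReal_le_dimH_of_fourier_decay {A : Set ℚ_[p]} {μ : Measure ℚ_[p]} (hμ : μ ∈ probOn A)
    {β C : ℝ} (hβ1 : β ≤ 1)
    (h : ∀ ξ : ℚ_[p], ξ ≠ 0 → ‖fourierMeasure μ ξ‖ ^ 2 * ‖ξ‖ ^ β ≤ C) :
    ENNReal.ofReal β ≤ dimH A := by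
  have hpp := prime_real_pos p
  have hp1 := one_lt_prime_real p
  have hC : 0 ≤ C := (by positivity : (0 : ℝ) ≤ _).trans (h 1 one_ne_zero)
  obtain ⟨hprob, -, hsub⟩ := hμ
  refine le_of_forall_lt fun s hs => ?_
  obtain ⟨t, hst, hta⟩ := ENNReal.lt_iff_exists_nnreal_btwn.1 hs
  have ht0 : 0 < t := by
    have : (0 : ℝ≥0∞) < t := lt_of_le_of_lt zero_le hst
    exact_mod_cast this
  have hta' : (t : ℝ) < β := by
    rwa [ENNReal.lt_ofReal_iff_toReal_lt (by simp), ENNReal.coe_toReal] at hta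
  refine hst.trans_le ?_
  set g : ℕ → ℚ_[p] → ℝ := fun m x =>
    ((p : ℝ) ^ m) ^ (t : ℝ) * μ.real (Metric.closedBall x ((p : ℝ) ^ (-(m : ℤ)))) with hg
  have hg0 : ∀ m x, 0 ≤ g m x := fun m x => by positivity
  have hgc : ∀ m, Continuous (g m) := fun m =>
    continuous_const.mul (constOnBalls_real_closedBall μ m).continuous
  have hgi : ∀ m, ∫ x, g m x ∂μ ≤ (1 + C * m) * ((p : ℝ) ^ ((t : ℝ) - β)) ^ m := by
    intro m
    rw [hg, integral_const_mul]
    have h1 := setIntegral_norm_sq_fourierMeasure_le μ hβ1 hC h m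
    rw [energy_eq, ← le_div_iff₀' (by positivity)] at h1
    calc _ ≤ ((p : ℝ) ^ m) ^ (t : ℝ) * ((1 + C * m) * ((p : ℝ) ^ m) ^ (1 - β) / (p : ℝ) ^ m) := by
          gcongr
      _ = (1 + C * m) * (((p : ℝ) ^ m) ^ (t : ℝ) * ((p : ℝ) ^ m) ^ (1 - β) *
          ((p : ℝ) ^ m) ^ (-1 : ℝ)) := by rw [Real.rpow_neg_one]; ring
      _ = _ := by
          rw [← Real.rpow_add (by positivity), ← Real.rpow_add (by positivity),
            ← Real.rpow_natCast, ← Real.rpow_natCast, ← Real.rpow_mul hpp.le,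
            ← Real.rpow_mul hpp.le]
          congr 2; ring
  have hsum : Summable fun m : ℕ => (1 + C * m) * ((p : ℝ) ^ ((t : ℝ) - β)) ^ m := by
    have hρ : ‖(p : ℝ) ^ ((t : ℝ) - β)‖ < 1 := by
      rw [Real.norm_of_nonneg (by positivity)]
      exact Real.rpow_lt_one_of_one_lt_of_neg hp1 (by linarith)
    have h1 := summable_geometric_of_norm_lt_one hρ
    have h2 := (summable_pow_mul_geometric_of_norm_lt_one 1 hρ).mul_left C
    refine (h1.add h2).congr fun m => ?_
    simp only [pow_one]; ring
  have hInteg : ∀ m, Integrable (g m) μ := fun m => by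
    refine Integrable.of_bound (C := ((p : ℝ) ^ m) ^ (t : ℝ)) (hgc m).aestronglyMeasurable
      (Filter.Eventually.of_forall fun x => ?_)
    rw [Real.norm_of_nonneg (hg0 m x)]
    exact mul_le_of_le_one_right (by positivity) measureReal_le_one
  have hl : ∫⁻ x, ∑' m, ENNReal.ofReal (g m x) ∂μ ≠ ∞ := by
    rw [lintegral_tsum fun m => (hgc m).measurable.ennreal_ofReal.aemeasurable]
    refine ne_top_of_le_ne_top hsum.tsum_ofReal_ne_top (ENNReal.tsum_le_tsum fun m => ?_)
    rw [← ofReal_integral_eq_lintegral_ofReal (hInteg m) (Filter.Eventually.of_forall (hg0 m))]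
    exact ENNReal.ofReal_le_ofReal (hgi m)
  have hae := ae_lt_top (Measurable.tsum fun m => (hgc m).measurable.ennreal_ofReal) hl
  set F : ℕ → Set ℚ_[p] := fun K => μ.support ∩ {x | ∀ m, g m x ≤ K} with hF
  have hFm : ∀ K, MeasurableSet (F K) := fun K => by
    refine Measure.isClosed_support.measurableSet.inter ?_
    rw [Set.ofPred_forall]
    exact MeasurableSet.iInter fun m => measurableSet_le (hgc m).measurable measurable_const
  obtain ⟨K, hK⟩ : ∃ K, μ (F K) ≠ 0 := by
    by_contra! hall
    have h0 : μ (⋃ K, F K) = 0 := measure_iUnion_null hall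
    have h1 : (⋃ K, F K) ∈ ae μ := by
      filter_upwards [hae, Measure.support_mem_ae (μ := μ)] with x hx hxs
      obtain ⟨K, hK⟩ := exists_nat_ge (∑' m, ENNReal.ofReal (g m x)).toReal
      refine Set.mem_iUnion.2 ⟨K, hxs, fun m => le_trans ?_ hK⟩
      rw [← ENNReal.toReal_ofReal (hg0 m x)]
      exact ENNReal.toReal_mono hx.ne (ENNReal.le_tsum m)
    have h2 : μ (⋃ K, F K) = 1 :=
      (prob_compl_eq_zero_iff (MeasurableSet.iUnion hFm)).1 h1
    rw [h0] at h2
    exact zero_ne_one h2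
  refine le_trans ?_ (dimH_mono (Set.inter_subset_left.trans hsub : F K ⊆ A))
  refine le_dimH_of_measureReal_closedBall_le μ (hFm K) hK ht0 (K := K + 1) (by positivity)
    fun x hx m => ?_
  have h1 : g m x ≤ K + 1 := (hx.2 m).trans (by linarith)
  rw [zpow_neg, zpow_natCast, Real.inv_rpow (by positivity), ← div_eq_mul_inv,
    le_div_iff₀ (by positivity), mul_comm]
  rw [hg] at h1
  simpa only [zpow_neg, zpow_natCast] using h1

/-! ### Restriction at a single scale. -/

theorem integrable_stdChar_mul {f : ℚ_[p] → ℂ} (hf : Integrable f (haar p)) (s : ℚ_[p]) :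
    Integrable (fun x => stdChar (x * s) * f x) (haar p) :=
  hf.bdd_mul (c := 1) (continuous_stdChar.comp (by fun_prop)).aestronglyMeasurable
    (Filter.Eventually.of_forall fun x => (norm_stdChar _).le)

theorem continuous_fourierFun {f : ℚ_[p] → ℂ} (hf : Integrable f (haar p)) :
    Continuous (fourierFun f) := by
  refine continuous_of_dominated (bound := fun x => ‖f x‖)
    (fun s => (integrable_stdChar_mul hf s).aestronglyMeasurable) (fun s => ?_) hf.norm ?_
  · exact Filter.Eventually.of_forall fun x => by rw [norm_mul, norm_stdChar, one_mul]
  · exact Filter.Eventually.of_forall fun x =>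
      (continuous_stdChar.comp (by fun_prop)).mul continuous_const

theorem enorm_fourierFun_le (f : ℚ_[p] → ℂ) (s : ℚ_[p]) :
    ‖fourierFun f s‖ₑ ≤ ∫⁻ x, ‖f x‖ₑ ∂haar p := by
  refine (enorm_integral_le_lintegral_enorm _).trans (lintegral_mono fun x => ?_)
  have : ‖stdChar (x * s)‖ₑ = 1 := by rw [← ofReal_norm, norm_stdChar, ENNReal.ofReal_one]
  rw [enorm_mul, this, one_mul]

theorem norm_fourierFun_le {f : ℚ_[p] → ℂ} (s : ℚ_[p]) :
    ‖fourierFun f s‖ ≤ ∫ x, ‖f x‖ ∂haar p := by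
  refine (norm_integral_le_integral_norm _).trans (le_of_eq ?_)
  simp_rw [norm_mul, norm_stdChar, one_mul]

theorem integrable_norm_sq_fourierFun {f : ℚ_[p] → ℂ} (hf : Integrable f (haar p))
    (ν : Measure ℚ_[p]) [IsFiniteMeasure ν] : Integrable (fun t => ‖fourierFun f t‖ ^ 2) ν := by
  refine Integrable.of_bound (C := (∫ x, ‖f x‖ ∂haar p) ^ 2)
    ((continuous_fourierFun hf).norm.pow 2).aestronglyMeasurable
    (Filter.Eventually.of_forall fun t => ?_)
  rw [Real.norm_of_nonneg (by positivity)]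
  gcongr
  exact norm_fourierFun_le t

theorem integrable_prod_conj {f : ℚ_[p] → ℂ} (hf : Integrable f (haar p)) :
    Integrable (fun z : ℚ_[p] × ℚ_[p] => f z.1 * (starRingEnd ℂ) (f z.2))
      ((haar p).prod (haar p)) :=
  hf.mul_prod ((Complex.conjCLE : ℂ →L[ℝ] ℂ).integrable_comp hf)

theorem norm_sq_fourierFun {f : ℚ_[p] → ℂ} (t : ℚ_[p]) :
    ((‖fourierFun f t‖ ^ 2 : ℝ) : ℂ) = ∫ z, stdChar (t * (z.1 - z.2)) *
      (f z.1 * (starRingEnd ℂ) (f z.2)) ∂(haar p).prod (haar p) := by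
  have h1 : (starRingEnd ℂ) (fourierFun f t) =
      ∫ y, (starRingEnd ℂ) (stdChar (y * t) * f y) ∂haar p := integral_conj.symm
  rw [← Complex.normSq_eq_norm_sq, ← Complex.mul_conj, h1, fourierFun, ← integral_prod_mul]
  congr 1; ext z
  rw [mul_comm t, sub_mul, stdChar_sub, map_mul]
  ring

/-- Fubini after expanding the square: the `L²(ν)` norm of `f̂` is a quadratic form in `f` with
kernel `ν̂(x - y)`. Two measures can thus be compared through their transforms. -/
theorem integral_norm_sq_fourierFun {f : ℚ_[p] → ℂ} (hf : Integrable f (haar p))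
    (ν : Measure ℚ_[p]) [IsFiniteMeasure ν] :
    ((∫ t, ‖fourierFun f t‖ ^ 2 ∂ν : ℝ) : ℂ) =
      ∫ z, fourierMeasure ν (z.1 - z.2) * (f z.1 * (starRingEnd ℂ) (f z.2))
        ∂(haar p).prod (haar p) := by
  rw [← integral_complex_ofReal]
  simp_rw [norm_sq_fourierFun]
  rw [integral_integral_swap]
  · congr 1; ext z
    rw [fourierMeasure, integral_mul_const]
  · refine ((integrable_prod_conj hf).comp_snd ν).bdd_mul (c := 1) ?_
      (Filter.Eventually.of_forall fun x => (norm_stdChar _).le)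
    exact (continuous_stdChar.comp (by fun_prop)).aestronglyMeasurable

theorem ofReal_integral_norm_sq_fourierFun {f : ℚ_[p] → ℂ} (hf : Integrable f (haar p))
    (ν : Measure ℚ_[p]) [IsFiniteMeasure ν] :
    ENNReal.ofReal (∫ t, ‖fourierFun f t‖ ^ 2 ∂ν) = ∫⁻ t, ‖fourierFun f t‖ₑ ^ 2 ∂ν := by
  rw [ofReal_integral_eq_lintegral_ofReal (integrable_norm_sq_fourierFun hf ν)
    (Filter.Eventually.of_forall fun t => by positivity)]
  refine lintegral_congr fun t => ?_
  rw [ENNReal.ofReal_pow (norm_nonneg _), ofReal_norm]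

/-- Comparison of the `L²` norms of `f̂` with respect to two measures. -/
theorem lintegral_enorm_sq_fourierFun_le {f : ℚ_[p] → ℂ} (hf : Integrable f (haar p))
    (ν₁ ν₂ : Measure ℚ_[p]) [IsFiniteMeasure ν₁] [IsFiniteMeasure ν₂] :
    ∫⁻ t, ‖fourierFun f t‖ₑ ^ 2 ∂ν₁ ≤ ∫⁻ t, ‖fourierFun f t‖ₑ ^ 2 ∂ν₂ +
      ∫⁻ z, ‖fourierMeasure ν₁ (z.1 - z.2) - fourierMeasure ν₂ (z.1 - z.2)‖ₑ *
        (‖f z.1‖ₑ * ‖f z.2‖ₑ) ∂(haar p).prod (haar p) := by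
  have hb : ∀ (ν : Measure ℚ_[p]) [IsFiniteMeasure ν], Integrable (fun z : ℚ_[p] × ℚ_[p] =>
      fourierMeasure ν (z.1 - z.2) * (f z.1 * (starRingEnd ℂ) (f z.2)))
      ((haar p).prod (haar p)) := by
    intro ν _
    refine (integrable_prod_conj hf).bdd_mul (c := ν.real Set.univ) ?_
      (Filter.Eventually.of_forall fun z => ?_)
    · exact ((continuous_fourierMeasure ν).comp (by fun_prop)).aestronglyMeasurable
    · refine (norm_integral_le_of_norm_le_const (C := 1)
        (Filter.Eventually.of_forall fun x => (norm_stdChar _).le)).trans ?_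
      rw [one_mul]
  set I := ∫ z, (fourierMeasure ν₁ (z.1 - z.2) - fourierMeasure ν₂ (z.1 - z.2)) *
    (f z.1 * (starRingEnd ℂ) (f z.2)) ∂(haar p).prod (haar p) with hI
  have h1 : I = ((∫ t, ‖fourierFun f t‖ ^ 2 ∂ν₁ : ℝ) : ℂ) -
      ((∫ t, ‖fourierFun f t‖ ^ 2 ∂ν₂ : ℝ) : ℂ) := by
    rw [integral_norm_sq_fourierFun hf, integral_norm_sq_fourierFun hf,
      ← integral_sub (hb ν₁) (hb ν₂), hI]
    congr 1; ext z; ring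
  have h2 : ∫ t, ‖fourierFun f t‖ ^ 2 ∂ν₁ ≤ ∫ t, ‖fourierFun f t‖ ^ 2 ∂ν₂ + ‖I‖ := by
    have h3 : ‖I‖ = |∫ t, ‖fourierFun f t‖ ^ 2 ∂ν₁ - ∫ t, ‖fourierFun f t‖ ^ 2 ∂ν₂| := by
      rw [h1, ← Complex.ofReal_sub, Complex.norm_real, Real.norm_eq_abs]
    rw [h3]
    linarith [le_abs_self (∫ t, ‖fourierFun f t‖ ^ 2 ∂ν₁ - ∫ t, ‖fourierFun f t‖ ^ 2 ∂ν₂)]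
  have h4 := ENNReal.ofReal_le_ofReal h2
  rw [ENNReal.ofReal_add (integral_nonneg fun t => by positivity) (norm_nonneg _),
    ofReal_integral_norm_sq_fourierFun hf, ofReal_integral_norm_sq_fourierFun hf, ofReal_norm] at h4
  refine h4.trans ?_
  gcongr
  refine (enorm_integral_le_lintegral_enorm _).trans (le_of_eq (lintegral_congr fun z => ?_))
  rw [enorm_mul, enorm_mul, RCLike.enorm_conj]

theorem ENNReal_mul_le_sq_add_sq (a b : ℝ≥0∞) : a * b ≤ a ^ 2 + b ^ 2 := by
  rcases le_total a b with h | h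
  · calc a * b ≤ b * b := by gcongr
      _ = b ^ 2 := (sq b).symm
      _ ≤ _ := le_add_self
  · calc a * b ≤ a * a := by gcongr
      _ = a ^ 2 := (sq a).symm
      _ ≤ _ := le_self_add

/-- A local form of Plancherel's theorem. -/
theorem setLIntegral_enorm_sq_fourierFun_le {f : ℚ_[p] → ℂ} (hf : Integrable f (haar p))
    (hfm : Measurable f) :
    ∫⁻ t in Metric.closedBall 0 1, ‖fourierFun f t‖ₑ ^ 2 ∂haar p ≤
      2 * ∫⁻ x, ‖f x‖ₑ ^ 2 ∂haar p := by
  have hfin : IsFiniteMeasure ((haar p).restrict (Metric.closedBall 0 1)) :=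
    ⟨by rw [Measure.restrict_apply_univ]; exact (isCompact_closedBall _ _).measure_lt_top⟩
  have h := lintegral_enorm_sq_fourierFun_le hf ((haar p).restrict (Metric.closedBall 0 1)) 0
  rw [lintegral_zero_measure, zero_add] at h
  refine h.trans ?_
  -- The kernel is the transform of the indicator of `ℤ_p`, which is that same indicator. Its
  -- sections have measure `1`, so `a b ≤ a ^ 2 + b ^ 2` acts as a Schur test.
  set T : Set (ℚ_[p] × ℚ_[p]) := {z | ‖z.1 - z.2‖ ≤ 1} with hT
  have hTm : MeasurableSet T := measurableSet_le (by fun_prop) measurable_const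
  have hFT : ∀ z : ℚ_[p] × ℚ_[p], ‖fourierMeasure ((haar p).restrict (Metric.closedBall 0 1))
      (z.1 - z.2) - fourierMeasure 0 (z.1 - z.2)‖ₑ = T.indicator 1 z := by
    intro z
    have h1 := setIntegral_closedBall_stdChar (z.1 - z.2) 0
    simp only [zpow_zero, neg_zero] at h1
    rw [fourierMeasure, fourierMeasure, integral_zero_measure, sub_zero]
    simp_rw [mul_comm _ (z.1 - z.2)]
    rw [h1]
    by_cases hz : ‖z.1 - z.2‖ ≤ 1
    · rw [if_pos hz, Set.indicator_of_mem (show z ∈ T from hz)]; simp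
    · rw [if_neg hz, Set.indicator_of_notMem (show z ∉ T from hz)]; simp
  have hsec1 : ∀ x : ℚ_[p], ∫⁻ y, T.indicator 1 (x, y) ∂haar p = 1 := by
    intro x
    have : (fun y => T.indicator (1 : ℚ_[p] × ℚ_[p] → ℝ≥0∞) (x, y)) =
        (Metric.closedBall x 1).indicator 1 := by
      ext y
      have : (x, y) ∈ T ↔ y ∈ Metric.closedBall x 1 := by
        simp [hT, dist_eq_norm, norm_sub_rev]
      by_cases hy : y ∈ Metric.closedBall x 1
      · rw [Set.indicator_of_mem hy, Set.indicator_of_mem (this.2 hy)]; rfl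
      · rw [Set.indicator_of_notMem hy, Set.indicator_of_notMem (fun h => hy (this.1 h))]
    rw [this, lintegral_indicator_one (measurableSet_closedBall' _ _), haar_closedBall_one]
  have hsec2 : ∀ y : ℚ_[p], ∫⁻ x, T.indicator 1 (x, y) ∂haar p = 1 := by
    intro y
    rw [← hsec1 y]
    refine lintegral_congr fun x => ?_
    have : (x, y) ∈ T ↔ (y, x) ∈ T := by simp [hT, norm_sub_rev]
    by_cases hy : (x, y) ∈ T
    · rw [Set.indicator_of_mem hy, Set.indicator_of_mem (this.1 hy)]; rfl
    · rw [Set.indicator_of_notMem hy, Set.indicator_of_notMem (fun h => hy (this.2 h))]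
  have hTi : Measurable (T.indicator (1 : ℚ_[p] × ℚ_[p] → ℝ≥0∞)) :=
    measurable_one.indicator hTm
  have hm1 : Measurable fun z : ℚ_[p] × ℚ_[p] => T.indicator 1 z * ‖f z.1‖ₑ ^ 2 :=
    hTi.mul ((hfm.comp measurable_fst).enorm.pow_const 2)
  have hm2 : Measurable fun z : ℚ_[p] × ℚ_[p] => T.indicator 1 z * ‖f z.2‖ₑ ^ 2 :=
    hTi.mul ((hfm.comp measurable_snd).enorm.pow_const 2)
  calc _ ≤ ∫⁻ z, (T.indicator 1 z * ‖f z.1‖ₑ ^ 2 + T.indicator 1 z * ‖f z.2‖ₑ ^ 2)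
        ∂(haar p).prod (haar p) := by
        refine lintegral_mono fun z => ?_
        rw [hFT, ← mul_add]
        gcongr
        exact ENNReal_mul_le_sq_add_sq _ _
    _ = ∫⁻ z, T.indicator 1 z * ‖f z.1‖ₑ ^ 2 ∂(haar p).prod (haar p) +
        ∫⁻ z, T.indicator 1 z * ‖f z.2‖ₑ ^ 2 ∂(haar p).prod (haar p) := lintegral_add_left hm1 _
    _ = ∫⁻ x, ‖f x‖ₑ ^ 2 ∂haar p + ∫⁻ x, ‖f x‖ₑ ^ 2 ∂haar p := by
        congr 1
        · rw [lintegral_prod _ hm1.aemeasurable]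
          refine lintegral_congr fun x => ?_
          simp only
          have hx : Measurable fun y => T.indicator (1 : ℚ_[p] × ℚ_[p] → ℝ≥0∞) (x, y) :=
            hTi.comp measurable_prodMk_left
          rw [lintegral_mul_const _ hx, hsec1, one_mul]
        · rw [lintegral_prod_symm _ hm2.aemeasurable]
          refine lintegral_congr fun y => ?_
          simp only
          have hx : Measurable fun x => T.indicator (1 : ℚ_[p] × ℚ_[p] → ℝ≥0∞) (x, y) :=
            hTi.comp measurable_prodMk_right
          rw [lintegral_mul_const _ hx, hsec2, one_mul]
    _ = _ := (two_mul _).symm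

/-- The average of `μ` over balls of radius `p ^ (-k)`. -/
def ballAverage (μ : Measure ℚ_[p]) (k : ℕ) : Measure ℚ_[p] :=
  (haar p).withDensity fun t =>
    ENNReal.ofReal ((p : ℝ) ^ k * μ.real (Metric.closedBall t ((p : ℝ) ^ (-(k : ℤ)))))

theorem measurable_ballAverage_density (μ : Measure ℚ_[p]) (k : ℕ) : Measurable fun t : ℚ_[p] =>
    ENNReal.ofReal ((p : ℝ) ^ k * μ.real (Metric.closedBall t ((p : ℝ) ^ (-(k : ℤ))))) :=
  (continuous_const.mul (constOnBalls_real_closedBall μ k).continuous).measurable.ennreal_ofReal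

theorem measurableSet_norm_sub_le (r : ℝ) :
    MeasurableSet {z : ℚ_[p] × ℚ_[p] | ‖z.1 - z.2‖ ≤ r} :=
  measurableSet_le (by fun_prop) measurable_const

theorem integrable_indicator_norm_sub_le (μ : Measure ℚ_[p]) [IsProbabilityMeasure μ] (k : ℤ) :
    Integrable ({z : ℚ_[p] × ℚ_[p] | ‖z.1 - z.2‖ ≤ (p : ℝ) ^ k}.indicator (fun _ => (1 : ℂ)))
      ((haar p).prod μ) := by
  have hm := measurableSet_norm_sub_le (p := p) ((p : ℝ) ^ k)
  refine (integrable_indicator_iff hm).2 (integrableOn_const ?_)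
  rw [Measure.prod_apply_symm hm]
  have : ∀ u : ℚ_[p], haar p ((fun t => (t, u)) ⁻¹'
      {z : ℚ_[p] × ℚ_[p] | ‖z.1 - z.2‖ ≤ (p : ℝ) ^ k}) = ENNReal.ofReal ((p : ℝ) ^ k) := by
    intro u
    rw [← haar_closedBall u k]
    congr 1
  simp_rw [this]
  simp

/-- Averaging is convolution with the normalised indicator of a ball around `0`, whose transform is
the indicator of the dual ball. The cutoff in frequency is therefore sharp. -/
theorem fourierMeasure_ballAverage (μ : Measure ℚ_[p]) [IsProbabilityMeasure μ] (k : ℕ)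
    (s : ℚ_[p]) : fourierMeasure (ballAverage μ k) s =
      if ‖s‖ ≤ (p : ℝ) ^ k then fourierMeasure μ s else 0 := by
  have hpp := prime_real_pos p
  have hpk : ((p : ℂ) ^ k) ≠ 0 := pow_ne_zero _ (by exact_mod_cast hpp.ne')
  have hm := measurableSet_norm_sub_le (p := p) ((p : ℝ) ^ (-(k : ℤ)))
  set T := {z : ℚ_[p] × ℚ_[p] | ‖z.1 - z.2‖ ≤ (p : ℝ) ^ (-(k : ℤ))} with hT
  rw [fourierMeasure, ballAverage, integral_withDensity_eq_integral_toReal_smul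
    (measurable_ballAverage_density μ k)
    (Filter.Eventually.of_forall fun _ => ENNReal.ofReal_lt_top)]
  have h1 : ∀ t : ℚ_[p], (ENNReal.ofReal ((p : ℝ) ^ k *
      μ.real (Metric.closedBall t ((p : ℝ) ^ (-(k : ℤ)))))).toReal • stdChar (t * s) =
      ∫ u, (p : ℂ) ^ k * (stdChar (t * s) * T.indicator (fun _ => (1 : ℂ)) (t, u)) ∂μ := by
    intro t
    rw [integral_const_mul, integral_const_mul, ENNReal.toReal_ofReal (by positivity)]
    have : (fun u => T.indicator (fun _ => (1 : ℂ)) (t, u)) =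
        (Metric.closedBall t ((p : ℝ) ^ (-(k : ℤ)))).indicator (fun _ => (1 : ℂ)) := by
      ext u
      have : (t, u) ∈ T ↔ u ∈ Metric.closedBall t ((p : ℝ) ^ (-(k : ℤ))) := by
        simp only [hT, Set.mem_ofPred_eq, Metric.mem_closedBall, dist_eq_norm]
        rw [norm_sub_rev]
      by_cases hy : u ∈ Metric.closedBall t ((p : ℝ) ^ (-(k : ℤ)))
      · rw [Set.indicator_of_mem hy, Set.indicator_of_mem (this.2 hy)]
      · rw [Set.indicator_of_notMem hy, Set.indicator_of_notMem (fun h => hy (this.1 h))]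
    rw [this, integral_indicator_const _ (measurableSet_closedBall' _ _)]
    simp only [Complex.real_smul]
    push_cast; ring
  simp_rw [h1]
  rw [integral_integral_swap]
  swap
  · refine Integrable.const_mul ?_ _
    refine (integrable_indicator_norm_sub_le μ (-(k : ℤ))).bdd_mul (c := 1) ?_
      (Filter.Eventually.of_forall fun z => (norm_stdChar _).le)
    exact (continuous_stdChar.comp (by fun_prop)).aestronglyMeasurable
  have h2 : ∀ u : ℚ_[p], ∫ t, (p : ℂ) ^ k * (stdChar (t * s) *
      T.indicator (fun _ => (1 : ℂ)) (t, u)) ∂haar p =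
      if ‖s‖ ≤ (p : ℝ) ^ k then stdChar (u * s) else 0 := by
    intro u
    rw [integral_const_mul]
    have e : ∀ t, stdChar (t * s) * T.indicator (fun _ => (1 : ℂ)) (t, u) =
        (fun v => stdChar (u * s) * (Metric.closedBall 0 ((p : ℝ) ^ (-(k : ℤ)))).indicator
          (fun v => stdChar (s * v)) v) (-u + t) := by
      intro t
      have : (t, u) ∈ T ↔ -u + t ∈ Metric.closedBall (0 : ℚ_[p]) ((p : ℝ) ^ (-(k : ℤ))) := by
        simp only [hT, Set.mem_ofPred_eq, Metric.mem_closedBall, dist_zero_right]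
        rw [neg_add_eq_sub]
      simp only
      by_cases hy : (t, u) ∈ T
      · rw [Set.indicator_of_mem hy, Set.indicator_of_mem (this.1 hy), ← stdChar_add, mul_one]
        congr 1; ring
      · rw [Set.indicator_of_notMem hy, Set.indicator_of_notMem (fun h => hy (this.2 h))]
        simp
    simp_rw [e]
    rw [integral_add_left_eq_self (μ := haar p) (fun v => stdChar (u * s) *
      (Metric.closedBall 0 ((p : ℝ) ^ (-(k : ℤ)))).indicator (fun v => stdChar (s * v)) v) (-u),
      integral_const_mul, integral_indicator (measurableSet_closedBall' _ _),
      setIntegral_closedBall_stdChar, neg_neg, zpow_natCast]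
    split_ifs
    · push_cast
      rw [zpow_neg, zpow_natCast]
      field_simp
    · simp
  simp_rw [h2]
  split_ifs
  · rfl
  · simp

/-- The density is at most `p ^ k M` and vanishes off `ℤ_p`, since a ball of radius at most `1`
centred outside `ℤ_p` does not meet it. -/
theorem isFiniteMeasure_ballAverage (μ : Measure ℚ_[p]) [IsProbabilityMeasure μ]
    (hμ : μ (Metric.closedBall 0 1)ᶜ = 0) (k : ℕ) : IsFiniteMeasure (ballAverage μ k) ∧
      ∀ (G : ℚ_[p] → ℝ≥0∞) (M : ℝ), Measurable G →
        (∀ x, μ.real (Metric.closedBall x ((p : ℝ) ^ (-(k : ℤ)))) ≤ M) →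
        ∫⁻ t, G t ∂ballAverage μ k ≤
          ENNReal.ofReal ((p : ℝ) ^ k * M) * ∫⁻ t in Metric.closedBall 0 1, G t ∂haar p := by
  have hpp := prime_real_pos p
  have key : ∀ (G : ℚ_[p] → ℝ≥0∞) (M : ℝ), Measurable G →
      (∀ x, μ.real (Metric.closedBall x ((p : ℝ) ^ (-(k : ℤ)))) ≤ M) →
      ∫⁻ t, G t ∂ballAverage μ k ≤
        ENNReal.ofReal ((p : ℝ) ^ k * M) * ∫⁻ t in Metric.closedBall 0 1, G t ∂haar p := by
    intro G M hG hM
    rw [ballAverage, lintegral_withDensity_eq_lintegral_mul _ (measurable_ballAverage_density μ k)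
      hG, ← lintegral_const_mul _ hG, ← lintegral_indicator (measurableSet_closedBall' _ _)]
    refine lintegral_mono fun t => ?_
    simp only [Pi.mul_apply]
    by_cases ht : t ∈ Metric.closedBall (0 : ℚ_[p]) 1
    · rw [Set.indicator_of_mem ht]
      gcongr
      exact hM t
    · rw [Set.indicator_of_notMem ht]
      have h0 : μ.real (Metric.closedBall t ((p : ℝ) ^ (-(k : ℤ)))) = 0 := by
        rw [Measure.real, measure_mono_null _ hμ, ENNReal.toReal_zero]
        intro y hy hy1
        apply ht
        rw [Metric.mem_closedBall, dist_zero_right] at hy1 ⊢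
        rw [Metric.mem_closedBall, dist_comm, dist_eq_norm] at hy
        have h2 := hy.trans (zpow_le_one_of_nonpos₀ (one_lt_prime_real p).le
          (by omega : -(k : ℤ) ≤ 0))
        simpa using norm_add_le_of_le h2 hy1
      rw [h0]; simp
  refine ⟨⟨?_⟩, key⟩
  have h1 := key 1 1 measurable_one (fun x => measureReal_le_one)
  simp only [Pi.one_apply, lintegral_one, Measure.restrict_apply_univ, haar_closedBall_one] at h1
  exact h1.trans_lt (by simp)

/-- A single-scale restriction estimate. -/
theorem lintegral_enorm_sq_fourierFun_le_of_scale (μ : Measure ℚ_[p]) [IsProbabilityMeasure μ]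
    (hμ : μ (Metric.closedBall 0 1)ᶜ = 0) {k : ℕ} {M A : ℝ}
    (hM : ∀ x, μ.real (Metric.closedBall x ((p : ℝ) ^ (-(k : ℤ)))) ≤ M)
    (hA : ∀ s : ℚ_[p], (p : ℝ) ^ k < ‖s‖ → ‖fourierMeasure μ s‖ ≤ A)
    {f : ℚ_[p] → ℂ} (hf : Integrable f (haar p)) (hfm : Measurable f) :
    ∫⁻ t, ‖fourierFun f t‖ₑ ^ 2 ∂μ ≤
      ENNReal.ofReal ((p : ℝ) ^ k * M) * (2 * ∫⁻ x, ‖f x‖ₑ ^ 2 ∂haar p) +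
        ENNReal.ofReal A * (∫⁻ x, ‖f x‖ₑ ∂haar p) ^ 2 := by
  obtain ⟨hfin, hle⟩ := isFiniteMeasure_ballAverage μ hμ k
  refine (lintegral_enorm_sq_fourierFun_le hf μ (ballAverage μ k)).trans (add_le_add ?_ ?_)
  · refine (hle _ M ((continuous_fourierFun hf).measurable.enorm.pow_const 2) hM).trans ?_
    gcongr
    exact setLIntegral_enorm_sq_fourierFun_le hf hfm
  -- The difference of the transforms is zero up to `p ^ k` and equals `μ̂` beyond.
  · calc _ ≤ ∫⁻ z, ENNReal.ofReal A * (‖f z.1‖ₑ * ‖f z.2‖ₑ) ∂(haar p).prod (haar p) := by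
          refine lintegral_mono fun z => ?_
          gcongr
          rw [fourierMeasure_ballAverage]
          split_ifs with h
          · simp
          · rw [sub_zero, ← ofReal_norm]
            exact ENNReal.ofReal_le_ofReal (hA _ (not_le.1 h))
      _ = _ := by
          have hmm : Measurable fun z : ℚ_[p] × ℚ_[p] => ‖f z.1‖ₑ * ‖f z.2‖ₑ :=
            (hfm.comp measurable_fst).enorm.mul (hfm.comp measurable_snd).enorm
          rw [lintegral_const_mul _ hmm, lintegral_prod_mul hfm.enorm.aemeasurable
            hfm.enorm.aemeasurable, sq]

/-! ### Choice of the scale, dyadic summation and the full restriction estimate. -/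

/-- With `X = p ^ k`, the terms `X ^ (1 - 2/τ) Y ^ (q - 2)` and `X ^ (-1/τ) Y ^ (2 q - 2)` balance
at `X = Y ^ γ`, `γ = q τ / (τ - 1)`. Both then equal `Y ^ (-σ)`, and `σ > 0` is exactly the
condition on `q`. The small `ε` is for the logarithms and costs at most half of `σ`. -/
theorem exists_scale_exponent_bound {τ q : ℝ} (hτ : 2 < τ) (hq : 1 ≤ q)
    (hq' : q < 1 + 1 / (2 * τ - 3)) : ∃ δ > (0 : ℝ), ∃ ε > (0 : ℝ), ε < 1 / τ ∧ ∃ K > (0 : ℝ), ∀ Y : ℝ, 1 ≤ Y →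
      ∃ k : ℕ, (p : ℝ) ^ k * ((p : ℝ) ^ k) ^ (-(2 / τ) + ε) * Y ^ (q - 2) ≤ K * Y ^ (-δ) ∧
        ((p : ℝ) ^ k) ^ (-1 / τ + ε) * Y ^ (2 * q - 2) ≤ K * Y ^ (-δ) := by
  have hp1 := one_lt_prime_real p
  have hp0 := prime_real_pos p
  have hτ1 : 0 < τ - 1 := by linarith
  set σ : ℝ := 2 - q * (2 * τ - 3) / (τ - 1) with hσ
  have hσ0 : 0 < σ := by
    rw [hσ, sub_pos, div_lt_iff₀ hτ1]
    have h3 : 0 < 2 * τ - 3 := by linarith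
    have := mul_lt_mul_of_pos_right hq' h3
    rw [add_mul, one_div, inv_mul_cancel₀ h3.ne'] at this
    linarith
  set γ : ℝ := q * τ / (τ - 1) with hγ
  have hγ0 : 0 < γ := by positivity
  set ε : ℝ := min (σ / (2 * γ)) (1 / (2 * τ)) with hε
  have hε0 : 0 < ε := lt_min (by positivity) (by positivity)
  have hε1 : ε < 1 / τ := (min_le_right _ _).trans_lt
    (one_div_lt_one_div_of_lt (by linarith) (by linarith))
  have hγε : γ * ε ≤ σ / 2 := by
    calc γ * ε ≤ γ * (σ / (2 * γ)) := by gcongr; exact min_le_left _ _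
      _ = σ / 2 := by field_simp
  have hτ2 : 2 / τ < 1 := (div_lt_one (by linarith)).2 hτ
  refine ⟨σ / 2, by positivity, ε, hε0, hε1, (p : ℝ) ^ (1 - 2 / τ + ε) + 1, by positivity,
    fun Y hY => ?_⟩
  have hY0 : 0 < Y := by linarith
  obtain ⟨n, hn1, hn2⟩ := exists_nat_pow_near (Real.one_le_rpow hY hγ0.le) hp1
  have hYs : 0 < Y ^ (-(σ / 2)) := by positivity
  -- Rounding up keeps `X ≥ Y ^ γ`, as the second bound needs; the first one loses a constant power
  -- of `p`.
  refine ⟨n + 1, ?_, ?_⟩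
  · have hX : (0 : ℝ) < (p : ℝ) ^ (n + 1) := by positivity
    have hX2 : (p : ℝ) ^ (n + 1) ≤ p * Y ^ γ := by
      rw [pow_succ']; gcongr
    calc (p : ℝ) ^ (n + 1) * ((p : ℝ) ^ (n + 1)) ^ (-(2 / τ) + ε) * Y ^ (q - 2)
        = ((p : ℝ) ^ (n + 1)) ^ (1 - 2 / τ + ε) * Y ^ (q - 2) := by
          rw [show 1 - 2 / τ + ε = 1 + (-(2 / τ) + ε) by ring, Real.rpow_add hX 1, Real.rpow_one]
      _ ≤ (p * Y ^ γ) ^ (1 - 2 / τ + ε) * Y ^ (q - 2) := by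
          gcongr
      _ = (p : ℝ) ^ (1 - 2 / τ + ε) * Y ^ (γ * (1 - 2 / τ + ε) + (q - 2)) := by
          rw [Real.mul_rpow hp0.le (by positivity), ← Real.rpow_mul hY0.le, mul_assoc,
            ← Real.rpow_add hY0]
      _ ≤ ((p : ℝ) ^ (1 - 2 / τ + ε) + 1) * Y ^ (-(σ / 2)) := by
          gcongr
          · linarith
          · have : γ * (1 - 2 / τ) + (q - 2) = -σ := by
              rw [hγ, hσ]; field_simp; ring
            linarith
  · have hneg : -1 / τ + ε ≤ 0 := by rw [neg_div]; linarith
    calc ((p : ℝ) ^ (n + 1)) ^ (-1 / τ + ε) * Y ^ (2 * q - 2)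
        ≤ (Y ^ γ) ^ (-1 / τ + ε) * Y ^ (2 * q - 2) := by
          gcongr ?_ * _
          exact Real.rpow_le_rpow_of_nonpos (by positivity) hn2.le hneg
      _ = 1 * Y ^ (γ * (-1 / τ + ε) + (2 * q - 2)) := by
          rw [← Real.rpow_mul hY0.le, ← Real.rpow_add hY0, one_mul]
      _ ≤ ((p : ℝ) ^ (1 - 2 / τ + ε) + 1) * Y ^ (-(σ / 2)) := by
          gcongr
          · have : 0 < (p : ℝ) ^ (1 - 2 / τ + ε) := by positivity
            linarith
          · have : γ * (-1 / τ) + (2 * q - 2) = -σ := by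
              rw [hγ, hσ]; field_simp; ring
            linarith

/-- The two norm hypotheses are those satisfied by the part of a function of unit `L^q` norm whose
values have size about `1 / Y`. -/
theorem exists_restriction_scale_bound {μ : Measure ℚ_[p]} [IsProbabilityMeasure μ]
    (hμ : μ (Metric.closedBall 0 1)ᶜ = 0) {τ q C : ℝ} (hτ : 2 < τ) (hq : 1 ≤ q)
    (hq' : q < 1 + 1 / (2 * τ - 3)) (hC : 0 < C)
    (hdecay : ∀ ξ : ℚ_[p], 1 ≤ ‖ξ‖ →
      ‖fourierMeasure μ ξ‖ ≤ C * (‖ξ‖ ^ (-1 / τ) * Real.log (1 + ‖ξ‖) ^ 2))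
    (hball : ∀ (x : ℚ_[p]) (r : ℝ), 0 < r → r ≤ 1 →
      μ.real (Metric.closedBall x r) ≤ C * (r ^ (2 / τ) * Real.log (1 + r⁻¹) ^ 2)) :
    ∃ δ > (0 : ℝ), ∃ K > (0 : ℝ), ∀ Y : ℝ, 1 ≤ Y → ∀ f : ℚ_[p] → ℂ, Integrable f (haar p) → Measurable f →
      ∫⁻ x, ‖f x‖ₑ ^ 2 ∂haar p ≤ ENNReal.ofReal (4 * Y ^ (q - 2)) →
      ∫⁻ x, ‖f x‖ₑ ∂haar p ≤ ENNReal.ofReal (2 * Y ^ (q - 1)) →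
      ∫⁻ t, ‖fourierFun f t‖ₑ ^ 2 ∂μ ≤ ENNReal.ofReal (K * Y ^ (-δ)) := by
  have hp1 := one_lt_prime_real p
  have hp0 := prime_real_pos p
  obtain ⟨δ, hδ, ε, hε, hετ, K, hK, h⟩ := exists_scale_exponent_bound (p := p) hτ hq hq'
  obtain ⟨L, hL, hlog⟩ := exists_log_sq_le_rpow hε
  refine ⟨δ, hδ, 12 * (C * L * K), by positivity, fun Y hY f hf hfm h2 h1 => ?_⟩
  have hY0 : 0 < Y := by linarith
  obtain ⟨k, hk1, hk2⟩ := h Y hY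
  have hX1 : (1 : ℝ) ≤ (p : ℝ) ^ k := one_le_pow₀ hp1.le
  have hX0 : (0 : ℝ) < (p : ℝ) ^ k := by positivity
  have hM : ∀ x : ℚ_[p], μ.real (Metric.closedBall x ((p : ℝ) ^ (-(k : ℤ)))) ≤
      C * L * ((p : ℝ) ^ k) ^ (-(2 / τ) + ε) := by
    intro x
    rw [zpow_neg, zpow_natCast]
    refine (hball x _ (by positivity) (inv_le_one_of_one_le₀ hX1)).trans ?_
    rw [inv_inv, Real.inv_rpow hX0.le, ← Real.rpow_neg hX0.le, Real.rpow_add hX0]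
    rw [mul_assoc, mul_left_comm L]
    gcongr
    exact hlog _ hX1
  have hA : ∀ s : ℚ_[p], (p : ℝ) ^ k < ‖s‖ → ‖fourierMeasure μ s‖ ≤
      C * L * ((p : ℝ) ^ k) ^ (-1 / τ + ε) := by
    intro s hs
    have hs1 : 1 ≤ ‖s‖ := hX1.trans hs.le
    have hs0 : 0 < ‖s‖ := by linarith
    calc _ ≤ C * (‖s‖ ^ (-1 / τ) * Real.log (1 + ‖s‖) ^ 2) := hdecay s hs1
      _ ≤ C * (‖s‖ ^ (-1 / τ) * (L * ‖s‖ ^ ε)) := by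
          gcongr
          exact hlog _ hs1
      _ = C * L * ‖s‖ ^ (-1 / τ + ε) := by rw [Real.rpow_add hs0]; ring
      _ ≤ _ := by
          gcongr ?_ * ?_
          exact Real.rpow_le_rpow_of_nonpos hX0 hs.le (by rw [neg_div]; linarith)
  have hpow : (Y ^ (q - 1)) ^ 2 = Y ^ (2 * q - 2) := by
    rw [← Real.rpow_natCast, ← Real.rpow_mul hY0.le]; congr 1; push_cast; ring
  refine (lintegral_enorm_sq_fourierFun_le_of_scale μ hμ hM hA hf hfm).trans ?_
  calc _ ≤ ENNReal.ofReal ((p : ℝ) ^ k * (C * L * ((p : ℝ) ^ k) ^ (-(2 / τ) + ε))) *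
          (2 * ENNReal.ofReal (4 * Y ^ (q - 2))) +
        ENNReal.ofReal (C * L * ((p : ℝ) ^ k) ^ (-1 / τ + ε)) *
          ENNReal.ofReal (2 * Y ^ (q - 1)) ^ 2 := by gcongr
    _ = ENNReal.ofReal (C * L * (8 * ((p : ℝ) ^ k * ((p : ℝ) ^ k) ^ (-(2 / τ) + ε) *
          Y ^ (q - 2)) + 4 * (((p : ℝ) ^ k) ^ (-1 / τ + ε) * Y ^ (2 * q - 2)))) := by
        rw [show (2 : ℝ≥0∞) = ENNReal.ofReal 2 by simp, ← ENNReal.ofReal_mul (by norm_num),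
          ← ENNReal.ofReal_mul (by positivity), ← ENNReal.ofReal_pow (by positivity),
          ← ENNReal.ofReal_mul (by positivity), ← ENNReal.ofReal_add (by positivity)
          (by positivity), mul_pow, hpow]
        congr 1; ring
    _ ≤ _ := by
        refine ENNReal.ofReal_le_ofReal ?_
        calc _ ≤ C * L * (8 * (K * Y ^ (-δ)) + 4 * (K * Y ^ (-δ))) := by gcongr
          _ = _ := by ring

/-- A weak substitute for Cauchy–Schwarz: each `v j * a j` is at most the square root of the sum of
squares. It suffices since the weights will be geometric. -/
theorem sq_tsum_le_of_weights (a w v : ℕ → ℝ≥0∞) (h : ∀ j, w j * v j = 1) :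
    (∑' j, a j) ^ 2 ≤ (∑' j, w j) ^ 2 * ∑' j, (v j * a j) ^ 2 := by
  set S := ∑' j, (v j * a j) ^ 2
  have hs : (S ^ (1 / 2 : ℝ)) ^ 2 = S := by
    rw [← ENNReal.rpow_natCast, ← ENNReal.rpow_mul]; norm_num
  have ha : ∀ j, a j ≤ w j * S ^ (1 / 2 : ℝ) := by
    intro j
    calc a j = w j * (v j * a j) := by rw [← mul_assoc, h, one_mul]
      _ ≤ _ := by
        gcongr
        refine (ENNReal.pow_le_pow_left_iff two_ne_zero).1 ?_
        rw [hs]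
        exact ENNReal.le_tsum (f := fun j => (v j * a j) ^ 2) j
  calc _ ≤ (∑' j, w j * S ^ (1 / 2 : ℝ)) ^ 2 := by
        gcongr; exact ha _
    _ = _ := by rw [ENNReal.tsum_mul_right, mul_pow, hs]

/-- Weights `ρ ^ j` cost `ρ ^ (-2 j)` against the decay `ρ ^ (4 j)`, and `ρ ^ (2 j)` remains
summable. -/
theorem exists_lintegral_sq_tsum_le {Ω : Type*} [MeasurableSpace Ω] (μ : Measure Ω) {ρ : ℝ≥0}
    (hρ0 : ρ ≠ 0) (hρ1 : ρ < 1) (K : ℝ≥0) : ∃ K' : ℝ≥0∞, K' ≠ ∞ ∧ ∀ g : ℕ → Ω → ℝ≥0∞,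
      (∀ j, Measurable (g j)) → (∀ j, ∫⁻ t, g j t ^ 2 ∂μ ≤ K * ((ρ : ℝ≥0∞) ^ 4) ^ j) →
      ∫⁻ t, (∑' j, g j t) ^ 2 ∂μ ≤ K' := by
  have hρ1' : (ρ : ℝ≥0∞) < 1 := by exact_mod_cast hρ1
  have hρ0' : (ρ : ℝ≥0∞) ≠ 0 := by exact_mod_cast hρ0
  have hfin : ∀ r : ℝ≥0∞, r < 1 → (∑' j : ℕ, r ^ j) ≠ ∞ := by
    intro r hr
    rw [ENNReal.tsum_geometric]
    exact ENNReal.inv_ne_top.2 (tsub_pos_of_lt hr).ne'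
  refine ⟨(∑' j : ℕ, (ρ : ℝ≥0∞) ^ j) ^ 2 * (K * ∑' j : ℕ, ((ρ : ℝ≥0∞) ^ 2) ^ j),
    ENNReal.mul_ne_top (ENNReal.pow_ne_top (hfin _ hρ1'))
      (ENNReal.mul_ne_top ENNReal.coe_ne_top (hfin _ (pow_lt_one₀ zero_le hρ1' two_ne_zero))),
    fun g hg h => ?_⟩
  have hinv : ∀ j : ℕ, (ρ : ℝ≥0∞) ^ j * ((ρ : ℝ≥0∞)⁻¹) ^ j = 1 := fun j => by
    rw [← mul_pow, ENNReal.mul_inv_cancel hρ0' ENNReal.coe_ne_top, one_pow]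
  calc _ ≤ ∫⁻ t, (∑' j : ℕ, (ρ : ℝ≥0∞) ^ j) ^ 2 *
          ∑' j, (((ρ : ℝ≥0∞)⁻¹) ^ j * g j t) ^ 2 ∂μ :=
        lintegral_mono fun t => sq_tsum_le_of_weights _ _ _ hinv
    _ = (∑' j : ℕ, (ρ : ℝ≥0∞) ^ j) ^ 2 *
          ∑' j, ∫⁻ t, (((ρ : ℝ≥0∞)⁻¹) ^ j * g j t) ^ 2 ∂μ := by
        rw [lintegral_const_mul _ (.tsum fun j => ((hg j).const_mul _).pow_const 2),
          lintegral_tsum fun j => (((hg j).const_mul _).pow_const 2).aemeasurable]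
    _ ≤ _ := by
        rw [← ENNReal.tsum_mul_left (a := (K : ℝ≥0∞))]
        gcongr with j
        simp_rw [mul_pow]
        rw [lintegral_const_mul _ ((hg j).pow_const 2)]
        calc _ ≤ ((((ρ : ℝ≥0∞)⁻¹) ^ j) ^ 2) * (K * ((ρ : ℝ≥0∞) ^ 4) ^ j) := by
              gcongr; exact h j
          _ = K * ((ρ : ℝ≥0∞) ^ 2) ^ j * ((ρ : ℝ≥0∞) ^ j * ((ρ : ℝ≥0∞)⁻¹) ^ j) ^ 2 := by ring
          _ = _ := by rw [hinv]; simp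

/-- The dyadic level sets of `‖f‖`, all values at least `1` being collected in the first one. -/
def dyadicLevel (f : ℚ_[p] → ℂ) : ℕ → Set ℚ_[p] :=
  disjointed fun j => {x | (2 ^ j : ℝ)⁻¹ ≤ ‖f x‖}

theorem measurableSet_dyadicLevel {f : ℚ_[p] → ℂ} (hf : Measurable f) (j : ℕ) :
    MeasurableSet (dyadicLevel f j) :=
  MeasurableSet.disjointed (fun _ => measurableSet_le measurable_const hf.norm) j

theorem inv_le_norm_of_mem_dyadicLevel {f : ℚ_[p] → ℂ} {j : ℕ} {x : ℚ_[p]}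
    (hx : x ∈ dyadicLevel f j) : (2 ^ j : ℝ)⁻¹ ≤ ‖f x‖ :=
  disjointed_le (fun j => {x | (2 ^ j : ℝ)⁻¹ ≤ ‖f x‖}) j hx

theorem norm_lt_of_mem_dyadicLevel_succ {f : ℚ_[p] → ℂ} {j : ℕ} {x : ℚ_[p]}
    (hx : x ∈ dyadicLevel f (j + 1)) : ‖f x‖ < 2 * (2 ^ (j + 1) : ℝ)⁻¹ := by
  have hmono : Monotone fun j : ℕ => {x | (2 ^ j : ℝ)⁻¹ ≤ ‖f x‖} := fun i j hij x hx =>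
    le_trans (inv_anti₀ (by positivity) (pow_le_pow_right₀ one_le_two hij) :
      (2 ^ j : ℝ)⁻¹ ≤ (2 ^ i : ℝ)⁻¹) hx
  rw [dyadicLevel, hmono.disjointed_add_one] at hx
  have : ‖f x‖ < (2 ^ j : ℝ)⁻¹ := lt_of_not_ge hx.2
  rwa [show 2 * (2 ^ (j + 1) : ℝ)⁻¹ = (2 ^ j : ℝ)⁻¹ by rw [pow_succ]; field_simp]

theorem eq_zero_of_notMem_dyadicLevel {f : ℚ_[p] → ℂ} {x : ℚ_[p]}
    (hx : x ∉ ⋃ j, dyadicLevel f j) : f x = 0 := by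
  by_contra h
  refine hx ?_
  rw [dyadicLevel, iUnion_disjointed]
  obtain ⟨j, hj⟩ := exists_pow_lt_of_lt_one (norm_pos_iff.2 h) (by norm_num : (2 : ℝ)⁻¹ < 1)
  exact Set.mem_iUnion.2 ⟨j, by simpa [inv_pow] using hj.le⟩

theorem enorm_fourierFun_le_tsum {f : ℚ_[p] → ℂ} (hf : Integrable f (haar p)) (hfm : Measurable f)
    (t : ℚ_[p]) :
    ‖fourierFun f t‖ₑ ≤ ∑' j, ‖fourierFun ((dyadicLevel f j).indicator f) t‖ₑ := by
  have h := hasSum_integral_iUnion (measurableSet_dyadicLevel hfm)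
    (disjoint_disjointed fun j => {x | (2 ^ j : ℝ)⁻¹ ≤ ‖f x‖})
    (integrable_stdChar_mul hf t).integrableOn
  rw [setIntegral_eq_integral_of_forall_compl_eq_zero fun x hx => by
    rw [eq_zero_of_notMem_dyadicLevel hx, mul_zero]] at h
  have h2 : ∀ j, ∫ x in dyadicLevel f j, stdChar (x * t) * f x ∂haar p =
      fourierFun ((dyadicLevel f j).indicator f) t := by
    intro j
    rw [← integral_indicator (measurableSet_dyadicLevel hfm j), fourierFun]
    congr 1; ext x
    by_cases hx : x ∈ dyadicLevel f j <;> simp [hx]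
  simp_rw [h2] at h
  rw [fourierFun, ← h.tsum_eq]
  exact enorm_tsum_le_tsum_enorm

theorem haar_le_of_inv_le_norm {f : ℚ_[p] → ℂ} (hfm : Measurable f) {q Y : ℝ} (hq : 0 ≤ q)
    (hY : 0 < Y) (hf : ∫⁻ x, ‖f x‖ₑ ^ q ∂haar p ≤ 1) :
    haar p {x | Y⁻¹ ≤ ‖f x‖} ≤ ENNReal.ofReal (Y ^ q) := by
  have h1 := (mul_meas_ge_le_lintegral₀ (μ := haar p) (hfm.enorm.pow_const q).aemeasurable
    (ENNReal.ofReal Y⁻¹ ^ q)).trans hf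
  have h2 : {x | Y⁻¹ ≤ ‖f x‖} ⊆ {x | ENNReal.ofReal Y⁻¹ ^ q ≤ ‖f x‖ₑ ^ q} := fun x hx => by
    refine ENNReal.rpow_le_rpow ?_ hq
    rw [← ofReal_norm]
    exact ENNReal.ofReal_le_ofReal hx
  calc _ ≤ ENNReal.ofReal (Y ^ q) * (ENNReal.ofReal Y⁻¹ ^ q *
        haar p {x | ENNReal.ofReal Y⁻¹ ^ q ≤ ‖f x‖ₑ ^ q}) := by
        rw [← mul_assoc, ENNReal.ofReal_rpow_of_pos (by positivity),
          ← ENNReal.ofReal_mul (by positivity), ← Real.mul_rpow hY.le (by positivity),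
          mul_inv_cancel₀ hY.ne', Real.one_rpow, ENNReal.ofReal_one, one_mul,
          ← ENNReal.ofReal_rpow_of_pos (by positivity)]
        exact measure_mono h2
    _ ≤ ENNReal.ofReal (Y ^ q) * 1 := by gcongr
    _ = _ := mul_one _

/-- On this level the values are below `2 / Y`, and Chebyshev bounds its measure by `Y ^ q`. -/
theorem lintegral_pow_dyadicLevel_succ_le {f : ℚ_[p] → ℂ} (hfm : Measurable f) {q : ℝ}
    (hq : 0 ≤ q) (hf : ∫⁻ x, ‖f x‖ₑ ^ q ∂haar p ≤ 1) (j n : ℕ) (hn : n ≠ 0) :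
    ∫⁻ x, ‖(dyadicLevel f (j + 1)).indicator f x‖ₑ ^ n ∂haar p ≤
      ENNReal.ofReal (2 ^ n * ((2 : ℝ) ^ (j + 1)) ^ (q - n)) := by
  set Y : ℝ := 2 ^ (j + 1) with hYdef
  have hY : 0 < Y := by positivity
  calc _ ≤ ∫⁻ x, (dyadicLevel f (j + 1)).indicator
          (fun _ => ENNReal.ofReal ((2 * Y⁻¹) ^ n)) x ∂haar p := by
        refine lintegral_mono fun x => ?_
        by_cases hx : x ∈ dyadicLevel f (j + 1)
        · simp only [hx, Set.indicator_of_mem]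
          rw [← ofReal_norm, ← ENNReal.ofReal_pow (norm_nonneg _)]
          gcongr
          exact (norm_lt_of_mem_dyadicLevel_succ hx).le
        · simp [hx, hn]
    _ = ENNReal.ofReal ((2 * Y⁻¹) ^ n) * haar p (dyadicLevel f (j + 1)) := by
        rw [lintegral_indicator_const (measurableSet_dyadicLevel hfm _)]
    _ ≤ ENNReal.ofReal ((2 * Y⁻¹) ^ n) * ENNReal.ofReal (Y ^ q) := by
        gcongr
        refine (measure_mono fun x hx => ?_).trans (haar_le_of_inv_le_norm hfm hq hY hf)
        exact inv_le_norm_of_mem_dyadicLevel hx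
    _ = _ := by
        rw [← ENNReal.ofReal_mul (by positivity), Real.rpow_sub hY, Real.rpow_natCast, mul_pow,
          inv_pow, mul_assoc, div_eq_inv_mul]

/-- Here `|f| ≥ 1`, so `|f| ≤ |f| ^ q`. Large values thus need no dyadic splitting: the `L¹` norm
already bounds the transform by `1`. -/
theorem lintegral_dyadicLevel_zero_le {f : ℚ_[p] → ℂ} {q : ℝ} (hq : 1 ≤ q)
    (hf : ∫⁻ x, ‖f x‖ₑ ^ q ∂haar p ≤ 1) :
    ∫⁻ x, ‖(dyadicLevel f 0).indicator f x‖ₑ ∂haar p ≤ 1 := by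
  refine (lintegral_mono fun x => ?_).trans hf
  by_cases hx : x ∈ dyadicLevel f 0
  · simp only [hx, Set.indicator_of_mem]
    have h1 : (1 : ℝ≥0∞) ≤ ‖f x‖ₑ := by
      rw [← ofReal_norm, ← ENNReal.ofReal_one]
      exact ENNReal.ofReal_le_ofReal (by simpa using inv_le_norm_of_mem_dyadicLevel hx)
    simpa using ENNReal.rpow_le_rpow_of_exponent_le h1 hq
  · simp [hx]

theorem exists_restriction_bound_of_lintegral_le_one {μ : Measure ℚ_[p]} [IsProbabilityMeasure μ]
    (hμ : μ (Metric.closedBall 0 1)ᶜ = 0) {τ q C : ℝ} (hτ : 2 < τ) (hq : 1 ≤ q)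
    (hq' : q < 1 + 1 / (2 * τ - 3)) (hC : 0 < C)
    (hdecay : ∀ ξ : ℚ_[p], 1 ≤ ‖ξ‖ →
      ‖fourierMeasure μ ξ‖ ≤ C * (‖ξ‖ ^ (-1 / τ) * Real.log (1 + ‖ξ‖) ^ 2))
    (hball : ∀ (x : ℚ_[p]) (r : ℝ), 0 < r → r ≤ 1 →
      μ.real (Metric.closedBall x r) ≤ C * (r ^ (2 / τ) * Real.log (1 + r⁻¹) ^ 2)) :
    ∃ K : ℝ≥0∞, K ≠ ∞ ∧ ∀ f : ℚ_[p] → ℂ, Integrable f (haar p) → Measurable f →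
      ∫⁻ x, ‖f x‖ₑ ^ q ∂haar p ≤ 1 → ∫⁻ t, ‖fourierFun f t‖ₑ ^ 2 ∂μ ≤ K := by
  obtain ⟨δ, hδ, K, hK, h⟩ := exists_restriction_scale_bound hμ hτ hq hq' hC hdecay hball
  set ρ : ℝ≥0 := (2 : ℝ≥0) ^ (-(δ / 4)) with hρ
  have hρ0 : ρ ≠ 0 := (NNReal.rpow_pos (by norm_num)).ne'
  have hρ1 : ρ < 1 := NNReal.rpow_lt_one_of_one_lt_of_neg (by norm_num) (by linarith)
  have hρ4 : (ρ : ℝ) ^ 4 = (2 : ℝ) ^ (-δ) := by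
    rw [hρ, NNReal.coe_rpow, ← Real.rpow_natCast, ← Real.rpow_mul (by norm_num)]
    congr 1; push_cast; ring
  -- The added `1` lets the same constant cover level `0`, whose contribution is at most `1`.
  obtain ⟨K', hK', hsum⟩ := exists_lintegral_sq_tsum_le μ hρ0 hρ1 (K.toNNReal + 1)
  refine ⟨K', hK', fun f hf hfm hfq => ?_⟩
  have hfi : ∀ j, Integrable ((dyadicLevel f j).indicator f) (haar p) := fun j =>
    hf.indicator (measurableSet_dyadicLevel hfm j)
  have hq0 : 0 ≤ q := by linarith
  refine le_trans (lintegral_mono fun t => ?_) (hsum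
    (fun j t => ‖fourierFun ((dyadicLevel f j).indicator f) t‖ₑ)
    (fun j => (continuous_fourierFun (hfi j)).measurable.enorm) fun j => ?_)
  · exact pow_le_pow_left' (enorm_fourierFun_le_tsum hf hfm t) 2
  · rcases j with _ | j
    · calc _ ≤ ∫⁻ _, (1 : ℝ≥0∞) ∂μ := by
            refine lintegral_mono fun t => pow_le_one' ?_ 2
            exact (enorm_fourierFun_le _ t).trans (lintegral_dyadicLevel_zero_le hq hfq)
        _ ≤ _ := by simp
    · have hb := h (2 ^ (j + 1)) (one_le_pow₀ (by norm_num)) _ (hfi (j + 1))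
        (hfm.indicator (measurableSet_dyadicLevel hfm _))
        ((lintegral_pow_dyadicLevel_succ_le hfm hq0 hfq j 2 two_ne_zero).trans
          (by norm_num))
        (by simpa using lintegral_pow_dyadicLevel_succ_le hfm hq0 hfq j 1 one_ne_zero)
      refine hb.trans ?_
      have h3 : ((2 : ℝ) ^ (j + 1)) ^ (-δ) = ((ρ : ℝ) ^ 4) ^ (j + 1) := by
        rw [hρ4, ← Real.rpow_natCast, ← Real.rpow_natCast, ← Real.rpow_mul (by norm_num),
          ← Real.rpow_mul (by norm_num), mul_comm]
      rw [h3, ENNReal.ofReal_mul hK.le, ENNReal.ofReal_pow (by positivity),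
        ENNReal.ofReal_pow (by positivity), ENNReal.ofReal_coe_nnreal]
      have h4 : ENNReal.ofReal K ≤ ((K.toNNReal + 1 : ℝ≥0) : ℝ≥0∞) :=
        ENNReal.coe_le_coe.2 (le_add_of_nonneg_right zero_le)
      gcongr

theorem fourierFun_congr_ae {f g : ℚ_[p] → ℂ} (h : f =ᵐ[haar p] g) :
    fourierFun f = fourierFun g := by
  ext s
  exact integral_congr_ae (h.mono fun x hx => by simp [hx])

theorem fourierFun_const_mul (c : ℂ) (f : ℚ_[p] → ℂ) (s : ℚ_[p]) :
    fourierFun (fun x => c * f x) s = c * fourierFun f s := by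
  rw [fourierFun, fourierFun, ← integral_const_mul]
  congr 1; ext x; ring

theorem exists_restriction_bound {μ : Measure ℚ_[p]} [IsProbabilityMeasure μ]
    (hμ : μ (Metric.closedBall 0 1)ᶜ = 0) {τ q C : ℝ} (hτ : 2 < τ) (hq : 1 ≤ q)
    (hq' : q < 1 + 1 / (2 * τ - 3)) (hC : 0 < C)
    (hdecay : ∀ ξ : ℚ_[p], 1 ≤ ‖ξ‖ →
      ‖fourierMeasure μ ξ‖ ≤ C * (‖ξ‖ ^ (-1 / τ) * Real.log (1 + ‖ξ‖) ^ 2))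
    (hball : ∀ (x : ℚ_[p]) (r : ℝ), 0 < r → r ≤ 1 →
      μ.real (Metric.closedBall x r) ≤ C * (r ^ (2 / τ) * Real.log (1 + r⁻¹) ^ 2)) :
    ∃ C' : ℝ≥0, ∀ f : ℚ_[p] → ℂ, MemLp f (ENNReal.ofReal q) (haar p) → MemLp f 1 (haar p) →
      (∫⁻ x, ‖fourierFun f x‖ₑ ^ 2 ∂μ) ^ (1 / 2 : ℝ) ≤
        C' * eLpNorm f (ENNReal.ofReal q) (haar p) := by
  obtain ⟨K, hK, h⟩ := exists_restriction_bound_of_lintegral_le_one hμ hτ hq hq' hC hdecay hball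
  have hq0 : 0 < q := by linarith
  have hq00 : ENNReal.ofReal q ≠ 0 := (ENNReal.ofReal_pos.2 hq0).ne'
  refine ⟨(K ^ (1 / 2 : ℝ)).toNNReal, fun f hfq hf1 => ?_⟩
  rw [ENNReal.coe_toNNReal (ENNReal.rpow_ne_top_of_nonneg (by norm_num) hK)]
  have hfi : Integrable f (haar p) := memLp_one_iff_integrable.1 hf1
  set N := eLpNorm f (ENNReal.ofReal q) (haar p) with hN
  rcases eq_or_ne N 0 with h0 | h0
  · have hf0 : f =ᵐ[haar p] 0 := (eLpNorm_eq_zero_iff hf1.aestronglyMeasurable hq00).1 h0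
    have : fourierFun f = 0 := by
      rw [fourierFun_congr_ae hf0]; ext s; simp [fourierFun]
    simp [this]
  have hNtop : N ≠ ∞ := hfq.eLpNorm_ne_top
  have hN0 : 0 < N.toReal := ENNReal.toReal_pos h0 hNtop
  -- The level sets require a measurable representative; the Fourier transform does not see the
  -- change.
  set f' := hf1.aestronglyMeasurable.mk f
  have hff' : f =ᵐ[haar p] f' := hf1.aestronglyMeasurable.ae_eq_mk
  have hf'm : Measurable f' := hf1.aestronglyMeasurable.stronglyMeasurable_mk.measurable
  have hf'i : Integrable f' (haar p) := hfi.congr hff'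
  -- Both sides are homogeneous in `f`, so the `L^q` norm may be normalised to `1`.
  set c : ℂ := ((N.toReal⁻¹ : ℝ) : ℂ) with hc
  have hce : ‖c‖ₑ = N⁻¹ := by
    rw [hc, ← ofReal_norm, Complex.norm_real, Real.norm_of_nonneg (by positivity),
      ENNReal.ofReal_inv_of_pos hN0, ENNReal.ofReal_toReal hNtop]
  have hone : ∫⁻ x, ‖c * f' x‖ₑ ^ q ∂haar p ≤ 1 := by
    have h1 : N = (∫⁻ x, ‖f' x‖ₑ ^ q ∂haar p) ^ (1 / q) := by
      rw [hN, eLpNorm_congr_ae hff', eLpNorm_eq_lintegral_rpow_enorm_toReal hq00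
        ENNReal.ofReal_ne_top, ENNReal.toReal_ofReal hq0.le]
    have h2 : ∫⁻ x, ‖f' x‖ₑ ^ q ∂haar p = N ^ q := by
      rw [h1, ← ENNReal.rpow_mul, one_div, inv_mul_cancel₀ hq0.ne', ENNReal.rpow_one]
    simp_rw [enorm_mul, ENNReal.mul_rpow_of_nonneg _ _ hq0.le]
    rw [lintegral_const_mul _ (hf'm.enorm.pow_const q), h2, hce,
      ← ENNReal.mul_rpow_of_nonneg _ _ hq0.le, ENNReal.inv_mul_cancel h0 hNtop, ENNReal.one_rpow]
  have hb := h _ (hf'i.const_mul c) (hf'm.const_mul c) hone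
  simp_rw [fourierFun_const_mul, enorm_mul, mul_pow] at hb
  rw [lintegral_const_mul _ ((continuous_fourierFun hf'i).measurable.enorm.pow_const 2), hce,
    ← fourierFun_congr_ae hff'] at hb
  have hfin : ∫⁻ x, ‖fourierFun f x‖ₑ ^ 2 ∂μ ≤ K * N ^ 2 := by
    calc _ = N ^ 2 * (N⁻¹ ^ 2 * ∫⁻ x, ‖fourierFun f x‖ₑ ^ 2 ∂μ) := by
          rw [← mul_assoc, ← mul_pow, ENNReal.mul_inv_cancel h0 hNtop, one_pow, one_mul]
      _ ≤ N ^ 2 * K := by gcongr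
      _ = _ := mul_comm _ _
  calc _ ≤ (K * N ^ 2) ^ (1 / 2 : ℝ) := ENNReal.rpow_le_rpow hfin (by norm_num)
    _ = _ := by
      rw [ENNReal.mul_rpow_of_nonneg _ _ (by norm_num), ← ENNReal.rpow_natCast N,
        ← ENNReal.rpow_mul]
      norm_num

/-! ### The Fourier dimension and the conclusion. -/

theorem measure_compl_closedBall_eq_zero {τ : ℝ} {μ : Measure ℚ_[p]}
    (hμ : μ ∈ probOn (wellApprox p τ)) : μ (Metric.closedBall 0 1)ᶜ = 0 := by
  refine measure_mono_null ?_ (Measure.measure_compl_support (μ := μ))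
  exact Set.compl_subset_compl.2 fun x hx => by simpa using (hμ.2.2 hx).1

theorem exists_norm_sq_fourierMeasure_mul_rpow_le {μ : Measure ℚ_[p]} [IsProbabilityMeasure μ]
    {a C β : ℝ} (hC : 0 < C) (hβ : 0 ≤ β) (hβa : β < 2 * a)
    (hdecay : ∀ ξ : ℚ_[p], 1 ≤ ‖ξ‖ →
      ‖fourierMeasure μ ξ‖ ≤ C * (‖ξ‖ ^ (-a) * Real.log (1 + ‖ξ‖) ^ 2)) :
    ∃ K : ℝ, ∀ ξ : ℚ_[p], ξ ≠ 0 → ‖fourierMeasure μ ξ‖ ^ 2 * ‖ξ‖ ^ β ≤ K := by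
  obtain ⟨L, hL, hlog⟩ := exists_log_sq_le_rpow (ε := a - β / 2) (by linarith)
  refine ⟨max 1 ((C * L) ^ 2), fun ξ hξ => ?_⟩
  have hξ0 : 0 < ‖ξ‖ := norm_pos_iff.2 hξ
  rcases le_total 1 ‖ξ‖ with h1 | h1
  · refine le_max_of_le_right ?_
    have : ‖fourierMeasure μ ξ‖ ≤ C * L * ‖ξ‖ ^ (-(β / 2)) := by
      calc _ ≤ C * (‖ξ‖ ^ (-a) * Real.log (1 + ‖ξ‖) ^ 2) := hdecay ξ h1
        _ ≤ C * (‖ξ‖ ^ (-a) * (L * ‖ξ‖ ^ (a - β / 2))) := by gcongr; exact hlog _ h1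
        _ = C * L * (‖ξ‖ ^ (-a) * ‖ξ‖ ^ (a - β / 2)) := by ring
        _ = _ := by rw [← Real.rpow_add hξ0]; congr 2; ring
    calc _ ≤ (C * L * ‖ξ‖ ^ (-(β / 2))) ^ 2 * ‖ξ‖ ^ β := by gcongr
      _ = (C * L) ^ 2 * (‖ξ‖ ^ (-(β / 2)) * ‖ξ‖ ^ (-(β / 2)) * ‖ξ‖ ^ β) := by ring
      _ = (C * L) ^ 2 := by
        rw [← Real.rpow_add hξ0, ← Real.rpow_add hξ0]
        ring_nf
        rw [Real.rpow_zero, mul_one]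
  · refine le_max_of_le_left ?_
    exact mul_le_one₀ (pow_le_one₀ (norm_nonneg _) (norm_fourierMeasure_le_one μ ξ))
      (by positivity) (Real.rpow_le_one hξ0.le h1 hβ)

/-- The logarithm may prevent the supremum from being attained by this measure, so only exponents `β
< 2 / τ` are produced. The upper bound passes through the Hausdorff dimension. -/
theorem fourierDim_wellApprox {τ C : ℝ} (hτ : 2 < τ) (hC : 0 < C) {μ : Measure ℚ_[p]}
    (hμ : μ ∈ probOn (wellApprox p τ))
    (hdecay : ∀ ξ : ℚ_[p], 1 ≤ ‖ξ‖ →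
      ‖fourierMeasure μ ξ‖ ≤ C * (‖ξ‖ ^ (-1 / τ) * Real.log (1 + ‖ξ‖) ^ 2)) :
    fourierDim (wellApprox p τ) = 2 / τ := by
  have hprob : IsProbabilityMeasure μ := hμ.1
  have hτ0 : 0 < τ := by linarith
  have hτ1 : 2 / τ < 1 := (div_lt_one hτ0).2 hτ
  have hmem : ∀ β : ℝ, 0 ≤ β → β < 2 / τ → β ∈ {β : ℝ | 0 ≤ β ∧ β ≤ 1 ∧
      ∃ μ ∈ probOn (wellApprox p τ), ∃ C : ℝ, ∀ ξ : ℚ_[p], ξ ≠ 0 →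
        ‖fourierMeasure μ ξ‖ ^ 2 * ‖ξ‖ ^ β ≤ C} := by
    intro β h0 h1
    refine ⟨h0, by linarith, μ, hμ, ?_⟩
    refine exists_norm_sq_fourierMeasure_mul_rpow_le (a := 1 / τ) hC h0 ?_ ?_
    · rwa [mul_one_div]
    · rwa [← neg_div]
  refine csSup_eq_of_forall_le_of_forall_lt_exists_gt ⟨0, hmem 0 le_rfl (by positivity)⟩ ?_ ?_
  · rintro β ⟨h0, h1, ν, hν, K, hK⟩
    have := (ofReal_le_dimH_of_fourier_decay hν h1 hK).trans (dimH_wellApprox_le hτ)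
    exact (ENNReal.ofReal_le_ofReal_iff (by positivity)).1 this
  · intro w hw
    obtain ⟨β, hβ1, hβ2⟩ := exists_between (max_lt hw (by positivity : (0 : ℝ) < 2 / τ))
    exact ⟨β, hmem β ((le_max_right _ _).trans hβ1.le) hβ2, (le_max_left _ _).trans_lt hβ1⟩

end PadicSalem

end

open PadicSalem in
theorem theorem1 (p : ℕ) [Fact p.Prime] :
    ∃ C : ℝ, 0 < C ∧ ∀ τ : ℝ, 2 < τ →
      IsSalem (wellApprox p τ) ∧
      dimH (wellApprox p τ) = ENNReal.ofReal (2 / τ) ∧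
      fourierDim (wellApprox p τ) = 2 / τ ∧
      ∃ μ ∈ probOn (wellApprox p τ),
        (∀ ξ : ℚ_[p], 1 ≤ ‖ξ‖ →
          ‖fourierMeasure μ ξ‖ ≤ C * (‖ξ‖ ^ (-1 / τ) * Real.log (1 + ‖ξ‖) ^ 2)) ∧
        (∀ (x : ℚ_[p]) (r : ℝ), 0 < r → r ≤ 1 →
          μ.real (Metric.closedBall x r) ≤ C * (r ^ (2 / τ) * Real.log (1 + r⁻¹) ^ 2)) ∧
        (∀ q : ℝ, 1 ≤ q → q < 1 + 1 / (2 * τ - 3) →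
          ∃ C' : ℝ≥0, ∀ f : ℚ_[p] → ℂ,
            MemLp f (ENNReal.ofReal q) (haar p) → MemLp f 1 (haar p) →
            (∫⁻ x, ‖fourierFun f x‖ₑ ^ 2 ∂μ) ^ (1 / 2 : ℝ) ≤
              C' * eLpNorm f (ENNReal.ofReal q) (haar p)) := by
  obtain ⟨C, hC, h⟩ := exists_salem_measure p
  refine ⟨C, hC, fun τ hτ => ?_⟩
  obtain ⟨μ, hμ, hdecay, hball⟩ := h τ hτ
  have hprob : IsProbabilityMeasure μ := hμ.1
  have hH : dimH (wellApprox p τ) = ENNReal.ofReal (2 / τ) :=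
    (dimH_wellApprox_le hτ).antisymm (ofReal_le_dimH_of_ball_condition hμ hC hball)
  have hF : fourierDim (wellApprox p τ) = 2 / τ := fourierDim_wellApprox hτ hC hμ hdecay
  exact ⟨by rw [IsSalem, hH, hF], hH, hF, μ, hμ, hdecay, hball, fun q hq hq' =>
    exists_restriction_bound (measure_compl_closedBall_eq_zero hμ) hτ hq hq' hC hdecay hball⟩
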